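/- **Setting.** Let $b_1,\dots,b_r$ have degree $2$, $q_1,\dots,q_r$ degree $4$ and $h$ degree $2$. Put $\partial_a=\partial/\partial t_a=q_a\,\partial/\partial q_a$ with $q_a=e^{t_a}$, and let $D^h$ be the algebra of differential operators generated by $h\partial_1,\dots,h\partial_r$ with coefficients in $\mathbf C[q_1,\dots,q_r,h]$. Let $\mathcal R_k(b,q)$ be polynomials (for instance the relations of the quantum cohomology algebra $QH^*G/B=\mathbf C[b,q]/(\mathcal R_k)$ of a flag manifold), and let $D_k^h\in D^h$ be operators whose symbols $S(D^h_k)\in\mathbf C[b,q,h]$ (coefficients on the left, $h\partial_a$ replaced by $b_a$) are homogeneous, equal $\mathcal R_k(b,q)$ at $h=0$, and equal $\mathcal R_k(b,0)$ at $q=0$ (so they do not involve $h$ at $q=0$). Suppose that $M^h=D^h/(D^h_k)$, the quotient by the left ideal generated by the $D^h_k$, is free over $\mathbf C[q,h]$ with a finite basis $[P_j]$, where each $P_j$ is a monomial in $h\partial_1,\dots,h\partial_r$. (For $G/B$ one takes the quantum Toda lattice.) Let $\deg P_j$ be the number of factors of $P_j$ and $m=\max_j\deg P_j$; for $G/B$,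 $m=\dim_{\mathbf C}G/B$. Matrices indexed by the basis are divided into blocks: block $(\alpha,\beta)$ consists of the entries $(j,k)$ with $\deg P_j=\alpha$, $\deg P_k=\beta$. A matrix is $l$-triangular if its $(\alpha,\beta)$ block vanishes whenever $\beta<\alpha+l$; $A^{[l]}$ denotes the part of $A$ in the blocks with $\beta=\alpha+l$. Define $\Omega^h=\sum_a\Omega^h_a\,dt_a$ by $[h\partial_aP_j]=\sum_k(h\Omega^h_a)_{kj}[P_k]$ and write $\Omega^h=\frac1h\omega+\theta^{(0)}+h\theta^{(1)}+\cdots$. Consider solutions $L$ of $L^{-1}dL=\Omega^h$, holomorphic in $t\in\mathbf C^r$ with values in the group of smooth loops $\{|h|=1\}\to GL$, together with a Birkhoff factorization $L=L_-L_+$ over $\{t: |e^{t_a}|<\rho \text{ for all } a\}$ for some $\rho>0$, with $L_-=I+h^{-1}A_1+h^{-2}A_2+\cdots$ and $L_+=B_0(q)+hB_1(q)+\cdots$ (the inverses of these loops having expansions of the same kinds), such that $L_+$ extends holomorphically in $q$ (with $(q,h)\mapsto L_+(q,h)$ continuous) to $|q_a|<\rho$, with factors of the same kind, and is normalized by $L_+|_{q=0}=I$.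 **Proposition 2.2.** For every $\rho>0$ such $L=L_-L_+$ exists, and $L_+$ is unique: there are matrices $Q_0,Q_1,Q_2,\dots$ of polynomials in $q_1,\dots,q_r$ such that every such $L_+$ equals $Q_0(I+hQ_1+h^2Q_2+\cdots)$, that is, $B_0=Q_0$ and $B_i=Q_0Q_i$ for $i\ge1$. Moreover: 1. $Q_0=\exp X$, where $X$ is a $2$-triangular matrix of polynomials in $q_1,\dots,q_r$; 2. for $i\ge1$, $Q_i$ is $(i+2)$-triangular; 3. for $i\ge0$, each entry of $(Q_i)_{\alpha,\beta}$ is either zero or homogeneous of degree $2(\beta-\alpha-i)$. In particular $Q_i=0$ for $i\ge1$, $i>m-2$, so that $L_+=Q_0(I+hQ_1+\dots+h^{m-2}Q_{m-2})$ (and $L_+=Q_0$ if $m\le2$). Finally, the $Q_i$ satisfy the system $$dQ_0=Q_0(\theta^{(0)}+[Q_1,\omega]),\qquad dQ_i=\theta^{(i)}+\sum_{k=1}^{i-1}Q_k\theta^{(i-k)}+[Q_i,\theta^{(0)}]+[Q_{i+1},\omega]-[Q_1,\omega]Q_i\quad(i\ge1)$$ with $Q_0=I$, $Q_i=0$ $(i\ge1)$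 at $q=0$, and this system can be solved successively by quadrature, as follows. Order the unknowns $Q_i^{[j]}$ $(2\le i+2\le j\le m)$ by $Q_{i_1}^{[j_1]}<Q_{i_2}^{[j_2]}$ if and only if $j_1-i_1<j_2-i_2$, or $j_1-i_1=j_2-i_2$ and $j_2<j_1$. Then, for families of polynomial matrices such that $Q_0-I$ is $2$-triangular and $Q_i$ is $(i+2)$-triangular for $i\ge1$: the $[j]$-part $E=\sum_aE_a\,dt_a$ of the right hand side of the equation for $dQ_i$ depends only on the unknowns smaller than $Q_i^{[j]}$; if these smaller unknowns satisfy their equations and vanish at $q=0$, then $E$ is closed, and the unique matrix of polynomials $Y$ with $dY=E$ and $Y|_{q=0}=0$ is $Q_i^{[j]}$, given by $Q_i^{[j]}(q)=\int_0^1\sum_aE_a(xq)\,\frac{dx}{x}$. -/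

import Mathlib

open scoped ContDiff

noncomputable section

namespace QuantumDModule

/-! ### The ring of differential operators and the D-module of a set of relations -/

/-- The polynomial ring `ℂ[q₁,…,q_r,h]`: the variable `some i` is `q_i`, the variable `none` is `h`. -/
abbrev Coeff (r : ℕ) : Type := MvPolynomial (Option (Fin r)) ℂ

/-- The polynomial ring `ℂ[q₁,…,q_r]`. -/
abbrev QPoly (r : ℕ) : Type := MvPolynomial (Fin r) ℂ

/-- The operator `h∂_i` on `ℂ[q,h]`, where `∂_i = q_i ∂/∂q_i`. -/
def hPartialEnd {r : ℕ} (i : Fin r) : Module.End ℂ (Coeff r) :=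
  LinearMap.mulLeft ℂ (MvPolynomial.X none * MvPolynomial.X (some i)) ∘ₗ
    (MvPolynomial.pderiv (some i)).toLinearMap

/-- The algebra of differential operators generated by `h∂₁,…,h∂_r` with coefficients
in `ℂ[q₁,…,q_r,h]`, realised through its faithful action on `ℂ[q,h]`. -/
def diffOps (r : ℕ) : Subalgebra ℂ (Module.End ℂ (Coeff r)) :=
  Algebra.adjoin ℂ (Set.range (Algebra.lmul ℂ (Coeff r)) ∪ Set.range hPartialEnd)

/-- The algebra `D^h`, as a type. -/
def Dh (r : ℕ) : Type := diffOps r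

instance (r : ℕ) : Ring (Dh r) := inferInstanceAs (Ring (diffOps r))

instance (r : ℕ) : Algebra ℂ (Dh r) := inferInstanceAs (Algebra ℂ (diffOps r))

/-- The element `h∂_i` of `D^h`. -/
def hPartial {r : ℕ} (i : Fin r) : Dh r :=
  (⟨hPartialEnd i, Algebra.subset_adjoin (Or.inr ⟨i, rfl⟩)⟩ : diffOps r)

/-- The inclusion of the coefficient ring `ℂ[q,h]` in `D^h`, as multiplication operators. -/
def coeffHom (r : ℕ) : Coeff r →ₐ[ℂ] Dh r :=
  (Algebra.lmul ℂ (Coeff r)).codRestrict (diffOps r)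
    (fun f => Algebra.subset_adjoin (Or.inl ⟨f, rfl⟩))

/-- The monomial `(h∂₁)^{n₁} ⋯ (h∂_r)^{n_r}`. -/
def monomialOp {r : ℕ} (n : Fin r →₀ ℕ) : Dh r :=
  (List.ofFn fun i => hPartial i ^ n i).prod

/-- The operator `∑ₙ fₙ(q,h) (h∂)ⁿ` obtained from the polynomial `∑ₙ fₙ(q,h) bⁿ` in
`b₁,…,b_r` by writing `h∂_i` for `b_i`, coefficients on the left. The polynomial `N` is the
symbol `S(D)` of the operator `D = opOfSymbol N`. -/
def opOfSymbol {r : ℕ} (N : MvPolynomial (Fin r) (Coeff r)) : Dh r :=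
  ∑ n ∈ N.support, coeffHom r (N.coeff n) * monomialOp n

/-- The cyclic left `D^h`-module `M^h = D^h / (D_k : k ∈ κ)`, where `D_k` has symbol `N k` and
`(D_k : k ∈ κ)` is the left ideal generated by the `D_k`. -/
def DMod {r : ℕ} {κ : Type*} (N : κ → MvPolynomial (Fin r) (Coeff r)) : Type :=
  Dh r ⧸ Submodule.span (Dh r) (Set.range fun k => opOfSymbol (N k))

instance {r : ℕ} {κ : Type*} (N : κ → MvPolynomial (Fin r) (Coeff r)) :
    AddCommGroup (DMod N) :=
  inferInstanceAs (AddCommGroup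
    (Dh r ⧸ Submodule.span (Dh r) (Set.range fun k => opOfSymbol (N k))))

instance {r : ℕ} {κ : Type*} (N : κ → MvPolynomial (Fin r) (Coeff r)) :
    Module (Dh r) (DMod N) :=
  inferInstanceAs (Module (Dh r)
    (Dh r ⧸ Submodule.span (Dh r) (Set.range fun k => opOfSymbol (N k))))

/-- `M^h` as a module over `ℂ[q,h]`. -/
instance {r : ℕ} {κ : Type*} (N : κ → MvPolynomial (Fin r) (Coeff r)) :
    Module (Coeff r) (DMod N) :=
  Module.compHom (DMod N) (coeffHom r).toRingHom

/-- The class `[D]` in `M^h` of an operator `D`. -/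
def DMod.mk {r : ℕ} {κ : Type*} (N : κ → MvPolynomial (Fin r) (Coeff r)) (D : Dh r) : DMod N :=
  Submodule.Quotient.mk (p := Submodule.span (Dh r) (Set.range fun k => opOfSymbol (N k))) D

/-! ### Quantizations -/

/-- Degrees of the variables of `ℂ[q,h]`: each `q_i` has degree `4`, and `h` has degree `2`. -/
def coeffDegree (r : ℕ) : Option (Fin r) → ℤ
  | none => 2
  | some _ => 4

/-- The operators with symbols `N k` are a (homogeneous) quantization of the relations `R k` in
`ℂ[b₁,…,b_r,q₁,…,q_r]`, as far as the relations are concerned. Each `N k` is homogeneous, where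
`b_i` has degree `2`, `q_i` has degree `4` and `h` has degree `2`; for `h = 0` it is `R k`; for
`q = 0` it is `R k` at `q = 0` (in particular it does not involve `h`). -/
structure IsQuantization {r : ℕ} {κ : Type*} (R : κ → MvPolynomial (Fin r) (QPoly r))
    (N : κ → MvPolynomial (Fin r) (Coeff r)) : Prop where
  homogeneous : ∀ k, ∃ d : ℤ, ∀ n : Fin r →₀ ℕ,
    MvPolynomial.IsWeightedHomogeneous (coeffDegree r) ((N k).coeff n) (d - 2 * (n.degree : ℤ))
  classical_limit : ∀ k,
    MvPolynomial.map (MvPolynomial.aeval (R := ℂ)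
      (fun o : Option (Fin r) => o.elim (0 : QPoly r) MvPolynomial.X)).toRingHom (N k) = R k
  at_q_zero : ∀ k,
    MvPolynomial.map (MvPolynomial.aeval (R := ℂ)
      (fun o : Option (Fin r) => o.elim (Polynomial.X : Polynomial ℂ) (fun _ => 0))).toRingHom
        (N k) =
    MvPolynomial.map ((Polynomial.C : ℂ →+* Polynomial ℂ).comp MvPolynomial.constantCoeff) (R k)

/-! ### The connection form -/

variable {r : ℕ} {κ ι : Type*} {N : κ → MvPolynomial (Fin r) (Coeff r)}

/-- The matrix `hΩ^h_a` of the action of `h∂_a` on `M^h` in the basis `P`: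
`[h∂_a P_j] = ∑_k (hΩ^h_a)_{kj} [P_k]`. -/
def hOmega (P : Module.Basis ι (Coeff r) (DMod N)) (a : Fin r) : Matrix ι ι (Coeff r) :=
  Matrix.of fun k j => P.repr (hPartial a • P j) k

/-- The coefficient of `h^n` of a polynomial in `ℂ[q,h]`. -/
def hCoeff (n : ℕ) (f : Coeff r) : QPoly r :=
  (MvPolynomial.optionEquivLeft ℂ (Fin r) f).coeff n

/-- `ω_a`, the coefficient of `h⁻¹` in `Ω^h_a`. -/
def omega (P : Module.Basis ι (Coeff r) (DMod N)) (a : Fin r) : Matrix ι ι (QPoly r) :=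
  (hOmega P a).map (hCoeff 0)

/-- `θ_a^{(i)}`, the coefficient of `h^i` in `Ω^h_a`, for `i ≥ 0`. -/
def theta (P : Module.Basis ι (Coeff r) (DMod N)) (i : ℕ) (a : Fin r) : Matrix ι ι (QPoly r) :=
  (hOmega P a).map (hCoeff (i + 1))

/-- The value of `Ω^h_a` at a point `q` and at `h` in the unit circle. -/
def Omega (P : Module.Basis ι (Coeff r) (DMod N)) (a : Fin r) (q : Fin r → ℂ) (h : Circle) :
    Matrix ι ι ℂ :=
  (h : ℂ)⁻¹ • (hOmega P a).map (MvPolynomial.eval fun o => o.elim (h : ℂ) q)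

/-! ### Loops and the Birkhoff factorization -/

/-- `g` is a smooth loop in the general linear group. -/
def IsSmoothLoop [Fintype ι] [DecidableEq ι] (g : Circle → Matrix ι ι ℂ) : Prop :=
  (∀ h, IsUnit (g h)) ∧ ∀ j k, ContDiff ℝ ∞ fun x : ℝ => g (Circle.exp x) j k

/-- `g(h) = B₀ + h B₁ + h² B₂ + ⋯` belongs to the subgroup `Λ₊` of loops which, together with
their inverses, have Fourier series with nonnegative powers of `h` only. -/
def IsPlusLoop [Fintype ι] [DecidableEq ι] (B : ℕ → Matrix ι ι ℂ) (g : Circle → Matrix ι ι ℂ) :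
    Prop :=
  IsSmoothLoop g ∧ (∀ h : Circle, HasSum (fun n => (h : ℂ) ^ n • B n) (g h)) ∧
    ∃ B' : ℕ → Matrix ι ι ℂ, ∀ h : Circle, HasSum (fun n => (h : ℂ) ^ n • B' n) (g h)⁻¹

/-- `g(h) = I + h⁻¹ A₁ + h⁻² A₂ + ⋯` belongs to the subgroup of loops which, together with
their inverses, have Fourier series with nonpositive powers of `h` only and constant term `I`. -/
def IsMinusLoop [Fintype ι] [DecidableEq ι] (g : Circle → Matrix ι ι ℂ) : Prop :=
  IsSmoothLoop g ∧
    (∃ A : ℕ → Matrix ι ι ℂ, A 0 = 1 ∧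
      ∀ h : Circle, HasSum (fun n => (h : ℂ)⁻¹ ^ n • A n) (g h)) ∧
    ∃ A' : ℕ → Matrix ι ι ℂ, A' 0 = 1 ∧
      ∀ h : Circle, HasSum (fun n => (h : ℂ)⁻¹ ^ n • A' n) (g h)⁻¹

/-- `L : ℂ^r → Λ GL` is a solution of `L⁻¹ dL = Ω^h`. Here `t₁,…,t_r` are the coordinates of
`ℂ^r`, and `q_a = exp t_a`. -/
structure IsSolution [Fintype ι] [DecidableEq ι] (P : Module.Basis ι (Coeff r) (DMod N))
    (L : (Fin r → ℂ) → Circle → Matrix ι ι ℂ) : Prop where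
  loop : ∀ t, IsSmoothLoop (L t)
  continuous : Continuous fun p : (Fin r → ℂ) × Circle => L p.1 p.2
  holomorphic : ∀ h j k, Differentiable ℂ fun t => L t h j k
  equation : ∀ t h a j k,
    fderiv ℂ (fun t' => L t' h j k) t (Pi.single a 1) =
      (L t h * Omega P a (fun b => Complex.exp (t b)) h) j k

/-- `L = L₋ L₊` is a Birkhoff factorization over the points `t` for which `q = exp t` lies in the
polydisc `|q_a| < ρ`; the factor `L₊(q,h) = B₀(q) + h B₁(q) + ⋯` is (after extension)
holomorphic in `q` on the whole polydisc, and normalized by `L₊ = I` at `q = 0`. -/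
structure IsNormalizedBirkhoff [Fintype ι] [DecidableEq ι] (ρ : ℝ)
    (L Lminus : (Fin r → ℂ) → Circle → Matrix ι ι ℂ)
    (Lplus : (Fin r → ℂ) → Circle → Matrix ι ι ℂ)
    (B : ℕ → (Fin r → ℂ) → Matrix ι ι ℂ) : Prop where
  minus_loop : ∀ t : Fin r → ℂ, (fun a => Complex.exp (t a)) ∈ Metric.ball (0 : Fin r → ℂ) ρ →
    IsMinusLoop (Lminus t)
  plus_loop : ∀ q ∈ Metric.ball (0 : Fin r → ℂ) ρ, IsPlusLoop (fun n => B n q) (Lplus q)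
  factorization : ∀ t : Fin r → ℂ,
    (fun a => Complex.exp (t a)) ∈ Metric.ball (0 : Fin r → ℂ) ρ →
    ∀ h, L t h = Lminus t h * Lplus (fun a => Complex.exp (t a)) h
  plus_continuous : ContinuousOn (fun p : (Fin r → ℂ) × Circle => Lplus p.1 p.2)
    (Metric.ball 0 ρ ×ˢ Set.univ)
  plus_holomorphic : ∀ h j k,
    DifferentiableOn ℂ (fun q => Lplus q h j k) (Metric.ball (0 : Fin r → ℂ) ρ)
  normalized : ∀ h, Lplus 0 h = 1

/-! ### Block matrices -/

/-- A matrix whose rows and columns are indexed by `ι`, where the index `j` lies in the block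
number `deg j`, is (block) `l`-triangular if its `(α,β)` block vanishes whenever `β < α + l`. -/
def IsTriangular {A : Type*} [Zero A] (deg : ι → ℕ) (l : ℤ) (M : Matrix ι ι A) : Prop :=
  ∀ j k, (deg k : ℤ) < deg j + l → M j k = 0

/-- The (block) `l`-diagonal `M^{[l]}` of a matrix. -/
def diagPart {A : Type*} [Zero A] (deg : ι → ℕ) (l : ℤ) (M : Matrix ι ι A) : Matrix ι ι A :=
  Matrix.of fun j k => if (deg k : ℤ) = deg j + l then M j k else 0

/-- A family `Q₀, Q₁, …` such that `Q₀ - I` is `2`-triangular and `Q_i` is `(i+2)`-triangular for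
`i ≥ 1`. -/
def IsTriangularFamily [DecidableEq ι] (deg : ι → ℕ) (Q : ℕ → Matrix ι ι (QPoly r)) : Prop :=
  IsTriangular deg 2 (Q 0 - 1) ∧ ∀ i : ℕ, 1 ≤ i → IsTriangular deg ((i : ℤ) + 2) (Q i)

/-! ### The system of partial differential equations -/

/-- The value at a point `q` of a matrix of polynomials. -/
def evalAt (q : Fin r → ℂ) (M : Matrix ι ι (QPoly r)) : Matrix ι ι ℂ :=
  M.map (MvPolynomial.eval q)

/-- `∂_a = ∂/∂t_a = q_a ∂/∂q_a`, applied to each entry of a matrix. -/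
def logDeriv (a : Fin r) (M : Matrix ι ι (QPoly r)) : Matrix ι ι (QPoly r) :=
  M.map fun f => MvPolynomial.X a * MvPolynomial.pderiv a f

/-- The `dt_a` component of the right hand side of the equation for `dQ_i`:
`dQ₀ = Q₀ (θ⁽⁰⁾ + [Q₁, ω])`, and for `i ≥ 1`
`dQ_i = θ⁽ⁱ⁾ + Q₁ θ⁽ⁱ⁻¹⁾ + ⋯ + Q_{i-1} θ⁽¹⁾ + [Q_i, θ⁽⁰⁾] + [Q_{i+1}, ω] - [Q₁, ω] Q_i`. -/
def systemRhs [Fintype ι] (P : Module.Basis ι (Coeff r) (DMod N))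
    (Q : ℕ → Matrix ι ι (QPoly r)) : ℕ → Fin r → Matrix ι ι (QPoly r)
  | 0, a => Q 0 * (theta P 0 a + ⁅Q 1, omega P a⁆)
  | i + 1, a =>
      theta P (i + 1) a + ∑ k ∈ Finset.Icc 1 i, Q k * theta P (i + 1 - k) a
        + ⁅Q (i + 1), theta P 0 a⁆ + ⁅Q (i + 2), omega P a⁆ - ⁅Q 1, omega P a⁆ * Q (i + 1)

/-- The indices `(i,j)` of the unknowns `Q_i^{[j]}`: `2 ≤ i + 2 ≤ j ≤ m`. -/
def IsIndex (m : ℕ) (p : ℕ × ℕ) : Prop := p.1 + 2 ≤ p.2 ∧ p.2 ≤ m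

/-- The order in which the unknowns are found: `Q_{i₁}^{[j₁]} < Q_{i₂}^{[j₂]}` if and only if
`j₁ - i₁ < j₂ - i₂`, or `j₁ - i₁ = j₂ - i₂` and `j₂ < j₁`. -/
def Precedes (p p' : ℕ × ℕ) : Prop :=
  (p.2 : ℤ) - p.1 < (p'.2 : ℤ) - p'.1 ∨ ((p.2 : ℤ) - p.1 = (p'.2 : ℤ) - p'.1 ∧ p'.2 < p.2)

/-- The system for `Q₀, Q₁, …`, for an unknown `Q` with the initial condition `Q₀ = I`,
`Q_i = 0` (`i ≥ 1`) at `q = 0`, can be solved successively by quadrature, and `Q` is the result.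
Namely, with the unknowns `Q_i^{[j]}` in the above order,
* `Q` satisfies the system;
* the part of the system that determines `dQ_i^{[j]}` involves only unknowns which precede
  `Q_i^{[j]}`;
* as soon as the unknowns which precede `Q_i^{[j]}` have been found from their equations and
  initial conditions, the right hand side of the equation for `dQ_i^{[j]}` is a known `1`-form
  `E = ∑ E_a dt_a` which is closed; its one primitive that vanishes at `q = 0` is `Q_i^{[j]}`;
  and this primitive is the integral of `E` along the segments `x ↦ x q`, `0 ≤ x ≤ 1` (where
  `dt_a = dx / x`). -/
structure SolvedByQuadrature [Fintype ι] [DecidableEq ι] (P : Module.Basis ι (Coeff r) (DMod N))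
    (deg : ι → ℕ) (m : ℕ) (Q : ℕ → Matrix ι ι (QPoly r)) : Prop where
  system : ∀ i a, logDeriv a (Q i) = systemRhs P Q i a
  initial_zero : evalAt 0 (Q 0) = 1
  initial_pos : ∀ i, 1 ≤ i → evalAt 0 (Q i) = 0
  triangular_dependence : ∀ p, IsIndex m p → ∀ Q' Q'' : ℕ → Matrix ι ι (QPoly r),
    IsTriangularFamily deg Q' → IsTriangularFamily deg Q'' →
    (∀ p', IsIndex m p' → Precedes p' p → diagPart deg p'.2 (Q' p'.1) = diagPart deg p'.2 (Q'' p'.1)) →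
    ∀ a, diagPart deg p.2 (systemRhs P Q' p.1 a) = diagPart deg p.2 (systemRhs P Q'' p.1 a)
  quadrature : ∀ p, IsIndex m p → ∀ Q' : ℕ → Matrix ι ι (QPoly r), IsTriangularFamily deg Q' →
    (∀ p', IsIndex m p' → Precedes p' p →
      evalAt 0 (diagPart deg p'.2 (Q' p'.1)) = 0 ∧
      ∀ a, logDeriv a (diagPart deg p'.2 (Q' p'.1)) = diagPart deg p'.2 (systemRhs P Q' p'.1 a)) →
    (∀ a b, logDeriv a (diagPart deg p.2 (systemRhs P Q' p.1 b)) =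
      logDeriv b (diagPart deg p.2 (systemRhs P Q' p.1 a))) ∧
    (∀ Y : Matrix ι ι (QPoly r),
      (evalAt 0 Y = 0 ∧ ∀ a, logDeriv a Y = diagPart deg p.2 (systemRhs P Q' p.1 a)) ↔
        Y = diagPart deg p.2 (Q p.1)) ∧
    (∀ (q : Fin r → ℂ) (j k : ι), evalAt q (diagPart deg p.2 (Q p.1)) j k =
      ∫ x : ℝ in (0 : ℝ)..1, ∑ a, (x : ℂ)⁻¹ *
        evalAt (fun b => (x : ℂ) * q b) (diagPart deg p.2 (systemRhs P Q' p.1 a)) j k)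

end QuantumDModule

end

/-! The factor L₊ is a gauge transformation G = Q₀(I + hQ₁ + h²Q₂ + ⋯), polynomial in q and h, which
carries Ω^h into h⁻¹A with A = Q₀ωQ₀⁻¹ free of h: h dG = G·hΩ^h − AG. Compared power by power in h,
this equation is the system of the proposition (`system_iff_gauge`). Once G is known, flatness says
that A is closed and that its components commute, so dS = h⁻¹SA is solved by iterated integrals, S =
I + h⁻¹Z₁ + h⁻²Z₂ + ⋯ (`exists_isPencilSolution`), and L = SG is a Birkhoff factorization.

Two facts make the system triangular. The relations are homogeneous, so the left ideal is stable
under conjugation by q ↦ 2⁴q, h ↦ 2²h, which gives the degrees of the entries of hΩ^h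
(`hOmega_isWeightedHomogeneous`). The relations do not involve h at q = 0, and a study of leading
terms shows that every θ^(i) vanishes there (`constantCoeff_theta`). As q_a has degree 4, θ^(i) is
(i+2)-triangular, while ω is (−1)-triangular. Hence the [j]-part of the equation for dQ_i involves
only smaller unknowns (`IsGraded.diagPart_systemRhs_eq`), and repeated integration along the Euler
field ∑∂_a becomes stationary (`exists_fixed_eulerStep`). This solves only the sum of the equations
over a. Flatness supplies the rest: the transformed connection is flat with an h-free Euler
component, which forces each of its components to be h-free (`hCoeffMat_eq_zero_of_flat`).

For uniqueness, compare L = L₋L₊ with SG along the ray e^s q, s → −∞. There L = C·SG with C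
depending on h only, so CS = L₋(L₊G⁻¹). The Schwarz lemma gives L₊G⁻¹ = I + O(e^s). At q = 0 the
matrix ∑A_a shifts degrees by one, so a diagonal conjugation makes it small and S, S⁻¹ are
O(e^(−s/4)). Therefore C = L₋S⁻¹ + O(e^(s/2)), so C has the nonnegative Fourier coefficients of I
(`isMinusFourier_of_growth`). Consequently L₊G⁻¹ is both a plus and a minus loop, and equals I.
Points with some q_a = 0 follow by continuity. -/

namespace QuantumDModule

/-! ### Operators on `ℂ[q,h]` -/

section Operators

variable {r : ℕ}

/-- The action of `D^h` on `ℂ[q,h]`. -/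
noncomputable def Dh.toEnd (r : ℕ) : Dh r →ₐ[ℂ] Module.End ℂ (Coeff r) := (diffOps r).val

theorem Dh.toEnd_injective (r : ℕ) : Function.Injective (Dh.toEnd r) := Subtype.val_injective

theorem Dh.ext_toEnd {D D' : Dh r} (h : ∀ f, Dh.toEnd r D f = Dh.toEnd r D' f) : D = D' :=
  Dh.toEnd_injective r (LinearMap.ext h)

theorem toEnd_hPartial (i : Fin r) (f : Coeff r) : Dh.toEnd r (hPartial i) f =
    MvPolynomial.X none * MvPolynomial.X (some i) * MvPolynomial.pderiv (some i) f := rfl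

theorem toEnd_coeffHom (f g : Coeff r) : Dh.toEnd r (coeffHom r f) g = f * g := rfl

/-- The commutator of two derivations is a derivation, so it vanishes as soon as it kills the
variables. -/
theorem pderiv_pderiv_comm {σ : Type*} {A : Type*} [CommRing A] (a b : σ) (f : MvPolynomial σ A) :
    MvPolynomial.pderiv a (MvPolynomial.pderiv b f) =
      MvPolynomial.pderiv b (MvPolynomial.pderiv a f) := by
  have h : ⁅(MvPolynomial.pderiv a : Derivation A (MvPolynomial σ A) (MvPolynomial σ A)),
      (MvPolynomial.pderiv b : Derivation A (MvPolynomial σ A) (MvPolynomial σ A))⁆ = 0 := by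
    classical
    refine MvPolynomial.derivation_ext (R := A) fun i => ?_
    simp only [Derivation.commutator_apply, MvPolynomial.pderiv_X, Pi.single_apply]
    split_ifs <;> simp
  have := congrArg (fun D => D f) h
  simpa [Derivation.commutator_apply, sub_eq_zero] using this

theorem hPartial_mul_comm (a b : Fin r) : hPartial a * hPartial b = hPartial b * hPartial a := by
  refine Dh.ext_toEnd fun f => ?_
  rw [map_mul, map_mul, Module.End.mul_apply, Module.End.mul_apply]
  simp only [toEnd_hPartial]
  by_cases hab : a = b
  · rw [hab]
  · have h1 : (some a : Option (Fin r)) ≠ some b := by simpa using hab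
    have h2 : (some b : Option (Fin r)) ≠ some a := h1.symm
    simp only [Derivation.leibniz, MvPolynomial.pderiv_X_of_ne h1, MvPolynomial.pderiv_X_of_ne h2,
      MvPolynomial.pderiv_X_of_ne (i := some a) (j := none) (by simp),
      MvPolynomial.pderiv_X_of_ne (i := some b) (j := none) (by simp),
      pderiv_pderiv_comm (some a) (some b) f]
    simp only [smul_eq_mul]
    ring

theorem hPartial_mul_coeffHom (a : Fin r) (f : Coeff r) :
    hPartial a * coeffHom r f = coeffHom r f * hPartial a +
      coeffHom r (MvPolynomial.X none * (MvPolynomial.X (some a) *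
        MvPolynomial.pderiv (some a) f)) := by
  refine Dh.ext_toEnd fun g => ?_
  rw [map_mul, map_add, map_mul, LinearMap.add_apply, Module.End.mul_apply, Module.End.mul_apply]
  simp only [toEnd_hPartial]
  rw [toEnd_coeffHom f g, toEnd_coeffHom, toEnd_coeffHom]
  simp only [Derivation.leibniz, smul_eq_mul]
  ring

theorem Dh.induction {p : Dh r → Prop} (coeff : ∀ f, p (coeffHom r f)) (partials : ∀ i, p (hPartial i))
    (add : ∀ x y, p x → p y → p (x + y)) (mul : ∀ x y, p x → p y → p (x * y)) (D : Dh r) : p D := by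
  obtain ⟨D, hD⟩ := D
  induction hD using Algebra.adjoin_induction with
  | mem x hx =>
    rcases hx with ⟨f, rfl⟩ | ⟨i, rfl⟩
    · exact coeff f
    · exact partials i
  | algebraMap c =>
    have h := coeff (MvPolynomial.C c)
    refine (congrArg p (Dh.ext_toEnd fun f => ?_)).mpr h
    exact (MvPolynomial.C_mul' (σ := Option (Fin r)) (a := c) (p := f)).symm
  | add x y hx hy h1 h2 => exact add _ _ h1 h2
  | mul x y hx hy h1 h2 => exact mul _ _ h1 h2

open scoped IsMulCommutative in
-- The ordered product defining a monomial lives in the commutative submonoid generated by the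
-- `hPartial i`. Moving there gives access to products over finite sets, which do not exist in the
-- noncommutative ring.
theorem exists_monomialOp_eq_coe (r : ℕ) : ∃ (T : Type) (_ : CommMonoid T)
    (v : T →* Dh r) (x : Fin r → T), (∀ i, v (x i) = hPartial i) ∧
      ∀ n : Fin r →₀ ℕ, monomialOp n = v (∏ i, x i ^ n i) := by
  have hc : ∀ x ∈ Set.range (hPartial (r := r)), ∀ y ∈ Set.range (hPartial (r := r)),
      x * y = y * x := by
    rintro _ ⟨a, rfl⟩ _ ⟨b, rfl⟩
    exact hPartial_mul_comm a b
  have := Submonoid.isMulCommutative_closure _ hc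
  refine ⟨Submonoid.closure (Set.range (hPartial (r := r))), inferInstance,
    ⟨⟨Subtype.val, rfl⟩, fun _ _ => rfl⟩,
    fun i => ⟨hPartial i, Submonoid.subset_closure ⟨i, rfl⟩⟩, fun i => rfl, fun n => ?_⟩
  rw [← List.prod_ofFn, map_list_prod, List.map_ofFn]
  rfl

theorem monomialOp_zero : monomialOp (0 : Fin r →₀ ℕ) = 1 := by
  obtain ⟨T, _, v, x, -, h⟩ := exists_monomialOp_eq_coe r
  rw [h]; simp

theorem monomialOp_add (m n : Fin r →₀ ℕ) : monomialOp (m + n) = monomialOp m * monomialOp n := by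
  obtain ⟨T, _, v, x, -, h⟩ := exists_monomialOp_eq_coe r
  rw [h, h, h, ← map_mul, ← Finset.prod_mul_distrib]
  simp [pow_add]

theorem monomialOp_single (a : Fin r) : monomialOp (Finsupp.single a 1) = hPartial a := by
  obtain ⟨T, _, v, x, hx, h⟩ := exists_monomialOp_eq_coe r
  rw [h, ← hx, Finset.prod_eq_single a]
  · simp
  · intro b _ hb
    simp [Finsupp.single_eq_of_ne hb]
  · simp

theorem monomialOp_induction {p : (Fin r →₀ ℕ) → Prop} (zero : p 0)
    (step : ∀ a n, p n → p (Finsupp.single a 1 + n)) (n : Fin r →₀ ℕ) : p n := by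
  have key : ∀ (k : ℕ) (a : Fin r) (n : Fin r →₀ ℕ), p n → p (Finsupp.single a k + n) := by
    intro k
    induction k with
    | zero => intro a n hn; simpa using hn
    | succ k ih =>
      intro a n hn
      have := step a _ (ih a n hn)
      rwa [← add_assoc, ← Finsupp.single_add, add_comm 1 k] at this
  induction n using Finsupp.induction with
  | zero => exact zero
  | single_add a k f _ _ ih => exact key k a f ih

theorem opOfSymbol_eq_sum (N : MvPolynomial (Fin r) (Coeff r)) {s : Finset (Fin r →₀ ℕ)}
    (hs : N.support ⊆ s) : opOfSymbol N = ∑ n ∈ s, coeffHom r (N.coeff n) * monomialOp n := by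
  refine Finset.sum_subset hs fun n _ hn => ?_
  rw [MvPolynomial.notMem_support_iff.1 hn, map_zero, zero_mul]

theorem opOfSymbol_add (N N' : MvPolynomial (Fin r) (Coeff r)) :
    opOfSymbol (N + N') = opOfSymbol N + opOfSymbol N' := by
  classical
  have h : (N + N').support ⊆ N.support ∪ N'.support := MvPolynomial.support_add
  rw [opOfSymbol_eq_sum _ h, opOfSymbol_eq_sum N Finset.subset_union_left,
    opOfSymbol_eq_sum N' Finset.subset_union_right, ← Finset.sum_add_distrib]
  refine Finset.sum_congr rfl fun n _ => ?_
  rw [MvPolynomial.coeff_add, map_add, add_mul]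

theorem opOfSymbol_monomial (n : Fin r →₀ ℕ) (c : Coeff r) :
    opOfSymbol (MvPolynomial.monomial n c) = coeffHom r c * monomialOp n := by
  classical
  rw [opOfSymbol_eq_sum _ (MvPolynomial.support_monomial_subset), Finset.sum_singleton,
    MvPolynomial.coeff_monomial, if_pos rfl]

/-- Every operator can be written with the coefficients on the left. -/
theorem exists_eq_opOfSymbol (D : Dh r) : ∃ N, D = opOfSymbol N := by
  -- Normally ordered operators are stable under left multiplication by each generator, thanks to
  -- the commutation rule. Quantifying over all `N` lets the product case be a composition; `N = 1`
  -- recovers `D`.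
  suffices h : ∀ N, ∃ N', D * opOfSymbol N = opOfSymbol N' by
    obtain ⟨N', hN'⟩ := h 1
    refine ⟨N', ?_⟩
    rw [← hN', ← MvPolynomial.C_1, ← MvPolynomial.monomial_zero', opOfSymbol_monomial,
      monomialOp_zero, map_one, mul_one, mul_one]
  induction D using Dh.induction with
  | coeff f =>
    intro N
    induction N using MvPolynomial.induction_on' with
    | monomial n c =>
      refine ⟨MvPolynomial.monomial n (f * c), ?_⟩
      rw [opOfSymbol_monomial, opOfSymbol_monomial, map_mul, mul_assoc]
    | add N₁ N₂ h₁ h₂ =>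
      obtain ⟨N₁', h₁⟩ := h₁
      obtain ⟨N₂', h₂⟩ := h₂
      exact ⟨N₁' + N₂', by rw [opOfSymbol_add, opOfSymbol_add, mul_add, h₁, h₂]⟩
  | partials i =>
    intro N
    induction N using MvPolynomial.induction_on' with
    | monomial n c =>
      refine ⟨MvPolynomial.monomial (Finsupp.single i 1 + n) c + MvPolynomial.monomial n
        (MvPolynomial.X none * (MvPolynomial.X (some i) *
          MvPolynomial.pderiv (some i) c)), ?_⟩
      rw [opOfSymbol_add, opOfSymbol_monomial, opOfSymbol_monomial, opOfSymbol_monomial,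
        ← mul_assoc, hPartial_mul_coeffHom, monomialOp_add, monomialOp_single, add_mul, mul_assoc]
    | add N₁ N₂ h₁ h₂ =>
      obtain ⟨N₁', h₁⟩ := h₁
      obtain ⟨N₂', h₂⟩ := h₂
      exact ⟨N₁' + N₂', by rw [opOfSymbol_add, opOfSymbol_add, mul_add, h₁, h₂]⟩
  | add x y hx hy =>
    intro N
    obtain ⟨N₁, h₁⟩ := hx N
    obtain ⟨N₂, h₂⟩ := hy N
    exact ⟨N₁ + N₂, by rw [opOfSymbol_add, add_mul, h₁, h₂]⟩
  | mul x y hx hy =>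
    intro N
    obtain ⟨N₁, h₁⟩ := hy N
    obtain ⟨N₂, h₂⟩ := hx N₁
    exact ⟨N₂, by rw [mul_assoc, h₁, h₂]⟩

end Operators

/-! ### The module -/

section DModule

variable {r : ℕ} {κ : Type*} {N : κ → MvPolynomial (Fin r) (Coeff r)}

theorem DMod.mk_add (D D' : Dh r) : DMod.mk N (D + D') = DMod.mk N D + DMod.mk N D' := rfl

theorem DMod.mk_mul (A D : Dh r) : DMod.mk N (A * D) = A • DMod.mk N D := rfl

theorem DMod.coeff_smul (f : Coeff r) (x : DMod N) : f • x = coeffHom r f • x := rfl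

theorem DMod.mk_coeffHom_mul (f : Coeff r) (D : Dh r) :
    DMod.mk N (coeffHom r f * D) = f • DMod.mk N D := rfl

theorem DMod.mk_sub (D D' : Dh r) : DMod.mk N (D - D') = DMod.mk N D - DMod.mk N D' := rfl

theorem DMod.mk_sum {α : Type*} (s : Finset α) (D : α → Dh r) :
    DMod.mk N (∑ i ∈ s, D i) = ∑ i ∈ s, DMod.mk N (D i) :=
  map_sum (Submodule.span (Dh r) (Set.range fun k => opOfSymbol (N k))).mkQ D s

theorem DMod.mk_eq_zero {D : Dh r} : DMod.mk N D = 0 ↔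
    D ∈ Submodule.span (Dh r) (Set.range fun k => opOfSymbol (N k)) :=
  Submodule.Quotient.mk_eq_zero _

theorem DMod.mk_surjective : Function.Surjective (DMod.mk N) :=
  Submodule.Quotient.mk_surjective _

end DModule

end QuantumDModule

namespace QuantumDModule

/-! ### Homogeneity of the connection matrices -/

section Scaling

variable {r : ℕ}

/-- The substitution `q_i ↦ 2⁴ q_i`, `h ↦ 2² h`. -/
noncomputable def scale (r : ℕ) : Coeff r →ₐ[ℂ] Coeff r :=
  MvPolynomial.aeval fun o => MvPolynomial.C ((2 : ℂ) ^ coeffDegree r o) * MvPolynomial.X o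

theorem scale_X (o : Option (Fin r)) : scale r (MvPolynomial.X o) =
    MvPolynomial.C ((2 : ℂ) ^ coeffDegree r o) * MvPolynomial.X o :=
  MvPolynomial.aeval_X _ _

theorem scale_surjective (r : ℕ) : Function.Surjective (scale r) := by
  have h : (scale r).comp (MvPolynomial.aeval fun o =>
      MvPolynomial.C ((2 : ℂ) ^ (- coeffDegree r o)) * MvPolynomial.X o) = AlgHom.id ℂ _ := by
    refine MvPolynomial.algHom_ext fun o => ?_
    rw [AlgHom.comp_apply, MvPolynomial.aeval_X, map_mul, scale_X, AlgHom.id_apply, ← mul_assoc,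
      MvPolynomial.algHom_C, MvPolynomial.algebraMap_eq, ← map_mul, ← zpow_add₀ two_ne_zero,
      neg_add_cancel, zpow_zero, map_one, one_mul]
  exact fun f => ⟨_, congrArg (fun φ => φ f) h⟩

theorem scale_monomial (μ : Option (Fin r) →₀ ℕ) (c : ℂ) :
    scale r (MvPolynomial.monomial μ c) =
      MvPolynomial.monomial μ ((2 : ℂ) ^ Finsupp.weight (coeffDegree r) μ * c) := by
  have h : (2 : ℂ) ^ Finsupp.weight (coeffDegree r) μ =
      μ.prod fun o k => ((2 : ℂ) ^ coeffDegree r o) ^ k := by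
    rw [Finsupp.weight_apply, Finsupp.sum, Finsupp.prod]
    induction μ.support using Finset.induction with
    | empty => simp
    | insert a s ha ih =>
      rw [Finset.sum_insert ha, Finset.prod_insert ha, zpow_add₀ two_ne_zero, ih, nsmul_eq_mul,
        mul_comm (μ a : ℤ), zpow_mul, zpow_natCast]
  rw [scale, MvPolynomial.aeval_monomial, h, MvPolynomial.monomial_eq, MvPolynomial.algebraMap_eq,
    mul_comm _ c, map_mul, mul_assoc]
  congr 1
  rw [Finsupp.prod, Finsupp.prod, Finsupp.prod, map_prod, ← Finset.prod_mul_distrib]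
  refine Finset.prod_congr rfl fun o _ => ?_
  rw [mul_pow, map_pow]

theorem coeff_scale (f : Coeff r) (μ : Option (Fin r) →₀ ℕ) :
    (scale r f).coeff μ = (2 : ℂ) ^ Finsupp.weight (coeffDegree r) μ * f.coeff μ := by
  induction f using MvPolynomial.induction_on' with
  | monomial ν c =>
    classical
    rw [scale_monomial, MvPolynomial.coeff_monomial, MvPolynomial.coeff_monomial]
    split_ifs with h
    · rw [h]
    · rw [mul_zero]
  | add f g hf hg => rw [map_add, MvPolynomial.coeff_add, MvPolynomial.coeff_add, hf, hg, mul_add]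

theorem scale_of_isWeightedHomogeneous {f : Coeff r} {d : ℤ}
    (hf : MvPolynomial.IsWeightedHomogeneous (coeffDegree r) f d) :
    scale r f = MvPolynomial.C ((2 : ℂ) ^ d) * f := by
  ext μ
  rw [coeff_scale, MvPolynomial.coeff_C_mul]
  by_cases h : f.coeff μ = 0
  · rw [h, mul_zero, mul_zero]
  · rw [hf h]

/-- A monomial of weight w is an eigenvector of the substitution with eigenvalue 2^w, and w ↦ 2^w is
injective on the integers. One single substitution therefore detects the degree. -/
theorem isWeightedHomogeneous_of_scale {f : Coeff r} {d : ℤ}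
    (hf : scale r f = MvPolynomial.C ((2 : ℂ) ^ d) * f) :
    MvPolynomial.IsWeightedHomogeneous (coeffDegree r) f d := by
  intro μ hμ
  have h := congrArg (fun g => MvPolynomial.coeff μ g) hf
  simp only [coeff_scale, MvPolynomial.coeff_C_mul] at h
  have h2 := congrArg (fun z : ℂ => ‖z‖) (mul_right_cancel₀ hμ h)
  simp only [norm_zpow, Complex.norm_ofNat] at h2
  exact zpow_right_injective₀ (by norm_num) (by norm_num) h2

/-- `D'` is the conjugate of `D` by the substitution `scale`. -/
def IsScaled (D D' : Dh r) : Prop :=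
  ∀ f, scale r (Dh.toEnd r D f) = Dh.toEnd r D' (scale r f)

theorem IsScaled.add {D₁ D₁' D₂ D₂' : Dh r} (h₁ : IsScaled D₁ D₁') (h₂ : IsScaled D₂ D₂') :
    IsScaled (D₁ + D₂) (D₁' + D₂') := fun f => by
  rw [map_add, map_add, LinearMap.add_apply, LinearMap.add_apply, map_add, h₁ f, h₂ f]

theorem IsScaled.mul {D₁ D₁' D₂ D₂' : Dh r} (h₁ : IsScaled D₁ D₁') (h₂ : IsScaled D₂ D₂') :
    IsScaled (D₁ * D₂) (D₁' * D₂') := fun f => by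
  rw [map_mul, map_mul, Module.End.mul_apply, Module.End.mul_apply, h₁, h₂]

theorem isScaled_zero : IsScaled (0 : Dh r) 0 := fun f => by simp

theorem isScaled_one : IsScaled (1 : Dh r) 1 := fun f => by simp

theorem isScaled_sum {α : Type*} (s : Finset α) {D D' : α → Dh r}
    (h : ∀ i ∈ s, IsScaled (D i) (D' i)) : IsScaled (∑ i ∈ s, D i) (∑ i ∈ s, D' i) := by
  classical
  induction s using Finset.induction with
  | empty => simpa using isScaled_zero
  | insert a s ha ih =>
    rw [Finset.sum_insert ha, Finset.sum_insert ha]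
    exact (h a (Finset.mem_insert_self a s)).add
      (ih fun i hi => h i (Finset.mem_insert_of_mem hi))

theorem isScaled_coeffHom (f : Coeff r) : IsScaled (coeffHom r f) (coeffHom r (scale r f)) :=
  fun g => by rw [toEnd_coeffHom, toEnd_coeffHom, map_mul]

/-- The field q∂/∂q is invariant under rescaling of q. In h∂_i only the factor h is rescaled, so
h∂_i gets degree 2. -/
theorem scale_pderiv (i : Fin r) (f : Coeff r) :
    scale r (MvPolynomial.X (some i) * MvPolynomial.pderiv (some i) f) =
      MvPolynomial.X (some i) * MvPolynomial.pderiv (some i) (scale r f) := by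
  classical
  induction f using MvPolynomial.induction_on with
  | C a => simp [MvPolynomial.algHom_C, MvPolynomial.algebraMap_eq]
  | add f g hf hg => simp only [map_add, mul_add] at *; rw [hf, hg]
  | mul_X f o hf =>
    have e : ∀ F G : Coeff r, MvPolynomial.X (some i) * MvPolynomial.pderiv (some i) (F * G) =
        F * (MvPolynomial.X (some i) * MvPolynomial.pderiv (some i) G) +
        (MvPolynomial.X (some i) * MvPolynomial.pderiv (some i) F) * G := by
      intro F G
      rw [Derivation.leibniz, smul_eq_mul, smul_eq_mul]
      ring
    rw [e, map_mul (scale r) f, e, map_add, map_mul,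
      map_mul (scale r) (_ * _) (MvPolynomial.X o), hf]
    have hX : scale r (MvPolynomial.X (some i) * MvPolynomial.pderiv (some i) (MvPolynomial.X o)) =
        MvPolynomial.X (some i) * MvPolynomial.pderiv (some i) (scale r (MvPolynomial.X o)) := by
      rw [scale_X, Derivation.leibniz, MvPolynomial.pderiv_C, smul_zero, add_zero, smul_eq_mul,
        MvPolynomial.pderiv_X, Pi.single_apply]
      split_ifs with h
      · subst h; rw [mul_one, scale_X, mul_one, mul_comm]
      · simp
    rw [hX]

theorem isScaled_hPartial (i : Fin r) :
    IsScaled (hPartial i) (coeffHom r (MvPolynomial.C (2 ^ (2 : ℤ))) * hPartial i) := fun f => by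
  rw [map_mul, Module.End.mul_apply, toEnd_coeffHom, toEnd_hPartial, toEnd_hPartial, mul_assoc,
    map_mul, scale_pderiv, scale_X, coeffDegree]
  ring

theorem coeffHom_C_comm (c : ℂ) (D : Dh r) :
    coeffHom r (MvPolynomial.C c) * D = D * coeffHom r (MvPolynomial.C c) := by
  rw [← MvPolynomial.algebraMap_eq, AlgHom.commutes, Algebra.commutes]

theorem isScaled_monomialOp (n : Fin r →₀ ℕ) : IsScaled (monomialOp n)
    (coeffHom r (MvPolynomial.C (2 ^ (2 * (n.degree : ℤ)))) * monomialOp n) := by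
  induction n using monomialOp_induction with
  | zero => simpa [monomialOp_zero] using isScaled_one
  | step a n ih =>
    rw [monomialOp_add, monomialOp_single]
    have hd : 2 * ((Finsupp.single a 1 + n).degree : ℤ) = 2 + 2 * (n.degree : ℤ) := by
      rw [map_add, Finsupp.degree_single]
      push_cast
      ring
    convert (isScaled_hPartial a).mul ih using 1
    rw [mul_assoc, ← mul_assoc (hPartial a), ← coeffHom_C_comm, mul_assoc,
      ← mul_assoc (coeffHom r _) (coeffHom r _), ← map_mul, ← map_mul, ← zpow_add₀ two_ne_zero, hd]

theorem exists_isScaled (D : Dh r) : ∃ D', IsScaled D D' := by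
  induction D using Dh.induction with
  | coeff f => exact ⟨_, isScaled_coeffHom f⟩
  | partials i => exact ⟨_, isScaled_hPartial i⟩
  | add x y hx hy => exact ⟨_, hx.choose_spec.add hy.choose_spec⟩
  | mul x y hx hy => exact ⟨_, hx.choose_spec.mul hy.choose_spec⟩

theorem IsScaled.unique {D D₁ D₂ : Dh r} (h₁ : IsScaled D D₁) (h₂ : IsScaled D D₂) : D₁ = D₂ := by
  refine Dh.ext_toEnd fun f => ?_
  obtain ⟨g, rfl⟩ := scale_surjective r f
  rw [← h₁, ← h₂]

theorem isScaled_opOfSymbol {N : MvPolynomial (Fin r) (Coeff r)} {d : ℤ}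
    (hN : ∀ n : Fin r →₀ ℕ, MvPolynomial.IsWeightedHomogeneous (coeffDegree r) (N.coeff n)
      (d - 2 * (n.degree : ℤ))) :
    IsScaled (opOfSymbol N) (coeffHom r (MvPolynomial.C (2 ^ d)) * opOfSymbol N) := by
  rw [opOfSymbol, Finset.mul_sum]
  refine isScaled_sum _ fun n _ => ?_
  convert (isScaled_coeffHom (N.coeff n)).mul (isScaled_monomialOp n) using 1
  rw [scale_of_isWeightedHomogeneous (hN n), ← mul_assoc, ← mul_assoc, ← map_mul, ← map_mul,
    mul_comm _ (MvPolynomial.C (2 ^ (2 * (n.degree : ℤ)))), ← mul_assoc, ← map_mul,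
    ← zpow_add₀ two_ne_zero, add_sub_cancel]

/-- Conjugation by the substitution multiplies each homogeneous generator by a power of 2 and maps
D^h to itself, so it preserves the left ideal. -/
theorem exists_isScaled_mem_span {κ : Type*} {N : κ → MvPolynomial (Fin r) (Coeff r)}
    (hN : ∀ k, ∃ d : ℤ, ∀ n : Fin r →₀ ℕ, MvPolynomial.IsWeightedHomogeneous (coeffDegree r)
      ((N k).coeff n) (d - 2 * (n.degree : ℤ))) {D : Dh r}
    (hD : D ∈ Submodule.span (Dh r) (Set.range fun k => opOfSymbol (N k))) :
    ∃ D' ∈ Submodule.span (Dh r) (Set.range fun k => opOfSymbol (N k)), IsScaled D D' := by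
  induction hD using Submodule.span_induction with
  | mem x hx =>
    obtain ⟨k, rfl⟩ := hx
    obtain ⟨d, hd⟩ := hN k
    exact ⟨_, Submodule.smul_mem _ (coeffHom r (MvPolynomial.C (2 ^ d)))
      (Submodule.subset_span ⟨k, rfl⟩), isScaled_opOfSymbol hd⟩
  | zero => exact ⟨0, Submodule.zero_mem _, isScaled_zero⟩
  | add x y _ _ hx hy =>
    obtain ⟨x', h1, h2⟩ := hx
    obtain ⟨y', h3, h4⟩ := hy
    exact ⟨_, Submodule.add_mem _ h1 h3, h2.add h4⟩
  | smul A x _ hx =>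
    obtain ⟨x', h1, h2⟩ := hx
    obtain ⟨A', hA⟩ := exists_isScaled A
    exact ⟨A' • x', Submodule.smul_mem _ _ h1, hA.mul h2⟩

end Scaling

/-! ### Degrees and flatness of the connection matrices. -/

section Homogeneity

variable {r : ℕ} {κ ι : Type*} {N : κ → MvPolynomial (Fin r) (Coeff r)}

theorem hOmega_apply (P : Module.Basis ι (Coeff r) (DMod N)) (a : Fin r) (k j : ι) :
    hOmega P a k j = P.repr (hPartial a • P j) k := rfl

theorem mk_hPartial_mul_eq_sum [Fintype ι] {e : ι → Fin r →₀ ℕ}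
    {P : Module.Basis ι (Coeff r) (DMod N)}
    (hP : ∀ j, P j = DMod.mk N (monomialOp (e j))) (a : Fin r) (k : ι) :
    DMod.mk N (hPartial a * monomialOp (e k)) =
      DMod.mk N (∑ j, coeffHom r (hOmega P a j k) * monomialOp (e j)) := by
  rw [DMod.mk_sum, DMod.mk_mul, ← hP, ← P.sum_repr (hPartial a • P k)]
  refine Finset.sum_congr rfl fun j _ => ?_
  rw [DMod.mk_coeffHom_mul, ← hP]
  rfl

/-- The relation expressing h∂_a P_k in the basis is an element of the left ideal, and so is its
conjugate by the substitution. Comparing the two in the basis gives the eigenvalue of each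
coefficient. -/
theorem hOmega_isWeightedHomogeneous [Fintype ι]
    (hN : ∀ k, ∃ d : ℤ, ∀ n : Fin r →₀ ℕ, MvPolynomial.IsWeightedHomogeneous (coeffDegree r)
      ((N k).coeff n) (d - 2 * (n.degree : ℤ))) {e : ι → Fin r →₀ ℕ}
    {P : Module.Basis ι (Coeff r) (DMod N)}
    (hP : ∀ j, P j = DMod.mk N (monomialOp (e j))) (a : Fin r) (j k : ι) :
    MvPolynomial.IsWeightedHomogeneous (coeffDegree r) (hOmega P a j k)
      (2 * ((e k).degree + 1 - (e j).degree : ℤ)) := by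
  have h := mk_hPartial_mul_eq_sum hP a k
  have hmem := DMod.mk_eq_zero.1 ((DMod.mk_sub _ _).trans (sub_eq_zero.2 h))
  obtain ⟨D', hD', hsc⟩ := exists_isScaled_mem_span hN hmem
  have hneg : IsScaled (-∑ j, coeffHom r (hOmega P a j k) * monomialOp (e j))
      (-∑ j, coeffHom r (scale r (hOmega P a j k)) *
        (coeffHom r (MvPolynomial.C (2 ^ (2 * ((e j).degree : ℤ)))) * monomialOp (e j))) := by
    rw [← Finset.sum_neg_distrib, ← Finset.sum_neg_distrib]
    refine isScaled_sum _ fun j _ => ?_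
    rw [← neg_mul, ← neg_mul, ← map_neg, ← map_neg, ← map_neg]
    exact (isScaled_coeffHom _).mul (isScaled_monomialOp _)
  have hsc' := (isScaled_monomialOp (Finsupp.single a 1 + e k)).add hneg
  rw [monomialOp_add, monomialOp_single, ← sub_eq_add_neg] at hsc'
  rw [hsc.unique hsc', ← sub_eq_add_neg] at hD'
  have h2 := sub_eq_zero.1 ((DMod.mk_sub _ _).symm.trans (DMod.mk_eq_zero.2 hD'))
  rw [DMod.mk_coeffHom_mul, h, DMod.mk_sum, DMod.mk_sum, Finset.smul_sum] at h2
  -- The coordinate j of the conjugated relation, in which h∂_a P_k contributes 2^(2(1 + deg k)) and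
  -- P_j contributes 2^(2 deg j).
  have h3 := congrArg (fun x => P.repr x j) h2
  simp only [← mul_assoc, ← map_mul, DMod.mk_coeffHom_mul, ← hP, map_sum, map_smul,
    Module.Basis.repr_self, Finsupp.coe_finsetSum, Finset.sum_apply, Finsupp.smul_apply,
    smul_eq_mul] at h3
  classical
  simp only [Finsupp.single_apply, mul_ite, mul_one, mul_zero, Finset.sum_ite_eq',
    Finset.mem_univ, if_true] at h3
  refine isWeightedHomogeneous_of_scale ?_
  have h4 : ∀ d : ℤ, (MvPolynomial.C ((2 : ℂ) ^ d) : Coeff r) * MvPolynomial.C (2 ^ (-d)) = 1 := by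
    intro d
    rw [← map_mul, ← zpow_add₀ two_ne_zero, add_neg_cancel, zpow_zero, map_one]
  rw [← mul_one (scale r _), ← h4 (2 * ((e j).degree : ℤ)), ← mul_assoc, ← h3, mul_comm, ← mul_assoc,
    ← map_mul, ← zpow_add₀ two_ne_zero, map_add, Finsupp.degree_single]
  congr 3
  push_cast
  ring

/-! ### Flatness -/

/-- Both sides are coordinates of second-order actions on P_k, taken in the two orders, and the
operators h∂_a and h∂_b commute. The derivative terms appear when an operator is moved past the
coefficients. -/
theorem hOmega_flat [Fintype ι] (P : Module.Basis ι (Coeff r) (DMod N)) (a b : Fin r) (i k : ι) :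
    MvPolynomial.X none * (MvPolynomial.X (some b) *
        MvPolynomial.pderiv (some b) (hOmega P a i k)) + (hOmega P b * hOmega P a) i k =
      MvPolynomial.X none * (MvPolynomial.X (some a) *
        MvPolynomial.pderiv (some a) (hOmega P b i k)) + (hOmega P a * hOmega P b) i k := by
  classical
  have key : ∀ a b, P.repr (hPartial b • hPartial a • P k) i =
      MvPolynomial.X none * (MvPolynomial.X (some b) *
        MvPolynomial.pderiv (some b) (hOmega P a i k)) + (hOmega P b * hOmega P a) i k := by
    intro a b
    conv_lhs => rw [← P.sum_repr (hPartial a • P k), Finset.smul_sum]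
    have h : ∀ j, hPartial b • (P.repr (hPartial a • P k) j) • P j =
        (hOmega P a j k) • (hPartial b • P j) + (MvPolynomial.X none * (MvPolynomial.X (some b) *
        MvPolynomial.pderiv (some b) (hOmega P a j k))) • P j := by
      intro j
      rw [DMod.coeff_smul, DMod.coeff_smul, DMod.coeff_smul, smul_smul, smul_smul, ← add_smul,
        hOmega_apply, ← hPartial_mul_coeffHom]
    simp only [h, map_sum, map_add, map_smul, Module.Basis.repr_self, Finsupp.coe_finsetSum,
      Finset.sum_apply, Finsupp.add_apply, Finsupp.smul_apply, smul_eq_mul, Finset.sum_add_distrib,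
      Finsupp.single_apply, mul_ite, mul_one, mul_zero, Finset.sum_ite_eq', Finset.mem_univ,
      if_true]
    rw [add_comm, Matrix.mul_apply, Finset.sum_congr rfl fun j _ =>
      (mul_comm (hOmega P a j k) (P.repr (hPartial b • P j) i))]
    simp only [hOmega_apply]
  rw [← key, ← key, smul_smul, smul_smul, hPartial_mul_comm]

end Homogeneity

end QuantumDModule

namespace QuantumDModule

/-! ### The connection matrices at `q = 0` -/

section AtZero

variable {r : ℕ}

/-- Evaluation of a polynomial in `q, h` at `q = 0`. -/
noncomputable def evalQZero (r : ℕ) : Coeff r →ₐ[ℂ] Polynomial ℂ :=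
  MvPolynomial.aeval fun o : Option (Fin r) => o.elim (Polynomial.X : Polynomial ℂ) (fun _ => 0)

theorem evalQZero_X_some (i : Fin r) : evalQZero r (MvPolynomial.X (some i)) = 0 :=
  MvPolynomial.aeval_X _ _

theorem evalQZero_X_none : evalQZero r (MvPolynomial.X none) = Polynomial.X :=
  MvPolynomial.aeval_X _ _

theorem evalQZero_C (c : ℂ) : evalQZero r (MvPolynomial.C c) = Polynomial.C c :=
  MvPolynomial.aeval_C _ _

/-- The monomial `qⁿ`, as an element of `ℂ[q,h]`. -/
noncomputable def qMonomial (n : Fin r →₀ ℕ) : Coeff r := MvPolynomial.monomial (n.mapDomain some) 1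

theorem X_mul_pderiv_qMonomial (i : Fin r) (n : Fin r →₀ ℕ) :
    MvPolynomial.X (some i) * MvPolynomial.pderiv (some i) (qMonomial n) = n i • qMonomial n := by
  rw [qMonomial, MvPolynomial.X_mul_pderiv_monomial,
    Finsupp.mapDomain_apply (Option.some_injective _)]

theorem qMonomial_ne_zero (n : Fin r →₀ ℕ) : qMonomial n ≠ 0 := by
  rw [qMonomial, Ne, MvPolynomial.monomial_eq_zero]
  exact one_ne_zero

/-- `D` acts on the leading term of the multiples of `qⁿ` by multiplication by `s`. -/
def HasLeading (D : Dh r) (n : Fin r →₀ ℕ) (s : Polynomial ℂ) : Prop :=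
  ∀ g, ∃ g', Dh.toEnd r D (qMonomial n * g) = qMonomial n * g' ∧
    evalQZero r g' = s * evalQZero r g

theorem HasLeading.unique {D : Dh r} {n : Fin r →₀ ℕ} {s s' : Polynomial ℂ}
    (h : HasLeading D n s) (h' : HasLeading D n s') : s = s' := by
  obtain ⟨g, h1, h2⟩ := h 1
  obtain ⟨g', h1', h2'⟩ := h' 1
  rw [map_one, mul_one] at h2 h2'
  rw [← h2, ← h2', mul_left_cancel₀ (qMonomial_ne_zero n) (h1.symm.trans h1')]

theorem HasLeading.add {D D' : Dh r} {n : Fin r →₀ ℕ} {s s' : Polynomial ℂ}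
    (h : HasLeading D n s) (h' : HasLeading D' n s') : HasLeading (D + D') n (s + s') := by
  intro g
  obtain ⟨g₁, h1, h2⟩ := h g
  obtain ⟨g₂, h1', h2'⟩ := h' g
  exact ⟨g₁ + g₂, by rw [map_add, LinearMap.add_apply, h1, h1', mul_add],
    by rw [map_add, h2, h2', add_mul]⟩

theorem HasLeading.mul {D D' : Dh r} {n : Fin r →₀ ℕ} {s s' : Polynomial ℂ}
    (h : HasLeading D n s) (h' : HasLeading D' n s') : HasLeading (D * D') n (s * s') := by
  intro g
  obtain ⟨g₂, h1', h2'⟩ := h' g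
  obtain ⟨g₁, h1, h2⟩ := h g₂
  exact ⟨g₁, by rw [map_mul (Dh.toEnd r), Module.End.mul_apply, h1', h1], by rw [h2, h2', mul_assoc]⟩

theorem hasLeading_coeffHom (f : Coeff r) (n : Fin r →₀ ℕ) :
    HasLeading (coeffHom r f) n (evalQZero r f) :=
  fun g => ⟨f * g, by rw [toEnd_coeffHom]; ring, map_mul _ _ _⟩

theorem hasLeading_zero (n : Fin r →₀ ℕ) : HasLeading 0 n 0 :=
  fun g => ⟨0, by simp, by simp⟩

theorem hasLeading_one (n : Fin r →₀ ℕ) : HasLeading 1 n 1 :=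
  fun g => ⟨g, by simp, by simp⟩

/-- Since h∂_i(qⁿg) = qⁿ(h n_i g + h q_i ∂g/∂q_i) and the last term vanishes at q = 0, the leading
action is multiplication by h n_i. An operator thus acts on leading terms through its symbol at q =
0 with b = hn. -/
theorem hasLeading_hPartial (i : Fin r) (n : Fin r →₀ ℕ) :
    HasLeading (hPartial i) n (Polynomial.X * Polynomial.C (n i : ℂ)) := by
  intro g
  refine ⟨MvPolynomial.X none * (MvPolynomial.X (some i) * MvPolynomial.pderiv (some i) g) +
    MvPolynomial.X none * MvPolynomial.C (n i : ℂ) * g, ?_, ?_⟩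
  · have h := X_mul_pderiv_qMonomial i n
    rw [nsmul_eq_mul] at h
    rw [toEnd_hPartial, Derivation.leibniz, smul_eq_mul, smul_eq_mul, map_natCast]
    linear_combination (MvPolynomial.X none * g) * h
  · simp only [map_add, map_mul, evalQZero_X_some, evalQZero_X_none, evalQZero_C]
    ring

theorem hasLeading_monomialOp (k n : Fin r →₀ ℕ) :
    HasLeading (monomialOp k) n
      (MvPolynomial.eval (fun i => Polynomial.X * Polynomial.C (n i : ℂ))
        (MvPolynomial.monomial k (1 : Polynomial ℂ))) := by
  induction k using monomialOp_induction with
  | zero => rw [monomialOp_zero, MvPolynomial.monomial_zero', map_one, map_one]; exact hasLeading_one n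
  | step a k ih =>
    rw [monomialOp_add, monomialOp_single]
    convert (hasLeading_hPartial a n).mul ih using 1
    rw [MvPolynomial.monomial_single_add, pow_one, map_mul, MvPolynomial.eval_X]

theorem hasLeading_opOfSymbol (N : MvPolynomial (Fin r) (Coeff r)) (n : Fin r →₀ ℕ) :
    HasLeading (opOfSymbol N) n
      (MvPolynomial.eval (fun i => Polynomial.X * Polynomial.C (n i : ℂ))
        (MvPolynomial.map (evalQZero r).toRingHom N)) := by
  induction N using MvPolynomial.induction_on' with
  | monomial k c =>
    rw [opOfSymbol_monomial]
    convert (hasLeading_coeffHom c n).mul (hasLeading_monomialOp k n) using 1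
    rw [MvPolynomial.map_monomial, MvPolynomial.eval_monomial, MvPolynomial.eval_monomial, one_mul]
    rfl
  | add N N' h h' =>
    rw [opOfSymbol_add, map_add, map_add]
    exact h.add h'

/-- The points b = (hn₁,…,hn_r) fill a product of infinite subsets of the domain ℂ[h], and a
polynomial is determined by its values on such a product. -/
theorem eq_of_eval_X_mul_natCast {G G' : MvPolynomial (Fin r) (Polynomial ℂ)}
    (h : ∀ n : Fin r →₀ ℕ, MvPolynomial.eval (fun i => Polynomial.X * Polynomial.C (n i : ℂ)) G =
      MvPolynomial.eval (fun i => Polynomial.X * Polynomial.C (n i : ℂ)) G') : G = G' := by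
  refine MvPolynomial.funext_set
    (fun _ => Set.range fun k : ℕ => (Polynomial.X * Polynomial.C (k : ℂ) : Polynomial ℂ))
    (fun _ => ?_) fun x hx => ?_
  · refine Set.infinite_range_of_injective fun k l hkl => ?_
    have := Polynomial.C_injective (mul_left_cancel₀ Polynomial.X_ne_zero hkl)
    exact_mod_cast this
  · choose n hn using fun i => hx i (Set.mem_univ i)
    have hx' : x = fun i => Polynomial.X * Polynomial.C (n i : ℂ) := funext fun i => (hn i).symm
    rw [hx']
    exact h (Finsupp.equivFunOnFinite.symm n)

variable {κ ι : Type*} {N : κ → MvPolynomial (Fin r) (Coeff r)}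

/-- Leading actions multiply like commuting polynomials. This turns membership in the noncommutative
left ideal into membership in an ordinary ideal, the one generated by the symbols at q = 0. -/
theorem exists_hasLeading_of_mem_span {D : Dh r}
    (hD : D ∈ Submodule.span (Dh r) (Set.range fun k => opOfSymbol (N k))) :
    ∃ G ∈ Ideal.span (Set.range fun k => MvPolynomial.map (evalQZero r).toRingHom (N k)),
      ∀ n : Fin r →₀ ℕ, HasLeading D n
        (MvPolynomial.eval (fun i => Polynomial.X * Polynomial.C (n i : ℂ)) G) := by
  induction hD using Submodule.span_induction with
  | mem x hx =>
    obtain ⟨k, rfl⟩ := hx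
    exact ⟨_, Ideal.subset_span ⟨k, rfl⟩, fun n => hasLeading_opOfSymbol _ n⟩
  | zero => exact ⟨0, Ideal.zero_mem _, fun n => by rw [map_zero]; exact hasLeading_zero n⟩
  | add x y _ _ hx hy =>
    obtain ⟨G, h1, h2⟩ := hx
    obtain ⟨G', h1', h2'⟩ := hy
    exact ⟨_, Ideal.add_mem _ h1 h1', fun n => by rw [map_add]; exact (h2 n).add (h2' n)⟩
  | smul A x _ hx =>
    obtain ⟨G, h1, h2⟩ := hx
    obtain ⟨N', rfl⟩ := exists_eq_opOfSymbol A
    exact ⟨_, Ideal.mul_mem_left _ (MvPolynomial.map (evalQZero r).toRingHom N') h1,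
      fun n => by rw [map_mul]; exact (hasLeading_opOfSymbol N' n).mul (h2 n)⟩

/-- Constants commute with every h∂_i, so for constant coefficients normal ordering costs nothing.
-/
theorem opOfSymbol_map_C_mul (A G : MvPolynomial (Fin r) ℂ) :
    opOfSymbol (MvPolynomial.map (MvPolynomial.C : ℂ →+* Coeff r) (A * G)) =
      opOfSymbol (MvPolynomial.map MvPolynomial.C A) *
        opOfSymbol (MvPolynomial.map MvPolynomial.C G) := by
  induction A using MvPolynomial.induction_on' with
  | monomial k c =>
    induction G using MvPolynomial.induction_on' with
    | monomial l d =>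
      rw [MvPolynomial.monomial_mul, MvPolynomial.map_monomial, MvPolynomial.map_monomial,
        MvPolynomial.map_monomial, opOfSymbol_monomial, opOfSymbol_monomial, opOfSymbol_monomial,
        map_mul, map_mul, monomialOp_add, mul_assoc, ← mul_assoc (coeffHom r (MvPolynomial.C d)),
        coeffHom_C_comm d, mul_assoc, mul_assoc]
    | add G G' h h' => rw [mul_add, map_add, map_add, opOfSymbol_add, opOfSymbol_add, mul_add, h, h']
  | add A A' h h' => rw [add_mul, map_add, map_add, opOfSymbol_add, opOfSymbol_add, add_mul, h, h']

/-- The submodule `(q) M^h`. -/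
noncomputable def qSubmodule (N : κ → MvPolynomial (Fin r) (Coeff r)) :
    Submodule (Coeff r) (DMod N) :=
  RingHom.ker (evalQZero r) • ⊤

/-- Moving h∂_a past f produces the correction h q_a ∂f/∂q_a, which is again in the ideal (q). It
matters here that the derivation is logarithmic. -/
theorem hPartial_smul_mem_qSubmodule (a : Fin r) {x : DMod N} (hx : x ∈ qSubmodule N) :
    hPartial a • x ∈ qSubmodule N := by
  refine Submodule.smul_induction_on (p := fun x => hPartial a • x ∈ qSubmodule N) hx
    (fun f hf y _ => ?_) fun y z hy hz => ?_
  · rw [DMod.coeff_smul, smul_smul, hPartial_mul_coeffHom, add_smul, ← smul_smul,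
      ← DMod.coeff_smul, ← DMod.coeff_smul]
    refine add_mem (Submodule.smul_mem_smul hf trivial) (Submodule.smul_mem_smul ?_ trivial)
    rw [RingHom.mem_ker, map_mul, map_mul, evalQZero_X_some, zero_mul, mul_zero]
  · rw [smul_add]
    exact add_mem hy hz

theorem smul_mem_qSubmodule (A : Dh r) {x : DMod N} (hx : x ∈ qSubmodule N) :
    A • x ∈ qSubmodule N := by
  induction A using Dh.induction generalizing x with
  | coeff f => exact Submodule.smul_mem _ f hx
  | partials i => exact hPartial_smul_mem_qSubmodule i hx
  | add y z hy hz => rw [add_smul]; exact add_mem (hy hx) (hz hx)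
  | mul y z hy hz => rw [← smul_smul]; exact hy (hz hx)

theorem mk_opOfSymbol_mem_qSubmodule {S : MvPolynomial (Fin r) (Coeff r)}
    (hS : MvPolynomial.map (evalQZero r).toRingHom S = 0) :
    DMod.mk N (opOfSymbol S) ∈ qSubmodule N := by
  rw [opOfSymbol, DMod.mk_sum]
  refine sum_mem fun n _ => ?_
  rw [DMod.mk_coeffHom_mul]
  refine Submodule.smul_mem_smul ?_ trivial
  have := congrArg (MvPolynomial.coeff n) hS
  rwa [MvPolynomial.coeff_map, MvPolynomial.coeff_zero] at this

/-- A generator R₀ differs from N_k by a symbol that vanishes at q = 0, and the operator of N_k is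
zero in the module. The rest of the ideal follows because (q)M^h is stable under D^h. -/
theorem mk_opOfSymbol_map_C_mem_qSubmodule {R₀ : κ → MvPolynomial (Fin r) ℂ}
    (hN : ∀ k, MvPolynomial.map (evalQZero r).toRingHom (N k) =
      MvPolynomial.map Polynomial.C (R₀ k)) {G : MvPolynomial (Fin r) ℂ}
    (hG : G ∈ Ideal.span (Set.range R₀)) :
    DMod.mk N (opOfSymbol (MvPolynomial.map MvPolynomial.C G)) ∈ qSubmodule N := by
  induction hG using Submodule.span_induction with
  | mem x hx =>
    obtain ⟨k, rfl⟩ := hx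
    have h : opOfSymbol (MvPolynomial.map MvPolynomial.C (R₀ k)) =
        opOfSymbol (MvPolynomial.map MvPolynomial.C (R₀ k) - N k) + opOfSymbol (N k) := by
      rw [← opOfSymbol_add, sub_add_cancel]
    rw [h, DMod.mk_add, DMod.mk_eq_zero.2 (Submodule.subset_span ⟨k, rfl⟩), add_zero]
    refine mk_opOfSymbol_mem_qSubmodule ?_
    rw [map_sub, hN, MvPolynomial.map_map, sub_eq_zero]
    congr 2
    ext c : 1
    exact evalQZero_C c
  | zero =>
    rw [map_zero]
    exact mk_opOfSymbol_mem_qSubmodule (map_zero _)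
  | add x y _ _ hx hy =>
    rw [map_add, opOfSymbol_add, DMod.mk_add]
    exact add_mem hx hy
  | smul A x _ hx =>
    rw [smul_eq_mul, opOfSymbol_map_C_mul, DMod.mk_mul]
    exact smul_mem_qSubmodule _ hx

theorem evalQZero_repr_of_mem_qSubmodule {P : Module.Basis ι (Coeff r) (DMod N)} {x : DMod N}
    (hx : x ∈ qSubmodule N) (j : ι) : evalQZero r (P.repr x j) = 0 := by
  refine Submodule.smul_induction_on (p := fun x => evalQZero r (P.repr x j) = 0) hx
    (fun f hf y _ => ?_) fun y z hy hz => ?_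
  · rw [map_smul, Finsupp.smul_apply, smul_eq_mul, map_mul, RingHom.mem_ker.1 hf, zero_mul]
  · rw [map_add, Finsupp.add_apply, map_add, hy, hz, add_zero]

/-- Let S be the symbol of the relation for h∂_a P_k. At q = 0 it lies in the ideal generated over
ℂ[h] by the R₀, which are free of h, so its specializations at h = z and h = w both lie in the ideal
(R₀). Their difference no longer contains the monomial of h∂_a P_k: it is a complex combination of
the monomials of the basis whose class lies in (q)M^h. By freeness its coefficients vanish. -/
theorem eval_evalQZero_hOmega [Fintype ι] {R₀ : κ → MvPolynomial (Fin r) ℂ}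
    (hN : ∀ k, MvPolynomial.map (evalQZero r).toRingHom (N k) =
      MvPolynomial.map Polynomial.C (R₀ k)) {e : ι → Fin r →₀ ℕ}
    {P : Module.Basis ι (Coeff r) (DMod N)}
    (hP : ∀ j, P j = DMod.mk N (monomialOp (e j))) (a : Fin r) (j k : ι) (z w : ℂ) :
    (evalQZero r (hOmega P a j k)).eval z = (evalQZero r (hOmega P a j k)).eval w := by
  have hmem := DMod.mk_eq_zero.1 ((DMod.mk_sub _ _).trans
    (sub_eq_zero.2 (mk_hPartial_mul_eq_sum hP a k)))
  obtain ⟨G, hG, hlead⟩ := exists_hasLeading_of_mem_span hmem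
  set S : MvPolynomial (Fin r) (Coeff r) :=
    MvPolynomial.monomial (Finsupp.single a 1 + e k) 1 +
      ∑ j, MvPolynomial.monomial (e j) (-hOmega P a j k) with hS
  have hop : ∀ s : Finset ι, opOfSymbol (∑ j ∈ s, MvPolynomial.monomial (e j) (-hOmega P a j k)) =
      -∑ j ∈ s, coeffHom r (hOmega P a j k) * monomialOp (e j) := by
    classical
    intro s
    induction s using Finset.induction with
    | empty => simp [opOfSymbol]
    | insert b s hb ih =>
      rw [Finset.sum_insert hb, Finset.sum_insert hb, opOfSymbol_add, ih, opOfSymbol_monomial,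
        map_neg, neg_mul, neg_add]
  have hSop : opOfSymbol S = hPartial a * monomialOp (e k) -
      ∑ j, coeffHom r (hOmega P a j k) * monomialOp (e j) := by
    rw [hS, opOfSymbol_add, opOfSymbol_monomial, hop, map_one, one_mul, monomialOp_add,
      monomialOp_single, sub_eq_add_neg]
  -- The operator determines its leading actions, and these determine the polynomial at q = 0.
  have hGS : MvPolynomial.map (evalQZero r).toRingHom S = G :=
    eq_of_eval_X_mul_natCast fun n => (hSop ▸ hasLeading_opOfSymbol S n).unique (hlead n)
  rw [← hGS] at hG
  have hspec : ∀ z : ℂ, MvPolynomial.map (Polynomial.evalRingHom z)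
      (MvPolynomial.map (evalQZero r).toRingHom S) ∈ Ideal.span (Set.range R₀) := by
    intro z
    have := Ideal.mem_map_of_mem (MvPolynomial.map (Polynomial.evalRingHom z)) hG
    rw [Ideal.map_span, ← Set.range_comp] at this
    convert this using 3
    funext k
    rw [Function.comp_apply, hN, MvPolynomial.map_map]
    have : (Polynomial.evalRingHom z).comp Polynomial.C = RingHom.id ℂ := by
      ext c
      simp
    rw [this, MvPolynomial.map_id]
  have hdiff := sub_mem (hspec w) (hspec z)
  have hexp : ∀ z : ℂ, MvPolynomial.map (Polynomial.evalRingHom z)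
      (MvPolynomial.map (evalQZero r).toRingHom S) =
      MvPolynomial.monomial (Finsupp.single a 1 + e k) 1 -
        ∑ j, MvPolynomial.monomial (e j) ((evalQZero r (hOmega P a j k)).eval z) := by
    intro z
    rw [hS]
    simp only [map_add, map_sum, MvPolynomial.map_monomial, map_one, map_neg,
      Finset.sum_neg_distrib, sub_eq_add_neg]
    rfl
  rw [hexp, hexp, sub_sub_sub_cancel_left, ← Finset.sum_sub_distrib] at hdiff
  have h1 := evalQZero_repr_of_mem_qSubmodule (P := P) (mk_opOfSymbol_map_C_mem_qSubmodule hN hdiff) j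
  have hop' : ∀ (s : Finset ι) (c : ι → ℂ), opOfSymbol (MvPolynomial.map MvPolynomial.C
      (∑ j ∈ s, MvPolynomial.monomial (e j) (c j))) =
      ∑ j ∈ s, coeffHom r (MvPolynomial.C (c j)) * monomialOp (e j) := by
    classical
    intro s c
    induction s using Finset.induction with
    | empty => simp [opOfSymbol]
    | insert b s hb ih =>
      rw [Finset.sum_insert hb, Finset.sum_insert hb, map_add, opOfSymbol_add, ih,
        MvPolynomial.map_monomial, opOfSymbol_monomial]
  simp only [← map_sub] at h1
  rw [hop', DMod.mk_sum] at h1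
  simp only [DMod.mk_coeffHom_mul, ← hP] at h1
  rw [P.repr_sum_self, evalQZero_C, Polynomial.C_eq_zero, sub_eq_zero] at h1
  exact h1

theorem evalQZero_eq_map_optionEquivLeft (f : Coeff r) : evalQZero r f =
    (MvPolynomial.optionEquivLeft ℂ (Fin r) f).map MvPolynomial.constantCoeff := by
  induction f using MvPolynomial.induction_on with
  | C a => simp [MvPolynomial.optionEquivLeft_C]
  | add f g hf hg => rw [map_add, map_add, Polynomial.map_add, hf, hg]
  | mul_X f o hf =>
    rw [map_mul, map_mul, Polynomial.map_mul, hf]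
    cases o with
    | none => rw [evalQZero_X_none, MvPolynomial.optionEquivLeft_X_none, Polynomial.map_X]
    | some i =>
      rw [evalQZero_X_some, MvPolynomial.optionEquivLeft_X_some, Polynomial.map_C,
        MvPolynomial.constantCoeff_X, Polynomial.C_0]

theorem constantCoeff_hCoeff (n : ℕ) (f : Coeff r) :
    MvPolynomial.constantCoeff (hCoeff n f) = (evalQZero r f).coeff n := by
  rw [evalQZero_eq_map_optionEquivLeft, Polynomial.coeff_map]
  rfl

theorem constantCoeff_theta [Fintype ι] {R : κ → MvPolynomial (Fin r) (QPoly r)}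
    (hN : IsQuantization R N) {e : ι → Fin r →₀ ℕ} {P : Module.Basis ι (Coeff r) (DMod N)}
    (hP : ∀ j, P j = DMod.mk N (monomialOp (e j))) (i : ℕ) (a : Fin r) (j k : ι) :
    MvPolynomial.constantCoeff (theta P i a j k) = 0 := by
  have hN' : ∀ k, MvPolynomial.map (evalQZero r).toRingHom (N k) = MvPolynomial.map Polynomial.C
      (MvPolynomial.map MvPolynomial.constantCoeff (R k)) := by
    intro k
    rw [MvPolynomial.map_map]
    exact hN.at_q_zero k
  have h : evalQZero r (hOmega P a j k) =
      Polynomial.C ((evalQZero r (hOmega P a j k)).eval 0) := by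
    refine Polynomial.funext fun z => ?_
    rw [Polynomial.eval_C]
    exact eval_evalQZero_hOmega hN' hP a j k z 0
  rw [theta, Matrix.map_apply, constantCoeff_hCoeff, h, Polynomial.coeff_C_succ]

end AtZero

end QuantumDModule

namespace QuantumDModule

/-! ### Triangular matrices -/

section Triangular

variable {ι A : Type*} {deg : ι → ℕ} {l l' : ℤ}

theorem IsTriangular.mono [Zero A] {M : Matrix ι ι A} (h : IsTriangular deg l M) (hl : l' ≤ l) :
    IsTriangular deg l' M := fun j k hjk => h j k (by omega)

theorem isTriangular_zero [Zero A] : IsTriangular deg l (0 : Matrix ι ι A) := fun _ _ _ => rfl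

variable [Ring A] {M M' : Matrix ι ι A}

theorem IsTriangular.add (h : IsTriangular deg l M) (h' : IsTriangular deg l M') :
    IsTriangular deg l (M + M') := fun j k hjk => by
  rw [Matrix.add_apply, h j k hjk, h' j k hjk, add_zero]

theorem IsTriangular.sub (h : IsTriangular deg l M) (h' : IsTriangular deg l M') :
    IsTriangular deg l (M - M') := fun j k hjk => by
  rw [Matrix.sub_apply, h j k hjk, h' j k hjk, sub_zero]

theorem IsTriangular.smul {𝕜 : Type*} [SMulZeroClass 𝕜 A] (c : 𝕜) (h : IsTriangular deg l M) :
    IsTriangular deg l (c • M) := fun j k hjk => by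
  rw [Matrix.smul_apply, h j k hjk, smul_zero]

theorem IsTriangular.sum {α : Type*} {s : Finset α} {F : α → Matrix ι ι A}
    (h : ∀ i ∈ s, IsTriangular deg l (F i)) : IsTriangular deg l (∑ i ∈ s, F i) := fun j k hjk => by
  rw [Matrix.sum_apply]
  exact Finset.sum_eq_zero fun i hi => h i hi j k hjk

theorem IsTriangular.mul [Fintype ι] (h : IsTriangular deg l M) (h' : IsTriangular deg l' M') :
    IsTriangular deg (l + l') (M * M') := fun j k hjk => by
  rw [Matrix.mul_apply]
  refine Finset.sum_eq_zero fun i _ => ?_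
  by_cases hi : (deg i : ℤ) < deg j + l
  · rw [h j i hi, zero_mul]
  · rw [h' i k (by omega), mul_zero]

theorem IsTriangular.lie [Fintype ι] (h : IsTriangular deg l M) (h' : IsTriangular deg l' M') :
    IsTriangular deg (l + l') ⁅M, M'⁆ := by
  rw [Ring.lie_def]
  exact (h.mul h').sub ((h'.mul h).mono (by omega))

theorem isTriangular_one [DecidableEq ι] : IsTriangular deg 0 (1 : Matrix ι ι A) :=
  fun j k hjk => Matrix.one_apply_ne (by rintro rfl; omega)

theorem IsTriangular.pow [Fintype ι] [DecidableEq ι] (h : IsTriangular deg l M) (n : ℕ) :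
    IsTriangular deg (n * l) (M ^ n) := by
  induction n with
  | zero => simpa using isTriangular_one
  | succ n ih =>
    rw [pow_succ]
    exact (ih.mul h).mono (by push_cast; linarith)

theorem IsTriangular.eq_zero {m : ℕ} (hm : ∀ j, deg j ≤ m) (h : IsTriangular deg l M)
    (hl : (m : ℤ) < l) : M = 0 := by
  ext j k
  exact h j k (by have := hm k; omega)

theorem IsTriangular.isNilpotent [Fintype ι] [DecidableEq ι] (h : IsTriangular deg l M)
    (hl : 1 ≤ l) : IsNilpotent M := by
  have hm : ∀ j, deg j ≤ Finset.univ.sup deg := fun j => Finset.le_sup (Finset.mem_univ j)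
  refine ⟨Finset.univ.sup deg + 1, (h.pow _).eq_zero hm ?_⟩
  push_cast
  nlinarith

theorem isTriangular_iff_diagPart {d : ℤ} : IsTriangular deg d M ↔
    ∀ l < d, diagPart deg l M = 0 := by
  constructor
  · intro h l hl
    ext j k
    rw [diagPart, Matrix.of_apply]
    split_ifs with hjk
    · exact h j k (by omega)
    · rfl
  · intro h j k hjk
    have := congrFun (congrFun (h (deg k - deg j) (by omega)) j) k
    rwa [diagPart, Matrix.of_apply, if_pos (by omega)] at this

theorem diagPart_sub : diagPart deg l (M - M') = diagPart deg l M - diagPart deg l M' := by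
  ext j k
  simp only [diagPart, Matrix.of_apply, Matrix.sub_apply]
  split_ifs
  · rfl
  · rw [sub_zero]

end Triangular

/-! ### Matrices of homogeneous polynomials -/

section Homogeneous

variable {r : ℕ} {ι : Type*} {deg : ι → ℕ} {c c' : ℤ}

/-- The `(j,k)` entry is homogeneous of degree `2 (deg k - deg j - c)`. -/
def IsHomogeneousOfShift (deg : ι → ℕ) (c : ℤ) (M : Matrix ι ι (QPoly r)) : Prop :=
  ∀ j k, MvPolynomial.IsWeightedHomogeneous (fun _ : Fin r => (4 : ℤ)) (M j k)
    (2 * ((deg k : ℤ) - deg j - c))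

theorem weight_four (d : Fin r →₀ ℕ) :
    Finsupp.weight (fun _ : Fin r => (4 : ℤ)) d = 4 * d.degree := by
  rw [Finsupp.weight_apply, Finsupp.sum, Finsupp.degree_apply, Nat.cast_sum, Finset.mul_sum]
  exact Finset.sum_congr rfl fun i _ => by rw [nsmul_eq_mul, mul_comm]

theorem isWeightedHomogeneous_four_iff {f : QPoly r} {w : ℤ} :
    MvPolynomial.IsWeightedHomogeneous (fun _ : Fin r => (4 : ℤ)) f w ↔
      ∀ d, f.coeff d ≠ 0 → 4 * (d.degree : ℤ) = w := by
  constructor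
  · intro h d hd
    rw [← weight_four, h hd]
  · intro h d hd
    rw [weight_four, h d hd]

variable {M M' : Matrix ι ι (QPoly r)}

theorem isHomogeneousOfShift_zero : IsHomogeneousOfShift deg c (0 : Matrix ι ι (QPoly r)) :=
  fun _ _ => MvPolynomial.isWeightedHomogeneous_zero _ _ _

theorem IsHomogeneousOfShift.add (h : IsHomogeneousOfShift deg c M)
    (h' : IsHomogeneousOfShift deg c M') : IsHomogeneousOfShift deg c (M + M') :=
  fun j k => (h j k).add (h' j k)

theorem IsHomogeneousOfShift.neg (h : IsHomogeneousOfShift deg c M) :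
    IsHomogeneousOfShift deg c (-M) := fun j k =>
  (MvPolynomial.weightedHomogeneousSubmodule ℂ _ _).neg_mem (h j k)

theorem IsHomogeneousOfShift.sub (h : IsHomogeneousOfShift deg c M)
    (h' : IsHomogeneousOfShift deg c M') : IsHomogeneousOfShift deg c (M - M') := by
  rw [sub_eq_add_neg]
  exact h.add h'.neg

theorem IsHomogeneousOfShift.sum {α : Type*} {s : Finset α} {F : α → Matrix ι ι (QPoly r)}
    (h : ∀ i ∈ s, IsHomogeneousOfShift deg c (F i)) :
    IsHomogeneousOfShift deg c (∑ i ∈ s, F i) := fun j k => by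
  rw [Matrix.sum_apply]
  exact MvPolynomial.IsWeightedHomogeneous.sum _ _ _ fun i hi => h i hi j k

theorem IsHomogeneousOfShift.mul [Fintype ι] (h : IsHomogeneousOfShift deg c M)
    (h' : IsHomogeneousOfShift deg c' M') : IsHomogeneousOfShift deg (c + c') (M * M') :=
  fun j k => by
  rw [Matrix.mul_apply]
  refine MvPolynomial.IsWeightedHomogeneous.sum _ _ _ fun i _ => ?_
  convert (h j i).mul (h' i k) using 1
  ring

theorem IsHomogeneousOfShift.lie [Fintype ι] (h : IsHomogeneousOfShift deg c M)
    (h' : IsHomogeneousOfShift deg c' M') : IsHomogeneousOfShift deg (c + c') ⁅M, M'⁆ := by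
  rw [Ring.lie_def]
  exact (h.mul h').sub (add_comm c c' ▸ h'.mul h)

theorem isHomogeneousOfShift_one [DecidableEq ι] :
    IsHomogeneousOfShift deg 0 (1 : Matrix ι ι (QPoly r)) := fun j k => by
  by_cases h : j = k
  · subst h
    rw [Matrix.one_apply_eq, sub_self, sub_zero, mul_zero]
    exact MvPolynomial.isWeightedHomogeneous_one _ _
  · rw [Matrix.one_apply_ne h]
    exact MvPolynomial.isWeightedHomogeneous_zero _ _ _

theorem IsHomogeneousOfShift.deg_eq (h : IsHomogeneousOfShift deg c M) {j k : ι}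
    (hjk : MvPolynomial.constantCoeff (M j k) ≠ 0) : (deg k : ℤ) = deg j + c := by
  have := isWeightedHomogeneous_four_iff.1 (h j k) 0 hjk
  rw [map_zero] at this
  push_cast at this
  omega

/-- Degrees of nonzero polynomials are nonnegative, so an entry whose prescribed degree is negative
is zero. -/
theorem IsHomogeneousOfShift.isTriangular (h : IsHomogeneousOfShift deg c M) :
    IsTriangular deg c M := fun j k hjk => by
  ext d
  by_contra hd
  have := isWeightedHomogeneous_four_iff.1 (h j k) d hd
  omega

/-- A nonzero entry without constant term has degree at least 4, the degree of q_a, and 4 amounts to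
two blocks. This is the source of every shift by 2 in the triangularity statements. -/
theorem IsHomogeneousOfShift.isTriangular_of_constantCoeff (h : IsHomogeneousOfShift deg c M)
    (h0 : ∀ j k, MvPolynomial.constantCoeff (M j k) = 0) : IsTriangular deg (c + 2) M :=
  fun j k hjk => by
  ext d
  by_contra hd
  have := isWeightedHomogeneous_four_iff.1 (h j k) d hd
  by_cases hd0 : d = 0
  · subst hd0
    exact hd (h0 j k)
  · have : d.degree ≠ 0 := by rwa [Ne, Finsupp.degree_eq_zero_iff]
    omega

theorem IsHomogeneousOfShift.constantCoeff_eq_zero (h : IsHomogeneousOfShift deg c M)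
    {l : ℤ} (ht : IsTriangular deg l M) (hl : c < l) (j k : ι) :
    MvPolynomial.constantCoeff (M j k) = 0 := by
  by_contra h0
  have := h.deg_eq h0
  exact h0 (by rw [ht j k (by omega), map_zero])

theorem hCoeff_isWeightedHomogeneous {f : Coeff r} {w : ℤ}
    (hf : MvPolynomial.IsWeightedHomogeneous (coeffDegree r) f w) (n : ℕ) :
    MvPolynomial.IsWeightedHomogeneous (fun _ : Fin r => (4 : ℤ)) (hCoeff n f) (w - 2 * n) := by
  rw [isWeightedHomogeneous_four_iff]
  intro d hd
  rw [hCoeff, MvPolynomial.optionEquivLeft_coeff_coeff] at hd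
  have := hf hd
  rw [Finsupp.weight_apply, Finsupp.sum_option_index _ _ (by simp)
    (by intro o a b; rw [add_smul])] at this
  simp only [Finsupp.optionElim_apply_none, Finsupp.some_optionElim, coeffDegree, nsmul_eq_mul] at this
  rw [← this, ← weight_four, Finsupp.weight_apply]
  simp only [nsmul_eq_mul]
  ring

end Homogeneous

/-! ### Logarithmic derivatives of polynomials -/

section LogDeriv

variable {r : ℕ} {ι : Type*}

theorem coeff_X_mul_pderiv {σ : Type*} (a : σ) (f : MvPolynomial σ ℂ) (d : σ →₀ ℕ) :
    (MvPolynomial.X a * MvPolynomial.pderiv a f).coeff d = d a * f.coeff d := by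
  classical
  induction f using MvPolynomial.induction_on' with
  | monomial e c =>
    rw [MvPolynomial.X_mul_pderiv_monomial, MvPolynomial.coeff_smul, MvPolynomial.coeff_monomial,
      nsmul_eq_mul]
    split_ifs with h
    · rw [h]
    · rw [mul_zero, mul_zero]
  | add f g hf hg =>
    rw [map_add, mul_add, MvPolynomial.coeff_add, MvPolynomial.coeff_add, hf, hg, mul_add]

theorem coeff_sum_X_mul_pderiv (f : QPoly r) (d : Fin r →₀ ℕ) :
    (∑ a, MvPolynomial.X a * MvPolynomial.pderiv a f).coeff d = d.degree * f.coeff d := by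
  rw [MvPolynomial.coeff_sum, Finset.sum_congr rfl fun a _ => coeff_X_mul_pderiv a f d,
    ← Finset.sum_mul, Finsupp.degree_eq_sum, Nat.cast_sum]

theorem eq_of_X_mul_pderiv_eq {f g : QPoly r}
    (h : ∀ a, MvPolynomial.X a * MvPolynomial.pderiv a f =
      MvPolynomial.X a * MvPolynomial.pderiv a g)
    (h0 : MvPolynomial.constantCoeff f = MvPolynomial.constantCoeff g) : f = g := by
  ext d
  by_cases hd : d = 0
  · subst hd; exact h0
  · obtain ⟨a, ha⟩ := Finsupp.ne_iff.1 hd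
    have := congrArg (MvPolynomial.coeff d) (h a)
    rw [coeff_X_mul_pderiv, coeff_X_mul_pderiv] at this
    exact mul_left_cancel₀ (by exact_mod_cast ha) this

/-- The Euler operator multiplies q^d by |d|, which is nonzero for d ≠ 0. -/
theorem eq_zero_of_sum_X_mul_pderiv_eq_zero {f : QPoly r}
    (h : ∑ a, MvPolynomial.X a * MvPolynomial.pderiv a f = 0)
    (h0 : MvPolynomial.constantCoeff f = 0) : f = 0 := by
  ext d
  by_cases hd : d = 0
  · subst hd; exact h0
  · have := congrArg (MvPolynomial.coeff d) h
    rw [coeff_sum_X_mul_pderiv, MvPolynomial.coeff_zero, mul_eq_zero, Nat.cast_eq_zero,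
      Finsupp.degree_eq_zero_iff] at this
    exact this.resolve_left hd

/-- The polynomial without constant term whose image under the Euler operator `∑ q_a ∂/∂q_a` is
`f`, if `f` has no constant term. -/
noncomputable def eulerPrimitive (f : QPoly r) : QPoly r :=
  ∑ d ∈ f.support, MvPolynomial.monomial d ((d.degree : ℂ)⁻¹ * f.coeff d)

theorem coeff_eulerPrimitive (f : QPoly r) (d : Fin r →₀ ℕ) :
    (eulerPrimitive f).coeff d = (d.degree : ℂ)⁻¹ * f.coeff d := by
  classical
  rw [eulerPrimitive, MvPolynomial.coeff_sum]
  simp only [MvPolynomial.coeff_monomial]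
  rw [Finset.sum_ite_eq']
  split_ifs with h
  · rfl
  · rw [MvPolynomial.notMem_support_iff.1 h, mul_zero]

theorem constantCoeff_eulerPrimitive (f : QPoly r) :
    MvPolynomial.constantCoeff (eulerPrimitive f) = 0 := by
  rw [MvPolynomial.constantCoeff_eq, coeff_eulerPrimitive, map_zero, Nat.cast_zero, inv_zero,
    zero_mul]

theorem sum_X_mul_pderiv_eulerPrimitive {f : QPoly r} (h0 : MvPolynomial.constantCoeff f = 0) :
    ∑ a, MvPolynomial.X a * MvPolynomial.pderiv a (eulerPrimitive f) = f := by
  ext d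
  rw [coeff_sum_X_mul_pderiv, coeff_eulerPrimitive]
  by_cases hd : d = 0
  · subst hd
    rw [MvPolynomial.constantCoeff_eq] at h0
    rw [h0, mul_zero, mul_zero]
  · rw [mul_inv_cancel_left₀]
    rwa [Ne, Nat.cast_eq_zero, Finsupp.degree_eq_zero_iff]

theorem eulerPrimitive_zero : eulerPrimitive (0 : QPoly r) = 0 := by
  rw [eulerPrimitive, MvPolynomial.support_zero, Finset.sum_empty]

theorem eulerPrimitive_isWeightedHomogeneous {f : QPoly r} {w : ℤ}
    (hf : MvPolynomial.IsWeightedHomogeneous (fun _ : Fin r => (4 : ℤ)) f w) :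
    MvPolynomial.IsWeightedHomogeneous (fun _ : Fin r => (4 : ℤ)) (eulerPrimitive f) w := by
  intro d hd
  rw [coeff_eulerPrimitive] at hd
  exact hf (right_ne_zero_of_mul hd)

theorem logDeriv_apply (a : Fin r) (M : Matrix ι ι (QPoly r)) (j k : ι) :
    logDeriv a M j k = MvPolynomial.X a * MvPolynomial.pderiv a (M j k) := rfl

theorem logDeriv_add (a : Fin r) (M M' : Matrix ι ι (QPoly r)) :
    logDeriv a (M + M') = logDeriv a M + logDeriv a M' := by
  ext1 j k
  rw [Matrix.add_apply, logDeriv_apply, logDeriv_apply, logDeriv_apply, Matrix.add_apply, map_add,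
    mul_add]

theorem logDeriv_sub (a : Fin r) (M M' : Matrix ι ι (QPoly r)) :
    logDeriv a (M - M') = logDeriv a M - logDeriv a M' := by
  ext1 j k
  rw [Matrix.sub_apply, logDeriv_apply, logDeriv_apply, logDeriv_apply, Matrix.sub_apply, map_sub,
    mul_sub]

theorem logDeriv_one [DecidableEq ι] (a : Fin r) : logDeriv a (1 : Matrix ι ι (QPoly r)) = 0 := by
  ext1 j k
  rw [logDeriv_apply, Matrix.one_apply]
  split_ifs <;> simp

theorem logDeriv_zero (a : Fin r) : logDeriv a (0 : Matrix ι ι (QPoly r)) = 0 := by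
  ext1 j k
  rw [logDeriv_apply, Matrix.zero_apply, map_zero, mul_zero]

theorem logDeriv_mul [Fintype ι] (a : Fin r) (M M' : Matrix ι ι (QPoly r)) :
    logDeriv a (M * M') = logDeriv a M * M' + M * logDeriv a M' := by
  ext1 j k
  rw [Matrix.add_apply, logDeriv_apply, Matrix.mul_apply, Matrix.mul_apply, Matrix.mul_apply,
    map_sum, Finset.mul_sum, ← Finset.sum_add_distrib]
  refine Finset.sum_congr rfl fun i _ => ?_
  rw [logDeriv_apply, logDeriv_apply, Derivation.leibniz, smul_eq_mul, smul_eq_mul]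
  ring

theorem logDeriv_comm (a b : Fin r) (M : Matrix ι ι (QPoly r)) :
    logDeriv a (logDeriv b M) = logDeriv b (logDeriv a M) := by
  ext j k d
  simp only [logDeriv_apply, coeff_X_mul_pderiv]
  ring

theorem evalAt_zero_apply (M : Matrix ι ι (QPoly r)) (j k : ι) :
    evalAt 0 M j k = MvPolynomial.constantCoeff (M j k) := by
  rw [evalAt, Matrix.map_apply, MvPolynomial.eval_zero]

end LogDeriv

end QuantumDModule

namespace QuantumDModule

/-! ### The system of differential equations -/

section System

set_option linter.unusedSectionVars false

variable {r : ℕ} {κ ι : Type*} [Fintype ι] {N : κ → MvPolynomial (Fin r) (Coeff r)}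
  {P : Module.Basis ι (Coeff r) (DMod N)} {deg : ι → ℕ} {m : ℕ}

/-- The connection matrices are homogeneous, and do not involve `h` at `q = 0`. -/
structure IsGraded (P : Module.Basis ι (Coeff r) (DMod N)) (deg : ι → ℕ) : Prop where
  homogeneous : ∀ a j k, MvPolynomial.IsWeightedHomogeneous (coeffDegree r) (hOmega P a j k)
    (2 * (deg k + 1 - deg j : ℤ))
  theta_zero : ∀ i a j k, MvPolynomial.constantCoeff (theta P i a j k) = 0

theorem IsGraded.omega_homogeneous (hP : IsGraded P deg) (a : Fin r) :
    IsHomogeneousOfShift deg (-1) (omega P a) := fun j k => by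
  have h := hCoeff_isWeightedHomogeneous (hP.homogeneous a j k) 0
  rwa [show (2 * (deg k + 1 - deg j) - 2 * (0 : ℕ) : ℤ) = 2 * ((deg k : ℤ) - deg j - -1) by
    push_cast; ring] at h

theorem IsGraded.theta_homogeneous (hP : IsGraded P deg) (i : ℕ) (a : Fin r) :
    IsHomogeneousOfShift deg i (theta P i a) := fun j k => by
  have h := hCoeff_isWeightedHomogeneous (hP.homogeneous a j k) (i + 1)
  rwa [show (2 * (deg k + 1 - deg j) - 2 * (i + 1 : ℕ) : ℤ) = 2 * ((deg k : ℤ) - deg j - i) by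
    push_cast; ring] at h

theorem IsGraded.omega_triangular (hP : IsGraded P deg) (a : Fin r) :
    IsTriangular deg (-1) (omega P a) := (hP.omega_homogeneous a).isTriangular

theorem IsGraded.theta_triangular (hP : IsGraded P deg) (i : ℕ) (a : Fin r) :
    IsTriangular deg (i + 2) (theta P i a) :=
  (hP.theta_homogeneous i a).isTriangular_of_constantCoeff (hP.theta_zero i a)

variable [DecidableEq ι] {Q Q' Q'' : ℕ → Matrix ι ι (QPoly r)}

theorem IsTriangularFamily.isTriangular (hQ : IsTriangularFamily deg Q) (k : ℕ) :
    IsTriangular deg k (Q k) := by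
  cases k with
  | zero =>
    rw [← sub_add_cancel (Q 0) 1]
    exact (hQ.1.mono (by norm_num)).add isTriangular_one
  | succ k => exact (hQ.2 (k + 1) (by omega)).mono (by omega)

theorem IsTriangularFamily.lie_omega (hQ : IsTriangularFamily deg Q) (hP : IsGraded P deg)
    (a : Fin r) : IsTriangular deg 2 ⁅Q 1, omega P a⁆ :=
  ((hQ.2 1 le_rfl).lie (hP.omega_triangular a)).mono (by norm_num)

/-- For i ≥ 1 the terms θ^(i) and ⁅Q_{i+1}, ω⁆ attain i + 2 exactly, the latter as (i + 3) − 1; all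
other products have room to spare. -/
theorem IsTriangularFamily.systemRhs (hQ : IsTriangularFamily deg Q) (hP : IsGraded P deg)
    (i : ℕ) (a : Fin r) : IsTriangular deg (i + 2) (systemRhs P Q i a) := by
  cases i with
  | zero =>
    exact ((hQ.isTriangular 0).mul (((hP.theta_triangular 0 a).mono (by norm_num)).add
      (hQ.lie_omega hP a))).mono (by norm_num)
  | succ i =>
    refine ((((hP.theta_triangular (i + 1) a).add (IsTriangular.sum fun k hk => ?_)).add ?_).add
      ?_).sub ?_
    · rw [Finset.mem_Icc] at hk
      exact ((hQ.2 k hk.1).mul (hP.theta_triangular (i + 1 - k) a)).mono (by omega)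
    · exact ((hQ.2 (i + 1) (by omega)).lie (hP.theta_triangular 0 a)).mono (by omega)
    · exact ((hQ.2 (i + 2) (by omega)).lie (hP.omega_triangular a)).mono (by omega)
    · exact ((hQ.lie_omega hP a).mul (hQ.2 (i + 1) (by omega))).mono (by omega)

theorem IsGraded.systemRhs_homogeneous (hP : IsGraded P deg)
    (hQ : ∀ i : ℕ, IsHomogeneousOfShift deg i (Q i)) (i : ℕ) (a : Fin r) :
    IsHomogeneousOfShift deg i (systemRhs P Q i a) := by
  have cast : ∀ {c c' : ℤ} {M : Matrix ι ι (QPoly r)}, IsHomogeneousOfShift deg c M → c = c' →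
      IsHomogeneousOfShift deg c' M := fun h e => e ▸ h
  have hlie : IsHomogeneousOfShift deg 0 ⁅Q 1, omega P a⁆ :=
    cast ((hQ 1).lie (hP.omega_homogeneous a)) (by norm_num)
  cases i with
  | zero => exact cast ((hQ 0).mul ((hP.theta_homogeneous 0 a).add hlie)) (by norm_num)
  | succ i =>
    refine ((((hP.theta_homogeneous (i + 1) a).add
      (IsHomogeneousOfShift.sum fun k hk => ?_)).add ?_).add ?_).sub ?_
    · rw [Finset.mem_Icc] at hk
      exact cast ((hQ k).mul (hP.theta_homogeneous (i + 1 - k) a)) (by omega)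
    · exact cast ((hQ (i + 1)).lie (hP.theta_homogeneous 0 a)) (by omega)
    · exact cast ((hQ (i + 2)).lie (hP.omega_homogeneous a)) (by omega)
    · exact cast (hlie.mul (hQ (i + 1))) (by omega)

theorem sub_lie_of_ring {A : Type*} [Ring A] (x y z : A) : ⁅x - y, z⁆ = ⁅x, z⁆ - ⁅y, z⁆ := by
  simp only [Ring.lie_def]
  noncomm_ring

/-- If two triangular families agree up to a certain order, then so do the right hand sides. -/
theorem IsGraded.systemRhs_sub (hP : IsGraded P deg) (hQ' : IsTriangularFamily deg Q')
    (hQ'' : IsTriangularFamily deg Q'') {i : ℕ} {d : ℤ}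
    (h : ∀ k : ℕ, IsTriangular deg (k + d) (Q' k - Q'' k))
    (h' : ∀ k : ℕ, i < k → IsTriangular deg (k + d + 1) (Q' k - Q'' k)) (a : Fin r) :
    IsTriangular deg (i + d + 1) (systemRhs P Q' i a - systemRhs P Q'' i a) := by
  -- Only the commutator of the next unknown with ω is tight, since ω lowers triangularity by one;
  -- there the stronger assumption `h'` on larger indices is used. Every other term gains at least
  -- one diagonal from θ, from ⁅Q₁, ω⁆ or from the triangularity of the other factor.
  cases i with
  | zero =>
    have e : systemRhs P Q' 0 a - systemRhs P Q'' 0 a =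
        (Q' 0 - Q'' 0) * (theta P 0 a + ⁅Q' 1, omega P a⁆) +
          Q'' 0 * ⁅Q' 1 - Q'' 1, omega P a⁆ := by
      rw [sub_lie_of_ring]
      simp only [systemRhs]
      noncomm_ring
    rw [e]
    refine IsTriangular.add ?_ ?_
    · exact ((h 0).mul (((hP.theta_triangular 0 a).mono (by norm_num)).add
        (hQ'.lie_omega hP a))).mono (by push_cast; omega)
    · exact ((hQ''.isTriangular 0).mul ((h' 1 (by norm_num)).lie
        (hP.omega_triangular a))).mono (by push_cast; omega)
  | succ i =>
    have e : systemRhs P Q' (i + 1) a - systemRhs P Q'' (i + 1) a =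
        ∑ k ∈ Finset.Icc 1 i, (Q' k - Q'' k) * theta P (i + 1 - k) a +
          ⁅Q' (i + 1) - Q'' (i + 1), theta P 0 a⁆ + ⁅Q' (i + 2) - Q'' (i + 2), omega P a⁆ -
          (⁅Q' 1, omega P a⁆ * (Q' (i + 1) - Q'' (i + 1)) +
            ⁅Q' 1 - Q'' 1, omega P a⁆ * Q'' (i + 1)) := by
      simp only [systemRhs, sub_lie_of_ring, sub_mul, mul_sub, Finset.sum_sub_distrib]
      abel
    rw [e]
    refine (((IsTriangular.sum fun k hk => ?_).add ?_).add ?_).sub (IsTriangular.add ?_ ?_)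
    · rw [Finset.mem_Icc] at hk
      exact ((h k).mul (hP.theta_triangular (i + 1 - k) a)).mono (by omega)
    · exact ((h (i + 1)).lie (hP.theta_triangular 0 a)).mono (by omega)
    · exact ((h' (i + 2) (by omega)).lie (hP.omega_triangular a)).mono (by omega)
    · exact ((hQ'.lie_omega hP a).mul (h (i + 1))).mono (by omega)
    · exact (((h 1).lie (hP.omega_triangular a)).mul (hQ''.2 (i + 1) (by omega))).mono (by omega)

theorem IsTriangularFamily.sub_isTriangular (hQ' : IsTriangularFamily deg Q')
    (hQ'' : IsTriangularFamily deg Q'') (k : ℕ) :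
    IsTriangular deg (k + 2) (Q' k - Q'' k) := by
  cases k with
  | zero =>
    rw [← sub_sub_sub_cancel_right (Q' 0) (Q'' 0) 1]
    exact (hQ'.1.sub hQ''.1).mono (by norm_num)
  | succ k => exact (hQ'.2 (k + 1) (by omega)).sub (hQ''.2 (k + 1) (by omega))

/-- Below the diagonal k + 2 two triangular families agree automatically, the identity in Q₀
cancelling; beyond m there is nothing. What remains are exactly the unknowns of the system. -/
theorem IsTriangularFamily.sub_isTriangular_of_diagPart (hm : ∀ j, deg j ≤ m)
    (hQ' : IsTriangularFamily deg Q') (hQ'' : IsTriangularFamily deg Q'') {k : ℕ} {d : ℤ}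
    (h : ∀ l, IsIndex m (k, l) → (l : ℤ) < d → diagPart deg l (Q' k) = diagPart deg l (Q'' k)) :
    IsTriangular deg d (Q' k - Q'' k) := by
  intro x y hxy
  by_cases hk : (deg y : ℤ) < deg x + (k + 2)
  · exact hQ'.sub_isTriangular hQ'' k x y hk
  · obtain ⟨l, hl⟩ : ∃ l : ℕ, deg y = deg x + l := ⟨deg y - deg x, by omega⟩
    have hy := hm y
    have := congrFun (congrFun (h l ⟨by dsimp only; omega, by dsimp only; omega⟩ (by omega)) x) y
    rw [diagPart, diagPart, Matrix.of_apply, Matrix.of_apply, if_pos (by omega), if_pos (by omega)]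
      at this
    rw [Matrix.sub_apply, this, sub_self]

/-- The relevant number is the offset j − i. Unknowns of smaller offset all precede, which gives
agreement at every index; at equal offset those with larger j, equivalently larger i, precede as
well, which gives the extra diagonal needed for the commutator with ω. -/
theorem IsGraded.diagPart_systemRhs_eq (hP : IsGraded P deg) (hm : ∀ j, deg j ≤ m) {p : ℕ × ℕ}
    (hQ' : IsTriangularFamily deg Q') (hQ'' : IsTriangularFamily deg Q'')
    (h : ∀ p', IsIndex m p' → Precedes p' p →
      diagPart deg p'.2 (Q' p'.1) = diagPart deg p'.2 (Q'' p'.1)) (a : Fin r) :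
    diagPart deg p.2 (systemRhs P Q' p.1 a) = diagPart deg p.2 (systemRhs P Q'' p.1 a) := by
  have h1 : ∀ k : ℕ, IsTriangular deg (k + ((p.2 : ℤ) - p.1)) (Q' k - Q'' k) := fun k =>
    hQ'.sub_isTriangular_of_diagPart hm hQ'' fun l hl hlt =>
      h (k, l) hl (Or.inl (by dsimp only; omega))
  have h2 : ∀ k : ℕ, p.1 < k → IsTriangular deg (k + ((p.2 : ℤ) - p.1) + 1) (Q' k - Q'' k) :=
    fun k hk => hQ'.sub_isTriangular_of_diagPart hm hQ'' fun l hl hlt =>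
      h (k, l) hl (by simp only [Precedes]; omega)
  have h3 := isTriangular_iff_diagPart.1 (hP.systemRhs_sub hQ' hQ'' h1 h2 a) p.2 (by omega)
  rwa [diagPart_sub, sub_eq_zero] at h3

/-- Integration of the system along the Euler vector field. -/
noncomputable def eulerStep (P : Module.Basis ι (Coeff r) (DMod N))
    (Q : ℕ → Matrix ι ι (QPoly r)) (i : ℕ) : Matrix ι ι (QPoly r) :=
  (if i = 0 then 1 else 0) + (∑ a, systemRhs P Q i a).map eulerPrimitive

theorem eulerStep_triangular (hP : IsGraded P deg) (hQ : IsTriangularFamily deg Q) :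
    IsTriangularFamily deg (eulerStep P Q) := by
  have h : ∀ i : ℕ, IsTriangular deg (i + 2) ((∑ a, systemRhs P Q i a).map eulerPrimitive) := by
    intro i j k hjk
    rw [Matrix.map_apply, IsTriangular.sum (fun a _ => hQ.systemRhs hP i a) j k hjk,
      eulerPrimitive_zero]
  refine ⟨?_, fun i hi => ?_⟩
  · rw [eulerStep, if_pos rfl, add_sub_cancel_left]
    exact h 0
  · rw [eulerStep, if_neg (by omega), zero_add]
    exact h i

theorem eulerStep_homogeneous (hP : IsGraded P deg)
    (hQ : ∀ i : ℕ, IsHomogeneousOfShift deg i (Q i)) (i : ℕ) :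
    IsHomogeneousOfShift deg i (eulerStep P Q i) := by
  have h : IsHomogeneousOfShift deg i ((∑ a, systemRhs P Q i a).map eulerPrimitive) := fun j k =>
    eulerPrimitive_isWeightedHomogeneous
      (IsHomogeneousOfShift.sum (fun a _ => hP.systemRhs_homogeneous hQ i a) j k)
  rw [eulerStep]
  split_ifs with hi
  · subst hi
    exact isHomogeneousOfShift_one.add h
  · rwa [zero_add]

/-- The position of an unknown in the order of `Precedes`. -/
def indexRank (m : ℕ) (p : ℕ × ℕ) : ℕ := (p.2 - p.1) * (m + 1) + (m - p.2)

theorem indexRank_lt {p p' : ℕ × ℕ} (hp : IsIndex m p) (hp' : IsIndex m p') (h : Precedes p p') :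
    indexRank m p < indexRank m p' := by
  obtain ⟨h1, h2⟩ := hp
  obtain ⟨h1', h2'⟩ := hp'
  rw [indexRank, indexRank]
  rcases h with h | ⟨h, hlt⟩
  · have hle : p.2 - p.1 + 1 ≤ p'.2 - p'.1 := by omega
    have := Nat.mul_le_mul_right (m + 1) hle
    rw [add_mul, one_mul] at this
    omega
  · have : p.2 - p.1 = p'.2 - p'.1 := by omega
    rw [this]
    omega

/-- Iterate the Euler integration from (I, 0, 0, …). By the triangular dependence, an unknown of
rank less than n no longer changes after n steps, and the ranks are bounded. -/
theorem exists_fixed_eulerStep (hP : IsGraded P deg) (hm : ∀ j, deg j ≤ m) :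
    ∃ Q : ℕ → Matrix ι ι (QPoly r), IsTriangularFamily deg Q ∧
      (∀ i : ℕ, IsHomogeneousOfShift deg i (Q i)) ∧ eulerStep P Q = Q := by
  set F : ℕ → ℕ → Matrix ι ι (QPoly r) := fun n => (eulerStep P)^[n] fun i => if i = 0 then 1 else 0
    with hF
  have hF0 : F 0 = fun i => if i = 0 then 1 else 0 := rfl
  have hFs : ∀ n, F (n + 1) = eulerStep P (F n) := fun n => Function.iterate_succ_apply' _ _ _
  clear_value F
  clear hF
  have htri : ∀ n, IsTriangularFamily deg (F n) := by
    intro n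
    induction n with
    | zero =>
      rw [hF0]
      refine ⟨?_, fun i hi => ?_⟩
      · simpa using isTriangular_zero
      · dsimp only
        rw [if_neg (by omega)]
        exact isTriangular_zero
    | succ n ih =>
      rw [hFs]
      exact eulerStep_triangular hP ih
  have hhom : ∀ n (i : ℕ), IsHomogeneousOfShift deg i (F n i) := by
    intro n
    induction n with
    | zero =>
      intro i
      rw [hF0]
      dsimp only
      split_ifs with hi
      · subst hi
        exact isHomogeneousOfShift_one
      · exact isHomogeneousOfShift_zero
    | succ n ih =>
      rw [hFs]
      exact eulerStep_homogeneous hP ih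
  have hagree : ∀ n p, IsIndex m p → indexRank m p < n →
      diagPart deg p.2 (F n p.1) = diagPart deg p.2 (F (n + 1) p.1) := by
    intro n
    induction n with
    | zero => intro p _ h; omega
    | succ n ih =>
      intro p hp hlt
      have hrhs : ∀ a, diagPart deg p.2 (systemRhs P (F n) p.1 a) =
          diagPart deg p.2 (systemRhs P (F (n + 1)) p.1 a) :=
        hP.diagPart_systemRhs_eq hm (htri n) (htri (n + 1)) fun p' hp' hprec =>
          ih p' hp' (lt_of_lt_of_le (indexRank_lt hp' hp hprec) (by omega))
      rw [hFs n, hFs (n + 1)]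
      ext1 j k
      rw [diagPart, diagPart, Matrix.of_apply, Matrix.of_apply]
      split_ifs with hjk
      · have hsum : (∑ a, systemRhs P (F n) p.1 a) j k =
            (∑ a, systemRhs P (F (n + 1)) p.1 a) j k := by
          rw [Matrix.sum_apply, Matrix.sum_apply]
          refine Finset.sum_congr rfl fun a _ => ?_
          have := congrFun (congrFun (hrhs a) j) k
          rwa [diagPart, diagPart, Matrix.of_apply, Matrix.of_apply, if_pos hjk, if_pos hjk]
            at this
        rw [eulerStep, eulerStep, Matrix.add_apply, Matrix.add_apply, Matrix.map_apply,
          Matrix.map_apply, hsum]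
      · rfl
  -- The number m(m + 1) + m bounds all ranks.
  obtain ⟨n, hn⟩ : ∃ n, m * (m + 1) + m < n := ⟨_, lt_add_one _⟩
  refine ⟨F n, htri n, hhom n, ?_⟩
  rw [← hFs]
  funext k
  rw [← sub_eq_zero]
  refine IsTriangular.eq_zero hm (l := m + 1) ?_ (by omega)
  refine (htri (n + 1)).sub_isTriangular_of_diagPart hm (htri n) fun l hl _ => ?_
  refine (hagree n (k, l) hl ?_).symm
  have := Nat.mul_le_mul_right (m + 1) ((Nat.sub_le l k).trans hl.2)
  simp only [indexRank]
  omega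

/-- A fixed point solves the Euler component of the system provided the right-hand side has no
constant term. It has none: equation i is homogeneous with shift i, so a constant term could only
sit on diagonal i, whereas the right-hand side is (i+2)-triangular. -/
theorem exists_radial_solution (hP : IsGraded P deg) (hm : ∀ j, deg j ≤ m) :
    ∃ Q : ℕ → Matrix ι ι (QPoly r), IsTriangularFamily deg Q ∧
      (∀ i : ℕ, IsHomogeneousOfShift deg i (Q i)) ∧
      (∀ i, evalAt 0 (Q i) = if i = 0 then 1 else 0) ∧
      ∀ i, ∑ a, logDeriv a (Q i) = ∑ a, systemRhs P Q i a := by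
  obtain ⟨Q, hQ, hhom, hfix⟩ := exists_fixed_eulerStep hP hm
  refine ⟨Q, hQ, hhom, fun i => ?_, fun i => ?_⟩
  · ext j k
    rw [evalAt_zero_apply, ← hfix, eulerStep, Matrix.add_apply, map_add, Matrix.map_apply,
      constantCoeff_eulerPrimitive, add_zero]
    split_ifs
    · rw [Matrix.one_apply, Matrix.one_apply]
      split_ifs <;> simp
    · simp
  · ext1 j k
    conv_lhs => rw [← hfix]
    rw [Matrix.sum_apply, Finset.sum_congr rfl fun a _ => congrFun (congrFun (show
      logDeriv a (eulerStep P Q i) =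
        logDeriv a ((∑ a, systemRhs P Q i a).map eulerPrimitive) from ?_) j) k]
    · refine sum_X_mul_pderiv_eulerPrimitive ?_
      exact (IsHomogeneousOfShift.sum fun a _ =>
        hP.systemRhs_homogeneous hhom i a).constantCoeff_eq_zero
          (IsTriangular.sum fun a _ => hQ.systemRhs hP i a) (by omega) j k
    · rw [eulerStep, logDeriv_add]
      split_ifs
      · rw [logDeriv_one, zero_add]
      · rw [logDeriv_zero, zero_add]

end System

end QuantumDModule

namespace QuantumDModule

/-! ### Expansion in powers of `h` -/

section HCoeff

variable {r : ℕ} {ι : Type*}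

theorem hCoeff_add (n : ℕ) (f g : Coeff r) : hCoeff n (f + g) = hCoeff n f + hCoeff n g := by
  rw [hCoeff, map_add, Polynomial.coeff_add]; rfl

theorem hCoeff_sub (n : ℕ) (f g : Coeff r) : hCoeff n (f - g) = hCoeff n f - hCoeff n g := by
  rw [hCoeff, map_sub, Polynomial.coeff_sub]; rfl

theorem hCoeff_zero (n : ℕ) : hCoeff n (0 : Coeff r) = 0 := by
  rw [hCoeff, map_zero, Polynomial.coeff_zero]

theorem hCoeff_sum (n : ℕ) {α : Type*} (s : Finset α) (f : α → Coeff r) :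
    hCoeff n (∑ i ∈ s, f i) = ∑ i ∈ s, hCoeff n (f i) := by
  rw [hCoeff, map_sum, Polynomial.finsetSum_coeff]; rfl

theorem hCoeff_mul (n : ℕ) (f g : Coeff r) : hCoeff n (f * g) =
    ∑ p ∈ Finset.HasAntidiagonal.antidiagonal n, hCoeff p.1 f * hCoeff p.2 g := by
  rw [hCoeff, map_mul, Polynomial.coeff_mul]; rfl

theorem hCoeff_X_none_mul_succ (n : ℕ) (f : Coeff r) :
    hCoeff (n + 1) (MvPolynomial.X none * f) = hCoeff n f := by
  rw [hCoeff, map_mul, MvPolynomial.optionEquivLeft_X_none, Polynomial.coeff_X_mul]; rfl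

theorem hCoeff_X_none_mul_zero (f : Coeff r) : hCoeff 0 (MvPolynomial.X none * f) = 0 := by
  rw [hCoeff, map_mul, MvPolynomial.optionEquivLeft_X_none, Polynomial.coeff_X_mul_zero]

theorem optionEquivLeft_rename_some (f : QPoly r) :
    MvPolynomial.optionEquivLeft ℂ (Fin r) (MvPolynomial.rename some f) = Polynomial.C f := by
  induction f using MvPolynomial.induction_on with
  | C a => rw [MvPolynomial.rename_C, MvPolynomial.optionEquivLeft_C]
  | add f g hf hg => rw [map_add, map_add, hf, hg, map_add]
  | mul_X f i hf =>
    rw [map_mul, map_mul, hf, MvPolynomial.rename_X, MvPolynomial.optionEquivLeft_X_some, map_mul]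

theorem hCoeff_rename (n : ℕ) (f : QPoly r) :
    hCoeff n (MvPolynomial.rename some f) = if n = 0 then f else 0 := by
  rw [hCoeff, optionEquivLeft_rename_some, Polynomial.coeff_C]

theorem hCoeff_X_mul_pderiv (n : ℕ) (a : Fin r) (f : Coeff r) :
    hCoeff n (MvPolynomial.X (some a) * MvPolynomial.pderiv (some a) f) =
      MvPolynomial.X a * MvPolynomial.pderiv a (hCoeff n f) := by
  ext d
  rw [coeff_X_mul_pderiv, hCoeff, hCoeff, MvPolynomial.optionEquivLeft_coeff_coeff,
    MvPolynomial.optionEquivLeft_coeff_coeff, coeff_X_mul_pderiv, Finsupp.optionElim_apply_some]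

theorem hCoeff_ext {f g : Coeff r} (h : ∀ n, hCoeff n f = hCoeff n g) : f = g :=
  (MvPolynomial.optionEquivLeft ℂ (Fin r)).injective (Polynomial.ext h)

theorem exists_hCoeff_eq_zero (f : Coeff r) : ∃ N, ∀ n, N ≤ n → hCoeff n f = 0 :=
  ⟨_, fun _ hn => Polynomial.coeff_eq_zero_of_natDegree_lt (Nat.lt_of_succ_le hn)⟩

theorem eval_eq_sum_hCoeff (f : Coeff r) {N : ℕ} (hN : ∀ n, N ≤ n → hCoeff n f = 0)
    (q : Fin r → ℂ) (z : ℂ) :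
    MvPolynomial.eval (fun o : Option (Fin r) => o.elim z q) f =
      ∑ n ∈ Finset.range N, z ^ n * MvPolynomial.eval q (hCoeff n f) := by
  rw [MvPolynomial.optionEquivLeft_elim_eval, Polynomial.eval_map,
    Polynomial.eval₂_eq_sum_range' _ (n := N + 1)]
  · rw [Finset.sum_range_succ,
      show (MvPolynomial.optionEquivLeft ℂ (Fin r) f).coeff N = 0 from hN N le_rfl, map_zero,
      zero_mul, add_zero]
    exact Finset.sum_congr rfl fun n _ => mul_comm _ _
  · rw [Nat.lt_succ_iff, Polynomial.natDegree_le_iff_coeff_eq_zero]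
    exact fun n hn => hN n hn.le

/-- The coefficient of `hⁿ` of a matrix with entries in `ℂ[q,h]`. -/
noncomputable def hCoeffMat (n : ℕ) (M : Matrix ι ι (Coeff r)) : Matrix ι ι (QPoly r) :=
  M.map (hCoeff n)

variable (n : ℕ) (M M' : Matrix ι ι (Coeff r))

theorem hCoeffMat_add : hCoeffMat n (M + M') = hCoeffMat n M + hCoeffMat n M' := by
  ext1 j k; exact hCoeff_add _ _ _

theorem hCoeffMat_sub : hCoeffMat n (M - M') = hCoeffMat n M - hCoeffMat n M' := by
  ext1 j k; exact hCoeff_sub _ _ _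

theorem hCoeffMat_sum {α : Type*} (s : Finset α) (F : α → Matrix ι ι (Coeff r)) :
    hCoeffMat n (∑ i ∈ s, F i) = ∑ i ∈ s, hCoeffMat n (F i) := by
  ext1 j k
  rw [Matrix.sum_apply, hCoeffMat, Matrix.map_apply, Matrix.sum_apply, hCoeff_sum]
  rfl

theorem hCoeffMat_mul [Fintype ι] : hCoeffMat n (M * M') =
    ∑ p ∈ Finset.HasAntidiagonal.antidiagonal n, hCoeffMat p.1 M * hCoeffMat p.2 M' := by
  ext1 j k
  rw [Matrix.sum_apply, hCoeffMat, Matrix.map_apply, Matrix.mul_apply, hCoeff_sum]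
  simp only [hCoeff_mul, Matrix.mul_apply]
  exact Finset.sum_comm

theorem hCoeffMat_smul_succ : hCoeffMat (n + 1) ((MvPolynomial.X none : Coeff r) • M) =
    hCoeffMat n M := by
  ext1 j k; exact hCoeff_X_none_mul_succ _ _

theorem hCoeffMat_smul_zero : hCoeffMat 0 ((MvPolynomial.X none : Coeff r) • M) = 0 := by
  ext1 j k; exact hCoeff_X_none_mul_zero _

variable {M M'} in
theorem hCoeffMat_ext (h : ∀ n, hCoeffMat n M = hCoeffMat n M') : M = M' := by
  ext1 j k
  exact hCoeff_ext fun n => congrFun (congrFun (h n) j) k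

theorem exists_hCoeffMat_eq_zero [Finite ι] : ∃ N, ∀ n, N ≤ n → hCoeffMat n M = 0 := by
  have := Fintype.ofFinite ι
  choose N hN using fun p : ι × ι => exists_hCoeff_eq_zero (M p.1 p.2)
  refine ⟨Finset.univ.sup N, fun n hn => ?_⟩
  ext1 j k
  exact hN (j, k) n ((Finset.le_sup (Finset.mem_univ _)).trans hn)

/-- A matrix over `ℂ[q]` as a matrix over `ℂ[q,h]`. -/
noncomputable def embedMat (M : Matrix ι ι (QPoly r)) : Matrix ι ι (Coeff r) :=
  M.map (MvPolynomial.rename some)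

theorem hCoeffMat_embedMat (M : Matrix ι ι (QPoly r)) :
    hCoeffMat n (embedMat M) = if n = 0 then M else 0 := by
  ext1 j k
  rw [hCoeffMat, embedMat, Matrix.map_apply, Matrix.map_apply, hCoeff_rename]
  split_ifs <;> rfl

theorem hCoeffMat_embedMat_mul [Fintype ι] (A : Matrix ι ι (QPoly r)) :
    hCoeffMat n (embedMat A * M) = A * hCoeffMat n M := by
  rw [hCoeffMat_mul, Finset.sum_eq_single (0, n)]
  · rw [hCoeffMat_embedMat, if_pos rfl]
  · rintro ⟨i, j⟩ hij hne
    rw [Finset.HasAntidiagonal.mem_antidiagonal] at hij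
    rw [hCoeffMat_embedMat, if_neg, zero_mul]
    rintro rfl
    exact hne (by simp at hij; simp [hij])
  · simp

theorem hCoeffMat_mul_embedMat [Fintype ι] (A : Matrix ι ι (QPoly r)) :
    hCoeffMat n (M * embedMat A) = hCoeffMat n M * A := by
  rw [hCoeffMat_mul, Finset.sum_eq_single (n, 0)]
  · rw [hCoeffMat_embedMat, if_pos rfl]
  · rintro ⟨i, j⟩ hij hne
    rw [Finset.HasAntidiagonal.mem_antidiagonal] at hij
    rw [hCoeffMat_embedMat, if_neg, mul_zero]
    rintro rfl
    exact hne (by simp at hij; simp [hij])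
  · simp

theorem hCoeffMat_mul_succ [Fintype ι] : hCoeffMat (n + 1) (M * M') =
    ∑ k ∈ Finset.range (n + 1), hCoeffMat k M * hCoeffMat (n - k + 1) M' +
      hCoeffMat (n + 1) M * hCoeffMat 0 M' := by
  rw [hCoeffMat_mul, Finset.Nat.sum_antidiagonal_eq_sum_range_succ
    (fun i j => hCoeffMat i M * hCoeffMat j M'), Finset.sum_range_succ, Nat.sub_self]
  congr 1
  refine Finset.sum_congr rfl fun k hk => ?_
  rw [Finset.mem_range] at hk
  rw [show n + 1 - k = n - k + 1 by omega]

/-- `∂_a`, applied to each entry of a matrix over `ℂ[q,h]`. -/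
noncomputable def logDerivH (a : Fin r) (M : Matrix ι ι (Coeff r)) : Matrix ι ι (Coeff r) :=
  M.map fun f => MvPolynomial.X (some a) * MvPolynomial.pderiv (some a) f

theorem hCoeffMat_logDerivH (a : Fin r) :
    hCoeffMat n (logDerivH a M) = logDeriv a (hCoeffMat n M) := by
  ext1 j k; exact hCoeff_X_mul_pderiv _ _ _

theorem logDerivH_mul [Fintype ι] (a : Fin r) :
    logDerivH a (M * M') = logDerivH a M * M' + M * logDerivH a M' := by
  ext1 j k
  simp only [logDerivH, Matrix.add_apply, Matrix.map_apply, Matrix.mul_apply, map_sum,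
    Finset.mul_sum, ← Finset.sum_add_distrib]
  refine Finset.sum_congr rfl fun i _ => ?_
  rw [Derivation.leibniz, smul_eq_mul, smul_eq_mul]
  ring

theorem logDerivH_sub (a : Fin r) : logDerivH a (M - M') = logDerivH a M - logDerivH a M' := by
  refine hCoeffMat_ext fun n => ?_
  simp only [hCoeffMat_sub, hCoeffMat_logDerivH, logDeriv_sub]

theorem logDerivH_smul (a : Fin r) : logDerivH a ((MvPolynomial.X none : Coeff r) • M) =
    (MvPolynomial.X none : Coeff r) • logDerivH a M := by
  refine hCoeffMat_ext fun n => ?_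
  cases n with
  | zero => rw [hCoeffMat_logDerivH, hCoeffMat_smul_zero, hCoeffMat_smul_zero, logDeriv_zero]
  | succ n => rw [hCoeffMat_logDerivH, hCoeffMat_smul_succ, hCoeffMat_smul_succ,
      hCoeffMat_logDerivH]

theorem logDerivH_comm (a b : Fin r) :
    logDerivH a (logDerivH b M) = logDerivH b (logDerivH a M) := by
  refine hCoeffMat_ext fun n => ?_
  simp only [hCoeffMat_logDerivH, logDeriv_comm a b]

end HCoeff

/-! ### Gauge transformations -/

section Gauge

variable {r : ℕ} {ι : Type*} [Fintype ι] [DecidableEq ι]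

/-- A gauge transform of a flat connection is flat: the curvature of Ω times B equals B times the
curvature of W, and B can be cancelled. -/
theorem gauge_flat {W Ω : Fin r → Matrix ι ι (Coeff r)} {B C : Matrix ι ι (Coeff r)}
    (hBC : B * C = 1)
    (hW : ∀ a b, (MvPolynomial.X none : Coeff r) • logDerivH b (W a) + W b * W a =
      (MvPolynomial.X none : Coeff r) • logDerivH a (W b) + W a * W b)
    (hΩ : ∀ a, Ω a * B = B * W a - (MvPolynomial.X none : Coeff r) • logDerivH a B)
    (a b : Fin r) :
    (MvPolynomial.X none : Coeff r) • logDerivH b (Ω a) + Ω b * Ω a =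
      (MvPolynomial.X none : Coeff r) • logDerivH a (Ω b) + Ω a * Ω b := by
  set h : Coeff r := MvPolynomial.X none
  -- Apart from the term in W alone, everything on the right is symmetric in a and b, and disappears
  -- when the two orders are subtracted.
  have key : ∀ a b, (h • logDerivH b (Ω a) + Ω b * Ω a) * B =
      B * (h • logDerivH b (W a) + W b * W a) - h • h • logDerivH b (logDerivH a B) -
        (Ω b * B * W a + Ω a * B * W b) + (Ω a * Ω b + Ω b * Ω a) * B := by
    intro a b
    have h1 := congrArg (fun M => h • logDerivH b M) (hΩ a)
    simp only [logDerivH_mul, logDerivH_sub, logDerivH_smul, h] at h1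
    change h • (logDerivH b (Ω a) * B + Ω a * logDerivH b B) =
      h • (logDerivH b B * W a + B * logDerivH b (W a) - h • logDerivH b (logDerivH a B)) at h1
    have h2 : h • logDerivH b B = B * W b - Ω b * B := by rw [hΩ b]; abel
    rw [smul_add, smul_sub, smul_add, ← mul_smul_comm h (Ω a), h2,
      ← smul_mul_assoc h (logDerivH b B), h2, ← mul_smul_comm h B] at h1
    rw [add_mul, smul_mul_assoc]
    have h3 : h • (logDerivH b (Ω a) * B) = (B * W b - Ω b * B) * W a +
        B * h • logDerivH b (W a) - h • h • logDerivH b (logDerivH a B) -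
        Ω a * (B * W b - Ω b * B) := by
      rw [eq_sub_iff_add_eq, ← h1]
    rw [h3]
    noncomm_ring
  have hB : ((h • logDerivH b (Ω a) + Ω b * Ω a) - (h • logDerivH a (Ω b) + Ω a * Ω b)) * B = 0 := by
    rw [sub_mul, key, key, hW a b, logDerivH_comm B b a, add_comm (Ω b * B * W a),
      add_comm (Ω b * Ω a), sub_self]
  have := congrArg (· * C) hB
  simp only [mul_assoc, hBC, mul_one, zero_mul] at this
  exact sub_eq_zero.1 this

/-- The right hand side of the system, for a general connection form. -/
theorem system_iff_gauge {R : Type*} [Ring R] (δ : R → R)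
    (hδ : ∀ x y, δ (x * y) = δ x * y + x * δ y) (Q θ : ℕ → R) (w Q' : R)
    (h2 : Q' * Q 0 = 1) {B : ℕ → R} (hB0 : B 0 = Q 0) (hB : ∀ i, B (i + 1) = Q 0 * Q (i + 1)) :
    (∀ i, ∑ k ∈ Finset.range (i + 1), B k * θ (i - k) + B (i + 1) * w - δ (B i) =
      Q 0 * w * Q' * B (i + 1)) ↔
    (δ (Q 0) = Q 0 * (θ 0 + ⁅Q 1, w⁆) ∧ ∀ i, δ (Q (i + 1)) =
      θ (i + 1) + ∑ k ∈ Finset.Icc 1 i, Q k * θ (i + 1 - k) + ⁅Q (i + 1), θ 0⁆ + ⁅Q (i + 2), w⁆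
        - ⁅Q 1, w⁆ * Q (i + 1)) := by
  have hcancel : ∀ x, Q 0 * w * Q' * (Q 0 * x) = Q 0 * (w * x) := by
    intro x
    rw [mul_assoc (Q 0 * w), ← mul_assoc Q', h2, one_mul, mul_assoc]
  -- Equation i is the coefficient of h^(i+1) in hδB = B(w + hθ₀ + h²θ₁ + ⋯) − (Q₀wQ')B. For i = 0
  -- it is the equation for Q₀. In the others δQ₀ is eliminated by means of that equation, after
  -- which Q₀ cancels on the left.
  have e0 : ∑ k ∈ Finset.range (0 + 1), B k * θ (0 - k) + B (0 + 1) * w - δ (B 0) -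
      Q 0 * w * Q' * B (0 + 1) = Q 0 * (θ 0 + ⁅Q 1, w⁆) - δ (Q 0) := by
    rw [hB, hB0, hcancel, Finset.sum_range_one, hB0, Ring.lie_def, zero_add]
    noncomm_ring
  have e1 : δ (Q 0) = Q 0 * (θ 0 + ⁅Q 1, w⁆) → ∀ i,
      ∑ k ∈ Finset.range (i + 1 + 1), B k * θ (i + 1 - k) + B (i + 1 + 1) * w - δ (B (i + 1)) -
      Q 0 * w * Q' * B (i + 1 + 1) = Q 0 * (θ (i + 1) +
        ∑ k ∈ Finset.Icc 1 i, Q k * θ (i + 1 - k) + ⁅Q (i + 1), θ 0⁆ + ⁅Q (i + 2), w⁆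
        - ⁅Q 1, w⁆ * Q (i + 1) - δ (Q (i + 1))) := by
    intro h i
    have hs : ∑ k ∈ Finset.range (i + 1 + 1), B k * θ (i + 1 - k) = Q 0 * (θ (i + 1) +
        ∑ k ∈ Finset.Icc 1 i, Q k * θ (i + 1 - k) + Q (i + 1) * θ 0) := by
      rw [Finset.sum_range_succ, Finset.sum_range_succ', hB0, hB, Nat.sub_self, Nat.sub_zero,
        mul_add, mul_add, Finset.mul_sum, mul_assoc, add_comm (∑ k ∈ Finset.range i, _)]
      congr 2
      rw [Finset.range_eq_Ico, Finset.sum_Ico_add' (fun k => B k * θ (i + 1 - k)) 0 i 1]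
      refine Finset.sum_congr (by ext; simp) fun k hk => ?_
      rw [Finset.mem_Icc] at hk
      obtain ⟨k, rfl⟩ := Nat.exists_eq_add_of_le' hk.1
      rw [hB, mul_assoc]
    rw [hs, hB, hB, hcancel, hδ, h, Ring.lie_def, Ring.lie_def, Ring.lie_def]
    noncomm_ring
  have hcancel' : ∀ x, Q 0 * x = 0 ↔ x = 0 := by
    intro x
    refine ⟨fun h => ?_, fun h => by rw [h, mul_zero]⟩
    rw [← one_mul x, ← h2, mul_assoc, h, mul_zero]
  constructor
  · intro h
    have h0 : δ (Q 0) = Q 0 * (θ 0 + ⁅Q 1, w⁆) := by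
      rw [sub_eq_zero.2 (h 0)] at e0
      exact (sub_eq_zero.1 e0.symm).symm
    refine ⟨h0, fun i => ?_⟩
    have := e1 h0 i
    rw [sub_eq_zero.2 (h (i + 1)), eq_comm, hcancel', sub_eq_zero] at this
    exact this.symm
  · rintro ⟨h0, h⟩ i
    rw [← sub_eq_zero]
    cases i with
    | zero => rw [e0, h0, sub_self]
    | succ i => rw [e1 h0 i, hcancel', sub_eq_zero, h i]

end Gauge

end QuantumDModule

namespace QuantumDModule

/-! ### The gauge transformation and the full system. -/

section Solution

set_option linter.unusedSectionVars false

variable {r : ℕ} {κ ι : Type*} [Fintype ι] [DecidableEq ι]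
  {N : κ → MvPolynomial (Fin r) (Coeff r)}
  {P : Module.Basis ι (Coeff r) (DMod N)} {deg : ι → ℕ} {m : ℕ}

/-- The coefficients of `Q₀ (I + h Q₁ + h² Q₂ + ⋯)`. -/
noncomputable def gaugeCoeff (Q : ℕ → Matrix ι ι (QPoly r)) (i : ℕ) : Matrix ι ι (QPoly r) :=
  if i = 0 then Q 0 else Q 0 * Q i

/-- The matrix `Q₀ (I + h Q₁ + ⋯ + h^m Q_m)`. -/
noncomputable def gaugeMat (m : ℕ) (Q : ℕ → Matrix ι ι (QPoly r)) : Matrix ι ι (Coeff r) :=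
  ∑ i ∈ Finset.range (m + 1), (MvPolynomial.X none : Coeff r) ^ i • embedMat (gaugeCoeff Q i)

theorem hCoeffMat_pow_smul_embedMat (n i : ℕ) (A : Matrix ι ι (QPoly r)) :
    hCoeffMat n ((MvPolynomial.X none : Coeff r) ^ i • embedMat A) = if n = i then A else 0 := by
  induction i generalizing n with
  | zero => rw [pow_zero, one_smul, hCoeffMat_embedMat]
  | succ i ih =>
    rw [pow_succ', mul_smul]
    cases n with
    | zero => rw [hCoeffMat_smul_zero, if_neg (by omega)]
    | succ n => rw [hCoeffMat_smul_succ, ih]; simp only [Nat.add_right_cancel_iff]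

theorem hCoeffMat_gaugeMat (hm : ∀ j, deg j ≤ m) {Q : ℕ → Matrix ι ι (QPoly r)}
    (hQ : IsTriangularFamily deg Q) (n : ℕ) : hCoeffMat n (gaugeMat m Q) = gaugeCoeff Q n := by
  rw [gaugeMat, hCoeffMat_sum]
  simp only [hCoeffMat_pow_smul_embedMat]
  rw [Finset.sum_ite_eq]
  simp only [Finset.mem_range]
  split_ifs with h
  · rfl
  · rw [gaugeCoeff, if_neg (by omega), (hQ.2 n (by omega)).eq_zero hm (by omega), mul_zero]

theorem embedMat_one : embedMat (1 : Matrix ι ι (QPoly r)) = 1 := by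
  ext1 j k
  rw [embedMat, Matrix.map_apply, Matrix.one_apply, Matrix.one_apply]
  split_ifs <;> simp

/-- The matrix minus I is strictly block triangular, hence nilpotent. Its inverse therefore also has
entries in ℂ[q,h], which later makes the matrix a plus loop at every q. -/
theorem IsTriangularFamily.isUnit_gaugeMat (hm : ∀ j, deg j ≤ m) {Q : ℕ → Matrix ι ι (QPoly r)}
    (hQ : IsTriangularFamily deg Q) : IsUnit (gaugeMat m Q) := by
  have h : IsTriangular deg 1 (gaugeMat m Q - 1) := by
    intro j k hjk
    refine hCoeff_ext fun n => ?_
    have h1 : hCoeffMat n (gaugeMat m Q - 1) j k = 0 := by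
      rw [← embedMat_one, hCoeffMat_sub, hCoeffMat_gaugeMat hm hQ, hCoeffMat_embedMat, gaugeCoeff]
      split_ifs with hn
      · exact hQ.1 j k (by omega)
      · rw [sub_zero]
        exact (hQ.isTriangular 0).mul (hQ.2 n (by omega)) j k (by push_cast; omega)
    rw [hCoeff_zero]
    exact h1
  have := (h.isNilpotent le_rfl).isUnit_one_add
  rwa [add_sub_cancel] at this

theorem IsTriangularFamily.isUnit_zero {Q : ℕ → Matrix ι ι (QPoly r)}
    (hQ : IsTriangularFamily deg Q) : IsUnit (Q 0) := by
  have := (hQ.1.isNilpotent (by norm_num)).isUnit_one_add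
  rwa [add_sub_cancel] at this

/-- Evaluation of a matrix over `ℂ[q,h]` at `q = 0`. -/
noncomputable def evalQZeroMat (r : ℕ) (ι : Type*) [Fintype ι] [DecidableEq ι] :
    Matrix ι ι (Coeff r) →+* Matrix ι ι (Polynomial ℂ) :=
  (evalQZero r).toRingHom.mapMatrix

theorem coeff_evalQZeroMat (M : Matrix ι ι (Coeff r)) (j k : ι) (n : ℕ) :
    (evalQZeroMat r ι M j k).coeff n = evalAt 0 (hCoeffMat n M) j k := by
  rw [evalAt_zero_apply]
  exact (constantCoeff_hCoeff n (M j k)).symm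

theorem hOmega_flat_matrix (P : Module.Basis ι (Coeff r) (DMod N)) (a b : Fin r) :
    (MvPolynomial.X none : Coeff r) • logDerivH b (hOmega P a) + hOmega P b * hOmega P a =
      (MvPolynomial.X none : Coeff r) • logDerivH a (hOmega P b) + hOmega P a * hOmega P b := by
  ext1 j k
  exact hOmega_flat P a b j k

theorem hCoeffMat_succ_hOmega (P : Module.Basis ι (Coeff r) (DMod N)) (n : ℕ) (a : Fin r) :
    hCoeffMat (n + 1) (hOmega P a) = theta P n a := rfl

theorem systemRhs_zero (Q : ℕ → Matrix ι ι (QPoly r)) (a : Fin r) :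
    systemRhs P Q 0 a = Q 0 * (theta P 0 a + ⁅Q 1, omega P a⁆) := rfl

theorem systemRhs_succ (Q : ℕ → Matrix ι ι (QPoly r)) (i : ℕ) (a : Fin r) :
    systemRhs P Q (i + 1) a =
      theta P (i + 1) a + ∑ k ∈ Finset.Icc 1 i, Q k * theta P (i + 1 - k) a
        + ⁅Q (i + 1), theta P 0 a⁆ + ⁅Q (i + 2), omega P a⁆ - ⁅Q 1, omega P a⁆ * Q (i + 1) := rfl

theorem sum_lie_of_ring {A α : Type*} [Ring A] (s : Finset α) (x : A) (f : α → A) :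
    ∑ i ∈ s, ⁅x, f i⁆ = ⁅x, ∑ i ∈ s, f i⁆ := by
  simp only [Ring.lie_def, Finset.sum_sub_distrib, Finset.mul_sum, Finset.sum_mul]

theorem hCoeffMat_gauge_succ (hm : ∀ j, deg j ≤ m) {Q : ℕ → Matrix ι ι (QPoly r)}
    (hQ : IsTriangularFamily deg Q) (i : ℕ) (a : Fin r) :
    hCoeffMat (i + 1) (gaugeMat m Q * hOmega P a -
      (MvPolynomial.X none : Coeff r) • logDerivH a (gaugeMat m Q)) =
    ∑ k ∈ Finset.range (i + 1), gaugeCoeff Q k * theta P (i - k) a +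
      gaugeCoeff Q (i + 1) * omega P a - logDeriv a (gaugeCoeff Q i) := by
  rw [hCoeffMat_sub, hCoeffMat_mul_succ, hCoeffMat_smul_succ, hCoeffMat_logDerivH]
  simp only [hCoeffMat_gaugeMat hm hQ]
  rfl

theorem hCoeffMat_gauge_zero (hm : ∀ j, deg j ≤ m) {Q : ℕ → Matrix ι ι (QPoly r)}
    (hQ : IsTriangularFamily deg Q) (a : Fin r) :
    hCoeffMat 0 (gaugeMat m Q * hOmega P a -
      (MvPolynomial.X none : Coeff r) • logDerivH a (gaugeMat m Q)) = Q 0 * omega P a := by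
  rw [hCoeffMat_sub, hCoeffMat_mul, hCoeffMat_smul_zero, sub_zero,
    Finset.HasAntidiagonal.antidiagonal_zero, Finset.sum_singleton, hCoeffMat_gaugeMat hm hQ]
  rfl

/-- A solution of the system along the Euler vector field transforms the connection along the
Euler vector field into one without nonnegative powers of `h`. -/
theorem sum_gauge_eq (hm : ∀ j, deg j ≤ m) {Q : ℕ → Matrix ι ι (QPoly r)}
    (hQ : IsTriangularFamily deg Q) {Q' : Matrix ι ι (QPoly r)}
    (h2 : Q' * Q 0 = 1) (hsys : ∀ i, ∑ a, logDeriv a (Q i) = ∑ a, systemRhs P Q i a) :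
    ∑ a, (gaugeMat m Q * hOmega P a - (MvPolynomial.X none : Coeff r) •
      logDerivH a (gaugeMat m Q)) =
      embedMat (Q 0 * (∑ a, omega P a) * Q') * gaugeMat m Q := by
  have hg := (system_iff_gauge (fun M => ∑ a, logDeriv a M)
    (fun x y => by simp only [logDeriv_mul, Finset.sum_add_distrib, Finset.sum_mul, Finset.mul_sum])
    Q (fun i => ∑ a, theta P i a) (∑ a, omega P a) Q' h2
    (B := gaugeCoeff Q) rfl (fun i => if_neg (by omega))).2 (by
      refine ⟨?_, fun i => ?_⟩
      · simp only [hsys, systemRhs_zero, ← Finset.mul_sum, Finset.sum_add_distrib, sum_lie_of_ring]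
      · simp only [hsys, systemRhs_succ, Finset.sum_add_distrib, Finset.sum_sub_distrib,
          sum_lie_of_ring, ← Finset.sum_mul]
        congr 4
        rw [Finset.sum_comm]
        simp only [Finset.mul_sum])
  refine hCoeffMat_ext fun n => ?_
  rw [hCoeffMat_sum, hCoeffMat_embedMat_mul, hCoeffMat_gaugeMat hm hQ]
  cases n with
  | zero =>
    simp only [hCoeffMat_gauge_zero hm hQ]
    rw [gaugeCoeff, if_pos rfl, mul_assoc, h2, mul_one, Finset.mul_sum]
  | succ i =>
    simp only [hCoeffMat_gauge_succ hm hQ]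
    rw [← hg i, Finset.sum_sub_distrib, Finset.sum_add_distrib, Finset.sum_comm]
    simp only [Finset.mul_sum]

theorem sum_logDeriv_eq_zero_imp {M : Matrix ι ι (QPoly r)} (h : ∑ a, logDeriv a M = 0)
    (h0 : evalAt 0 M = 0) : M = 0 := by
  ext1 j k
  refine eq_zero_of_sum_X_mul_pderiv_eq_zero ?_ ?_
  · have := congrFun (congrFun h j) k
    rwa [Matrix.sum_apply] at this
  · rw [← evalAt_zero_apply, h0]
    rfl

/-- Contract flatness with the Euler field, whose component is free of h. If the coefficient of
h^(n+2) in Ω_a is zero, the Euler derivative of the coefficient of h^(n+1) is zero too, and its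
vanishing at q = 0 makes it zero. Since Ω_a is polynomial in h, descending induction reaches all
positive powers. -/
theorem hCoeffMat_eq_zero_of_flat {Ω : Fin r → Matrix ι ι (Coeff r)} {A : Matrix ι ι (QPoly r)}
    (hflat : ∀ a b, (MvPolynomial.X none : Coeff r) • logDerivH b (Ω a) + Ω b * Ω a =
      (MvPolynomial.X none : Coeff r) • logDerivH a (Ω b) + Ω a * Ω b)
    (hsum : ∑ b, Ω b = embedMat A) (a : Fin r)
    (h0 : ∀ n, evalAt 0 (hCoeffMat (n + 1) (Ω a)) = 0) (n : ℕ) : hCoeffMat (n + 1) (Ω a) = 0 := by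
  have hs : (MvPolynomial.X none : Coeff r) • ∑ b, logDerivH b (Ω a) + embedMat A * Ω a =
      (MvPolynomial.X none : Coeff r) • logDerivH a (embedMat A) + Ω a * embedMat A := by
    have h := Finset.sum_congr rfl fun b (_ : b ∈ Finset.univ) => hflat a b
    have hd : ∑ b, logDerivH a (Ω b) = logDerivH a (∑ b, Ω b) := by
      refine hCoeffMat_ext fun n => ?_
      rw [hCoeffMat_sum, hCoeffMat_logDerivH, hCoeffMat_sum]
      simp only [hCoeffMat_logDerivH]
      ext1 j k
      simp only [Matrix.sum_apply, logDeriv_apply, map_sum, Finset.mul_sum]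
    simp only [Finset.sum_add_distrib, ← Finset.smul_sum, ← Finset.sum_mul, ← Finset.mul_sum,
      hd, hsum] at h
    exact h
  have hstep : ∀ n, hCoeffMat (n + 2) (Ω a) = 0 → hCoeffMat (n + 1) (Ω a) = 0 := by
    intro n hn
    refine sum_logDeriv_eq_zero_imp ?_ (h0 n)
    have h := congrArg (hCoeffMat (n + 2)) hs
    -- The inhomogeneous term h∂_aA only lives in degree 1 in h, below the degree n + 2 considered
    -- here.
    rw [hCoeffMat_add, hCoeffMat_add, hCoeffMat_smul_succ, hCoeffMat_smul_succ,
      hCoeffMat_embedMat_mul, hCoeffMat_mul_embedMat, hn, hCoeffMat_logDerivH, hCoeffMat_embedMat,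
      if_neg (by omega), logDeriv_zero, mul_zero, zero_mul, add_zero, add_zero, hCoeffMat_sum] at h
    simpa only [hCoeffMat_logDerivH] using h
  obtain ⟨K, hK⟩ := exists_hCoeffMat_eq_zero (Ω a)
  have hall : ∀ k n, K ≤ n + k → hCoeffMat (n + 1) (Ω a) = 0 := by
    intro k
    induction k with
    | zero => exact fun n hn => hK _ (by omega)
    | succ k ih => exact fun n hn => hstep n (ih (n + 1) (by omega))
  exact hall K n (by omega)

/-- The solution of the system, and the gauge transformation it defines. -/
structure IsGauge (P : Module.Basis ι (Coeff r) (DMod N)) (deg : ι → ℕ) (m : ℕ)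
    (Q : ℕ → Matrix ι ι (QPoly r)) (A : Fin r → Matrix ι ι (QPoly r)) : Prop where
  triangular : IsTriangularFamily deg Q
  homogeneous : ∀ i : ℕ, IsHomogeneousOfShift deg i (Q i)
  initial : ∀ i, evalAt 0 (Q i) = if i = 0 then 1 else 0
  equation : ∀ a, (MvPolynomial.X none : Coeff r) • logDerivH a (gaugeMat m Q) =
    gaugeMat m Q * hOmega P a - embedMat (A a) * gaugeMat m Q
  closed : ∀ a b, logDeriv b (A a) = logDeriv a (A b)
  commute : ∀ a b, A b * A a = A a * A b
  eval_zero : ∀ a, evalAt 0 (A a) = evalAt 0 (omega P a)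
  system : ∀ i a, logDeriv a (Q i) = systemRhs P Q i a

theorem evalAt_mul (q : Fin r → ℂ) (M M' : Matrix ι ι (QPoly r)) :
    evalAt q (M * M') = evalAt q M * evalAt q M' :=
  Matrix.map_mul

theorem evalAt_one (q : Fin r → ℂ) : evalAt q (1 : Matrix ι ι (QPoly r)) = 1 :=
  map_one ((MvPolynomial.eval q).mapMatrix (m := ι))

/-- The radial solution gives an h-free Euler component; flatness, together with the vanishing of
the θ^(i) at q = 0, extends this to each component. The gauge equation then holds for every a, and
its coefficients are the system. -/
theorem IsGraded.exists_isGauge (hP : IsGraded P deg) (hm : ∀ j, deg j ≤ m) :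
    ∃ Q A, IsGauge P deg m Q A := by
  obtain ⟨Q, hQ, hhom, hinit, hsys⟩ := exists_radial_solution hP hm
  obtain ⟨B, hB⟩ : ∃ B, B = gaugeMat m Q := ⟨_, rfl⟩
  obtain ⟨C, hBC, hCB⟩ := isUnit_iff_exists.1 (hQ.isUnit_gaugeMat hm)
  obtain ⟨Q', h1, h2⟩ := isUnit_iff_exists.1 hQ.isUnit_zero
  have hsum := sum_gauge_eq hm hQ h2 hsys
  have hc := fun n => hCoeffMat_gaugeMat hm hQ n
  have hz := hCoeffMat_gauge_zero (P := P) hm hQ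
  have hsucc := hCoeffMat_gauge_succ (P := P) hm hQ
  rw [← hB] at hBC hCB hsum
  simp only [← hB] at hz hsucc hc
  set Ω : Fin r → Matrix ι ι (Coeff r) := fun a =>
    (B * hOmega P a - (MvPolynomial.X none : Coeff r) • logDerivH a B) * C with hΩ
  have hΩB : ∀ a, Ω a * B = B * hOmega P a - (MvPolynomial.X none : Coeff r) • logDerivH a B :=
    fun a => by rw [hΩ]; dsimp only; rw [mul_assoc, hCB, mul_one]
  have hflat := gauge_flat hBC (hOmega_flat_matrix P) hΩB
  have hΩsum : ∑ a, Ω a = embedMat (Q 0 * (∑ a, omega P a) * Q') := by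
    rw [hΩ, ← Finset.sum_mul, hsum, mul_assoc, hBC, mul_one]
  clear_value Ω
  clear hΩ
  have hBzero : evalQZeroMat r ι B = 1 := by
    ext j k n
    rw [coeff_evalQZeroMat, hc, gaugeCoeff, Matrix.one_apply]
    split_ifs with hn hjk hjk
    · rw [hinit, if_pos rfl, hjk, Matrix.one_apply_eq, hn, Polynomial.coeff_one_zero]
    · rw [hinit, if_pos rfl, Matrix.one_apply_ne hjk, Polynomial.coeff_zero]
    · rw [evalAt_mul, hinit n, if_neg hn, mul_zero, Polynomial.coeff_one, if_neg hn]; rfl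
    · rw [evalAt_mul, hinit n, if_neg hn, mul_zero, Polynomial.coeff_zero]; rfl
  -- Logarithmic derivatives vanish at q = 0 and B is I there, so the gauge transformation does not
  -- change the connection at q = 0.
  have hΩzero : ∀ a, evalQZeroMat r ι (Ω a) = evalQZeroMat r ι (hOmega P a) := by
    intro a
    have h := congrArg (evalQZeroMat r ι) (hΩB a)
    rw [map_mul, map_sub, map_mul, hBzero, mul_one, one_mul] at h
    have hd : evalQZeroMat r ι ((MvPolynomial.X none : Coeff r) • logDerivH a B) = 0 := by
      ext j k n
      rw [coeff_evalQZeroMat, Matrix.zero_apply, Polynomial.coeff_zero]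
      cases n with
      | zero => rw [hCoeffMat_smul_zero, evalAt_zero_apply, Matrix.zero_apply, map_zero]
      | succ n => rw [hCoeffMat_smul_succ, hCoeffMat_logDerivH, evalAt_zero_apply, logDeriv_apply,
          map_mul, MvPolynomial.constantCoeff_X, zero_mul]
    rw [h, hd, sub_zero]
  have hΩ0 : ∀ a n, evalAt 0 (hCoeffMat (n + 1) (Ω a)) = 0 := by
    intro a n
    ext j k
    rw [← coeff_evalQZeroMat, hΩzero, coeff_evalQZeroMat, hCoeffMat_succ_hOmega,
      evalAt_zero_apply, hP.theta_zero, Matrix.zero_apply]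
  have hΩn := fun a => hCoeffMat_eq_zero_of_flat hflat hΩsum a (hΩ0 a)
  have hΩe : ∀ a, Ω a = embedMat (Q 0 * omega P a * Q') := by
    intro a
    refine hCoeffMat_ext fun n => ?_
    rw [hCoeffMat_embedMat]
    cases n with
    | zero =>
      have h := congrArg (hCoeffMat 0) (hΩB a)
      rw [hz, hCoeffMat_mul, Finset.HasAntidiagonal.antidiagonal_zero, Finset.sum_singleton, hc,
        gaugeCoeff, if_pos rfl] at h
      rw [if_pos rfl, ← h, mul_assoc, h1, mul_one]
    | succ n => rw [hΩn, if_neg (by omega)]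
  have hcoef : ∀ a i, ∑ k ∈ Finset.range (i + 1), gaugeCoeff Q k * theta P (i - k) a +
      gaugeCoeff Q (i + 1) * omega P a - logDeriv a (gaugeCoeff Q i) =
      Q 0 * omega P a * Q' * gaugeCoeff Q (i + 1) := by
    intro a i
    rw [← hsucc, ← hΩB, hΩe, hCoeffMat_embedMat_mul, hc]
  -- Flatness of an h-free connection splits by powers of h: degree 0 says that the components
  -- commute, and degree 1, used below, that the form is closed.
  have hcomm : ∀ a b, Q 0 * omega P b * Q' * (Q 0 * omega P a * Q') =
      Q 0 * omega P a * Q' * (Q 0 * omega P b * Q') := by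
    intro a b
    have h := congrArg (hCoeffMat 0) (hflat a b)
    rw [hΩe, hΩe, hCoeffMat_add, hCoeffMat_add, hCoeffMat_smul_zero, hCoeffMat_smul_zero, zero_add,
      zero_add, hCoeffMat_embedMat_mul, hCoeffMat_embedMat_mul, hCoeffMat_embedMat,
      hCoeffMat_embedMat, if_pos rfl, if_pos rfl] at h
    exact h
  refine ⟨Q, fun a => Q 0 * omega P a * Q', hQ, hhom, hinit, fun a => ?_, fun a b => ?_,
    hcomm, fun a => ?_, fun i a => ?_⟩
  · rw [← hB, ← hΩe, hΩB, sub_sub_cancel]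
  · have h := congrArg (hCoeffMat 1) (hflat a b)
    rw [hΩe, hΩe, hCoeffMat_add, hCoeffMat_add, hCoeffMat_smul_succ, hCoeffMat_smul_succ,
      hCoeffMat_embedMat_mul, hCoeffMat_embedMat_mul, hCoeffMat_embedMat, hCoeffMat_embedMat,
      if_neg one_ne_zero, if_neg one_ne_zero, mul_zero, mul_zero, add_zero, add_zero,
      hCoeffMat_logDerivH, hCoeffMat_logDerivH, hCoeffMat_embedMat, hCoeffMat_embedMat,
      if_pos rfl, if_pos rfl] at h
    exact h
  · have hQ' : evalAt 0 Q' = 1 := by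
      have := congrArg (evalAt 0) h1
      rwa [evalAt_mul, evalAt_one, hinit, if_pos rfl, one_mul] at this
    rw [evalAt_mul, evalAt_mul, hQ', hinit, if_pos rfl, one_mul, mul_one]
  · have hg := (system_iff_gauge (R := Matrix ι ι (QPoly r)) (logDeriv a)
      (fun x y => by rw [logDeriv_mul]) Q (fun i => theta P i a)
      (omega P a) Q' h2 (B := gaugeCoeff Q) (if_pos rfl) (fun i => if_neg (Nat.succ_ne_zero i))).1
      (hcoef a)
    cases i with
    | zero => exact hg.1
    | succ i => exact hg.2 i

end Solution

end QuantumDModule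

namespace QuantumDModule

/-! ### Unipotent matrices are exponentials -/

section Exp

theorem exists_exp_eq_one_add_add {R : Type*} [CommRing R] [Algebra ℚ R] {y : R}
    (hy : IsNilpotent y) : ∃ e, IsNilpotent.exp y = 1 + y + y ^ 2 * e := by
  obtain ⟨n, hn⟩ := hy
  refine ⟨∑ i ∈ Finset.range n, ((i + 2).factorial : ℚ)⁻¹ • y ^ i, ?_⟩
  rw [IsNilpotent.exp_eq_sum (pow_eq_zero_of_le (Nat.le_add_right n 2) hn), Finset.sum_range_succ',
    Finset.sum_range_succ', Finset.mul_sum]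
  have h : ∀ i, y ^ 2 * ((i + 2).factorial : ℚ)⁻¹ • y ^ i =
      ((i + 1 + 1).factorial : ℚ)⁻¹ • y ^ (i + 1 + 1) := fun i => by
    rw [mul_smul_comm, ← pow_add, add_comm 2 i]
  simp only [h, zero_add, Nat.factorial_zero, Nat.factorial_one, Nat.cast_one, inv_one, one_smul,
    pow_zero, pow_one]
  ring

/-- Successive approximation: if exp(xy) agrees with 1 + x up to an error x^(k+1)g, replacing y by y
− x^k g cancels the error up to order x^(k+2). Nilpotency of x ends the process. -/
theorem exists_exp_eq_one_add {R : Type*} [CommRing R] [Algebra ℚ R] {x : R}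
    (hx : IsNilpotent x) : ∃ y, IsNilpotent.exp (x * y) = 1 + x := by
  have key : ∀ k : ℕ, ∃ y g, IsNilpotent.exp (x * y) = 1 + x + x ^ (k + 1) * g := by
    intro k
    induction k with
    | zero => exact ⟨0, -1, by rw [mul_zero, IsNilpotent.exp_zero]; ring⟩
    | succ k ih =>
      obtain ⟨y, g, h⟩ := ih
      have hnil : ∀ z, IsNilpotent (x * z) := fun z => (Commute.all x z).isNilpotent_mul_right hx
      obtain ⟨e, he⟩ := exists_exp_eq_one_add_add (hnil (-(x ^ k * g)))
      refine ⟨y - x ^ k * g, -g - x ^ k * g ^ 2 + x ^ k * g ^ 2 * (1 + x + x ^ (k + 1) * g) * e, ?_⟩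
      rw [sub_eq_add_neg, mul_add, IsNilpotent.exp_add_of_commute (Commute.all _ _) (hnil _) (hnil _),
        h, he]
      ring
  obtain ⟨n, hn⟩ := hx
  obtain ⟨y, g, h⟩ := key n
  exact ⟨y, by rw [h, pow_succ, hn, zero_mul, zero_mul, add_zero]⟩

/-- The commutative case is applied to the class of X in ℚ[X]/(Xⁿ) and carried over by X ↦ x, so
that the logarithm is a polynomial in x. -/
theorem exists_polynomial_exp_eq {A : Type*} [Ring A] [Algebra ℚ A] {x : A}
    (hx : IsNilpotent x) : ∃ p : Polynomial ℚ,
      IsNilpotent.exp (x * Polynomial.aeval x p) = 1 + x := by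
  obtain ⟨n, hn⟩ := hx
  set I : Ideal (Polynomial ℚ) := Ideal.span {Polynomial.X ^ n} with hI
  have hX : IsNilpotent (Ideal.Quotient.mk I Polynomial.X) := by
    refine ⟨n, ?_⟩
    rw [← map_pow, Ideal.Quotient.eq_zero_iff_mem]
    exact Ideal.subset_span rfl
  obtain ⟨y, hy⟩ := exists_exp_eq_one_add hX
  obtain ⟨p, rfl⟩ := Ideal.Quotient.mk_surjective y
  refine ⟨p, ?_⟩
  let φ : (Polynomial ℚ ⧸ I) →+* A := Ideal.Quotient.lift I (Polynomial.aeval x).toRingHom (by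
    intro a ha
    rw [hI, Ideal.mem_span_singleton] at ha
    obtain ⟨c, rfl⟩ := ha
    change Polynomial.aeval x (Polynomial.X ^ n * c) = 0
    rw [map_mul, map_pow, Polynomial.aeval_X, hn, zero_mul])
  have hφ : ∀ a, φ (Ideal.Quotient.mk I a) = Polynomial.aeval x a := fun a =>
    Ideal.Quotient.lift_mk _ _ _
  have h := congrArg φ hy
  rw [IsNilpotent.map_exp ((Commute.all _ _).isNilpotent_mul_right hX) φ, map_mul, hφ, hφ,
    Polynomial.aeval_X, map_add, map_one, hφ, Polynomial.aeval_X] at h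
  exact h

theorem normedSpace_exp_eq {A : Type*} [Ring A] [Algebra ℚ A] [TopologicalSpace A]
    [IsTopologicalRing A] [T2Space A] {x : A} (hx : IsNilpotent x) :
    NormedSpace.exp x = IsNilpotent.exp x := by
  obtain ⟨n, hn⟩ := hx
  rw [IsNilpotent.exp_eq_sum hn, NormedSpace.exp_eq_tsum_rat]
  refine tsum_eq_sum fun i hi => ?_
  rw [Finset.mem_range, not_lt] at hi
  rw [pow_eq_zero_of_le hi hn, smul_zero]

variable {r : ℕ} {ι : Type*} [Fintype ι] [DecidableEq ι] {deg : ι → ℕ}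

/-- The logarithm is M − 1 times a polynomial in M − 1, so it inherits 2-triangularity and has
polynomial entries. Both exponentials are finite sums here, hence evaluation at q passes through. -/
theorem exists_isTriangular_exp_eq {M : Matrix ι ι (QPoly r)} (hM : IsTriangular deg 2 (M - 1)) :
    ∃ X : Matrix ι ι (QPoly r), IsTriangular deg 2 X ∧
      ∀ q, evalAt q M = NormedSpace.exp (evalAt q X) := by
  have hnil := hM.isNilpotent (by norm_num)
  obtain ⟨p, hp⟩ := exists_polynomial_exp_eq hnil
  have hc : Commute (M - 1) (Polynomial.aeval (M - 1) p) := by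
    have := (Commute.all Polynomial.X p).map (Polynomial.aeval (M - 1))
    rwa [Polynomial.aeval_X] at this
  have hp0 : IsTriangular deg 0 (Polynomial.aeval (M - 1) p) := by
    rw [Polynomial.aeval_eq_sum_range]
    exact IsTriangular.sum fun i _ => ((hM.pow i).mono (by positivity)).smul _
  refine ⟨(M - 1) * Polynomial.aeval (M - 1) p, (hM.mul hp0).mono (by norm_num), fun q => ?_⟩
  have hnil' := hc.isNilpotent_mul_right hnil
  have h := congrArg ((MvPolynomial.eval q).mapMatrix (m := ι)) hp
  rw [IsNilpotent.map_exp hnil', add_sub_cancel] at h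
  rw [normedSpace_exp_eq]
  · exact h.symm
  · exact hnil'.map (MvPolynomial.eval q).mapMatrix

end Exp

end QuantumDModule

namespace QuantumDModule

/-! ### Fundamental solutions of commuting pencils of flat connections -/

section Pencil

variable {E 𝔸 : Type*} [NormedAddCommGroup E] [NormedSpace ℂ E]
  [NormedRing 𝔸] [NormedAlgebra ℂ 𝔸]

/-- The form `v ↦ x * φ v`. -/
noncomputable def mulForm (x : 𝔸) (φ : E →L[ℂ] 𝔸) : E →L[ℂ] 𝔸 :=
  (ContinuousLinearMap.mul ℂ 𝔸 x).comp φ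

@[simp] theorem mulForm_apply (x : 𝔸) (φ : E →L[ℂ] 𝔸) (v : E) : mulForm x φ v = x * φ v := rfl

theorem norm_mulForm_le (x : 𝔸) (φ : E →L[ℂ] 𝔸) : ‖mulForm x φ‖ ≤ ‖x‖ * ‖φ‖ :=
  ContinuousLinearMap.opNorm_le_bound _ (by positivity) fun v => by
    rw [mulForm_apply, mul_assoc]
    exact (norm_mul_le _ _).trans (by gcongr; exact φ.le_opNorm v)

variable [CompleteSpace 𝔸]

/-- By the Poincaré lemma it suffices that gw is closed. Its differential is f w∧w + g dw: the first
term vanishes because the values of w commute, the second because w is closed. -/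
theorem exists_primitive_mulForm {w : E → E →L[ℂ] 𝔸} (hw : Differentiable ℂ w)
    (hclosed : ∀ t x y, fderiv ℂ w t x y = fderiv ℂ w t y x)
    (hcomm : ∀ t x y, w t x * w t y = w t y * w t x) {f g : E → 𝔸}
    (hg : ∀ t, HasFDerivAt g (mulForm (f t) (w t)) t) :
    ∃ g' : E → 𝔸, g' 0 = 0 ∧ ∀ t, HasFDerivAt g' (mulForm (g t) (w t)) t := by
  have hd : ∀ t, HasFDerivAt (fun t => mulForm (g t) (w t))
      (((ContinuousLinearMap.compL ℂ E 𝔸 𝔸 (ContinuousLinearMap.mul ℂ 𝔸 (g t))).comp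
        (fderiv ℂ w t)) + (((ContinuousLinearMap.compL ℂ E 𝔸 𝔸).flip (w t)).comp
          ((ContinuousLinearMap.mul ℂ 𝔸).comp (mulForm (f t) (w t))))) t := by
    intro t
    exact ((ContinuousLinearMap.mul ℂ 𝔸).hasFDerivAt.comp t (hg t)).clm_comp (hw t).hasFDerivAt
  obtain ⟨F, hF⟩ := convex_univ.exists_forall_hasFDerivAt_of_fderiv_symmetric (𝕜 := ℂ)
    isOpen_univ (fun t _ => ((hd t).restrictScalars ℝ).differentiableAt.differentiableWithinAt)
    (fun t _ x y => by
      rw [((hd t).restrictScalars ℝ).fderiv]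
      change g t * fderiv ℂ w t x y + f t * w t x * w t y =
        g t * fderiv ℂ w t y x + f t * w t y * w t x
      rw [hclosed, mul_assoc, hcomm, mul_assoc])
  exact ⟨fun t => F t - F 0, sub_self _, fun t => (hF t trivial).sub_const _⟩

theorem exists_iterated_primitive {w : E → E →L[ℂ] 𝔸} (hw : Differentiable ℂ w)
    (hclosed : ∀ t x y, fderiv ℂ w t x y = fderiv ℂ w t y x)
    (hcomm : ∀ t x y, w t x * w t y = w t y * w t x) :
    ∃ Z : ℕ → E → 𝔸, (∀ t, Z 0 t = 1) ∧ (∀ n, Z (n + 1) 0 = 0) ∧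
      ∀ n t, HasFDerivAt (Z (n + 1)) (mulForm (Z n t) (w t)) t := by
  -- Each function carries along the fact that its differential is a multiple of w, as required for
  -- integrating once more; the start, the constant 1, is a primitive of 0·w.
  have hstep : ∀ g : {g : E → 𝔸 // ∃ f : E → 𝔸, ∀ t, HasFDerivAt g (mulForm (f t) (w t)) t},
      ∃ g' : {g : E → 𝔸 // ∃ f : E → 𝔸, ∀ t, HasFDerivAt g (mulForm (f t) (w t)) t},
        g'.1 0 = 0 ∧ ∀ t, HasFDerivAt g'.1 (mulForm (g.1 t) (w t)) t := by
    rintro ⟨g, f, hg⟩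
    obtain ⟨g', h0, h⟩ := exists_primitive_mulForm hw hclosed hcomm hg
    exact ⟨⟨g', g, h⟩, h0, h⟩
  choose next h0 h using hstep
  let Z : ℕ → {g : E → 𝔸 // ∃ f : E → 𝔸, ∀ t, HasFDerivAt g (mulForm (f t) (w t)) t} :=
    fun n => Nat.rec ⟨fun _ => 1, fun _ => 0, fun t => by
      have : mulForm (0 : 𝔸) (w t) = 0 := by ext v; simp
      rw [this]
      exact hasFDerivAt_const _ _⟩ (fun _ g => next g) n
  exact ⟨fun n => (Z n).1, fun _ => rfl, fun n => h0 (Z n), fun n => h (Z n)⟩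

omit [CompleteSpace 𝔸] in
-- The usual bound for n-fold iterated integrals, obtained by comparing derivatives along the
-- segment from 0 to t.
theorem norm_iterated_primitive_le {w : E → E →L[ℂ] 𝔸} {Z : ℕ → E → 𝔸} (h1 : ∀ t, Z 0 t = 1)
    (h0 : ∀ n, Z (n + 1) 0 = 0) (hZ : ∀ n t, HasFDerivAt (Z (n + 1)) (mulForm (Z n t) (w t)) t)
    {R K : ℝ} (hK : ∀ t, ‖t‖ ≤ R → ‖w t‖ ≤ K) (n : ℕ) {t : E} (ht : ‖t‖ ≤ R) :
    ‖Z n t‖ ≤ ‖(1 : 𝔸)‖ * (K * ‖t‖) ^ n / n.factorial := by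
  have hK0 : 0 ≤ K := (norm_nonneg _).trans (hK t ht)
  induction n generalizing t with
  | zero => simp [h1]
  | succ n ih =>
    have hline : ∀ x : ℝ, HasDerivAt (fun x : ℝ => x • t) t x := fun x => by
      simpa using (hasDerivAt_id x).smul_const t
    have hd : ∀ x : ℝ, HasDerivAt (fun x : ℝ => Z (n + 1) (x • t))
        (Z n (x • t) * w (x • t) t) x := fun x =>
      HasFDerivAt.comp_hasDerivAt (f := fun x : ℝ => x • t) x
        ((hZ n (x • t)).restrictScalars ℝ) (hline x)
    have hB : ∀ x : ℝ, HasDerivAt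
        (fun x : ℝ => ‖(1 : 𝔸)‖ * (K * (x * ‖t‖)) ^ (n + 1) / (n + 1).factorial)
        (‖(1 : 𝔸)‖ * (K * (x * ‖t‖)) ^ n / n.factorial * (K * ‖t‖)) x := fun x => by
      have := ((((hasDerivAt_id x).mul_const ‖t‖).const_mul K).pow (n + 1)).const_mul ‖(1 : 𝔸)‖
        |>.div_const ((n + 1).factorial : ℝ)
      refine this.congr_deriv ?_
      rw [Nat.factorial_succ]
      push_cast
      have : (n.factorial : ℝ) ≠ 0 := by positivity
      have : (n + 1 : ℝ) ≠ 0 := by positivity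
      simp only [id]
      field_simp
    have key := image_norm_le_of_norm_deriv_right_le_deriv_boundary (a := 0) (b := 1)
      (fun x _ => (hd x).continuousAt.continuousWithinAt) (fun x _ => (hd x).hasDerivWithinAt)
      (B := fun x : ℝ => ‖(1 : 𝔸)‖ * (K * (x * ‖t‖)) ^ (n + 1) / (n + 1).factorial)
      (by simp [h0]) hB (fun x hx => by
        have hxt : ‖x • t‖ = x * ‖t‖ := by rw [norm_smul, Real.norm_of_nonneg hx.1]
        have hxR : ‖x • t‖ ≤ R := by
          rw [hxt]
          exact (mul_le_of_le_one_left (norm_nonneg t) hx.2.le).trans ht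
        have h2 := ih hxR
        rw [hxt] at h2
        have h3 : ‖w (x • t) t‖ ≤ K * ‖t‖ :=
          ((w (x • t)).le_opNorm t).trans (by gcongr; exact hK _ hxR)
        exact (norm_mul_le _ _).trans (mul_le_mul h2 h3 (norm_nonneg _)
          ((norm_nonneg _).trans h2))) (x := 1) (by simp)
    simpa using key

/-- The data of the solution `∑ λⁿ Zₙ(t)` of the equation `dZ = λ Z w`. -/
structure IsPencilSolution (w : E → E →L[ℂ] 𝔸) (Z : ℕ → E → 𝔸) (S : E → ℂ → 𝔸) : Prop where
  zero : ∀ t, Z 0 t = 1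
  hasSum : ∀ t z, HasSum (fun n => z ^ n • Z n t) (S t z)
  initial : ∀ z, S 0 z = 1
  hasFDerivAt : ∀ t z, HasFDerivAt (fun t => S t z) (z • mulForm (S t z) (w t)) t
  differentiable : ∀ t, Differentiable ℂ (S t)
  continuous : Continuous fun p : E × ℂ => S p.1 p.2

/-- The factorial bounds make ∑zⁿZₙ and its termwise differential converge locally uniformly in t
and z. -/
theorem exists_isPencilSolution [ProperSpace E] {w : E → E →L[ℂ] 𝔸} (hw : Differentiable ℂ w)
    (hclosed : ∀ t x y, fderiv ℂ w t x y = fderiv ℂ w t y x)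
    (hcomm : ∀ t x y, w t x * w t y = w t y * w t x) : ∃ Z S, IsPencilSolution w Z S := by
  obtain ⟨Z, h1, h0, hZ⟩ := exists_iterated_primitive hw hclosed hcomm
  have hbound : ∀ R : ℝ, 0 ≤ R → ∃ K : ℝ, 0 ≤ K ∧ (∀ t, ‖t‖ ≤ R → ‖w t‖ ≤ K) ∧
      ∀ n t, ‖t‖ ≤ R → ‖Z n t‖ ≤ ‖(1 : 𝔸)‖ * (K * R) ^ n / n.factorial := by
    intro R hR
    obtain ⟨K, hK⟩ := (isCompact_closedBall (0 : E) R).exists_bound_of_continuousOn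
      hw.continuous.continuousOn
    have hK' : ∀ t, ‖t‖ ≤ R → ‖w t‖ ≤ K := fun t ht => hK t (by simpa using ht)
    have hK0 : 0 ≤ K := (norm_nonneg _).trans (hK' 0 (by simpa using hR))
    refine ⟨K, hK0, hK', fun n t ht =>
      (norm_iterated_primitive_le h1 h0 hZ hK' n ht).trans (by gcongr)⟩
  have hcont : ∀ n, Continuous (Z n) := by
    rintro (_ | n)
    · rw [funext h1]; exact continuous_const
    · exact continuous_iff_continuousAt.2 fun t => (hZ n t).continuousAt
  have hu : ∀ a b c : ℝ, Summable fun n : ℕ => a ^ n * (c * b ^ n / n.factorial) := by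
    intro a b c
    refine ((Real.summable_pow_div_factorial (a * b)).mul_left c).congr fun n => ?_
    rw [mul_pow]; ring
  have hle : ∀ {K R ρ : ℝ}, (∀ n t, ‖t‖ ≤ R → ‖Z n t‖ ≤ ‖(1 : 𝔸)‖ * (K * R) ^ n / n.factorial) →
      ∀ n t, ‖t‖ ≤ R → ∀ z : ℂ, ‖z‖ ≤ ρ →
        ‖z ^ n • Z n t‖ ≤ ρ ^ n * (‖(1 : 𝔸)‖ * (K * R) ^ n / n.factorial) := by
    intro K R ρ h n t ht z hz
    rw [norm_smul, norm_pow]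
    have := h n t ht
    have hρ := (norm_nonneg z).trans hz
    gcongr
  have hsummable : ∀ (t : E) (z : ℂ), Summable fun n => z ^ n • Z n t := by
    intro t z
    obtain ⟨K, hK0, hK, hB⟩ := hbound ‖t‖ (norm_nonneg t)
    exact Summable.of_norm_bounded (hu _ _ _) fun n => hle hB n t le_rfl z le_rfl
  refine ⟨Z, fun t z => ∑' n, z ^ n • Z n t, h1, fun t z => (hsummable t z).hasSum, fun z => ?_,
    fun t z => ?_, fun t z => ?_, ?_⟩
  · rw [tsum_eq_single 0]
    · simp [h1]
    · rintro (_ | n) hn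
      · exact absurd rfl hn
      · rw [h0, smul_zero]
  · obtain ⟨K, hK0, hK, hB⟩ := hbound (‖t‖ + 1) (by positivity)
    have hsum' : Summable fun n => z ^ (n + 1) • mulForm (Z n t) (w t) := by
      refine Summable.of_norm_bounded ((hu ‖z‖ (K * (‖t‖ + 1)) ‖(1 : 𝔸)‖).mul_left
        (‖z‖ * ‖w t‖)) fun n => ?_
      have h2 := hle hB n t (by linarith) z le_rfl
      rw [norm_smul] at h2
      rw [norm_smul, pow_succ, norm_mul]
      calc ‖z ^ n‖ * ‖z‖ * ‖mulForm (Z n t) (w t)‖ ≤ ‖z ^ n‖ * ‖z‖ * (‖Z n t‖ * ‖w t‖) := by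
            gcongr; exact norm_mulForm_le _ _
        _ = ‖z‖ * ‖w t‖ * (‖z ^ n‖ * ‖Z n t‖) := by ring
        _ ≤ _ := by gcongr
    have hd := hasFDerivAt_tsum_of_isPreconnected (𝕜 := ℂ)
      (u := fun n : ℕ => Nat.casesOn n 0 fun n =>
        ‖z‖ * K * (‖z‖ ^ n * (‖(1 : 𝔸)‖ * (K * (‖t‖ + 1)) ^ n / n.factorial)))
      (f := fun n t => z ^ n • Z n t)
      (f' := fun n t => Nat.casesOn n 0 fun n => z ^ (n + 1) • mulForm (Z n t) (w t))
      (s := Metric.ball 0 (‖t‖ + 1)) (x₀ := t) (x := t)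
      ((summable_nat_add_iff 1).1 ((hu _ _ _).mul_left _)) Metric.isOpen_ball
      (convex_ball (0 : E) _).isPreconnected
      (by
        rintro (_ | n) x hx
        · simp only [pow_zero, one_smul, funext h1]
          exact hasFDerivAt_const _ _
        · exact (hZ n x).const_smul (z ^ (n + 1)))
      (by
        rintro (_ | n) x hx
        · simp
        · rw [mem_ball_zero_iff] at hx
          have h2 := hle hB n x hx.le z le_rfl
          rw [norm_smul] at h2
          have h3 := hK x hx.le
          simp only
          rw [norm_smul, pow_succ, norm_mul]
          calc ‖z ^ n‖ * ‖z‖ * ‖mulForm (Z n x) (w x)‖ ≤ ‖z ^ n‖ * ‖z‖ * (‖Z n x‖ * K) := by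
                gcongr; exact (norm_mulForm_le _ _).trans (by gcongr)
            _ = ‖z‖ * K * (‖z ^ n‖ * ‖Z n x‖) := by ring
            _ ≤ _ := by gcongr)
      (by simp) (hsummable t z) (by simp)
    refine hd.congr_fderiv ?_
    have hs2 : Summable fun n : ℕ => (Nat.casesOn n 0 fun n =>
        z ^ (n + 1) • mulForm (Z n t) (w t) : E →L[ℂ] 𝔸) := (summable_nat_add_iff 1).1 hsum'
    rw [hs2.tsum_eq_zero_add]
    refine (zero_add _).trans ?_
    ext v
    have h4 := hsum'.hasSum.mapL (ContinuousLinearMap.apply ℂ 𝔸 v)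
    refine h4.unique ?_
    have h5 := ((hsummable t z).hasSum.mul_right (w t v)).const_smul z
    refine h5.congr_fun fun n => ?_
    change z ^ (n + 1) • (Z n t * w t v) = _
    rw [pow_succ', mul_smul, smul_mul_assoc]
  · obtain ⟨K, hK0, hK, hB⟩ := hbound ‖t‖ (norm_nonneg t)
    have := Complex.differentiableOn_tsum_of_summable_norm (U := Metric.ball 0 (‖z‖ + 1))
      (F := fun n z => z ^ n • Z n t) (hu (‖z‖ + 1) _ _)
      (fun n => ((differentiable_id.pow n).smul_const _).differentiableOn) Metric.isOpen_ball
      (fun n x hx => hle hB n t le_rfl x (by rw [mem_ball_zero_iff] at hx; exact hx.le))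
    exact this.differentiableAt (Metric.isOpen_ball.mem_nhds (by simp))
  · refine continuous_iff_continuousAt.2 fun ⟨t, z⟩ => ?_
    obtain ⟨K, hK0, hK, hB⟩ := hbound (‖t‖ + 1) (by positivity)
    have := continuousOn_tsum (f := fun n (p : E × ℂ) => p.2 ^ n • Z n p.1)
      (s := Metric.ball 0 (‖t‖ + 1) ×ˢ Metric.ball 0 (‖z‖ + 1))
      (fun n => ((continuous_snd.pow n).smul ((hcont n).comp continuous_fst)).continuousOn)
      (hu (‖z‖ + 1) _ _) (by
        rintro n ⟨x, y⟩ ⟨hx, hy⟩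
        rw [mem_ball_zero_iff] at hx hy
        exact hle hB n x hx.le y hy.le)
    exact this.continuousAt ((Metric.isOpen_ball.prod Metric.isOpen_ball).mem_nhds (by simp))

/-- The same for the transposed equation `dM = - λ w M` of the inverse. -/
structure IsPencilInverse (w : E → E →L[ℂ] 𝔸) (M : ℕ → E → 𝔸) (T : E → ℂ → 𝔸) : Prop where
  zero : ∀ t, M 0 t = 1
  hasSum : ∀ t z, HasSum (fun n => z ^ n • M n t) (T t z)
  initial : ∀ z, T 0 z = 1
  hasFDerivAt : ∀ t z, ∃ D : E →L[ℂ] 𝔸, (∀ v, D v = -(z • (w t v * T t z))) ∧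
    HasFDerivAt (fun t => T t z) D t
  differentiable : ∀ t, Differentiable ℂ (T t)

/-- In the opposite algebra the equation dM = −λwM takes the form already solved, with −w in place
of w. -/
theorem exists_isPencilInverse [ProperSpace E] {w : E → E →L[ℂ] 𝔸} (hw : Differentiable ℂ w)
    (hclosed : ∀ t x y, fderiv ℂ w t x y = fderiv ℂ w t y x)
    (hcomm : ∀ t x y, w t x * w t y = w t y * w t x) : ∃ M T, IsPencilInverse w M T := by
  let op : 𝔸 ≃L[ℂ] 𝔸ᵐᵒᵖ := MulOpposite.opContinuousLinearEquiv ℂ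
  let c : (E →L[ℂ] 𝔸) →L[ℂ] (E →L[ℂ] 𝔸ᵐᵒᵖ) :=
    ContinuousLinearMap.compL ℂ E 𝔸 𝔸ᵐᵒᵖ (-(op : 𝔸 →L[ℂ] 𝔸ᵐᵒᵖ))
  have hc : ∀ φ v, c φ v = -MulOpposite.op (φ v) := fun φ v => rfl
  have hd : ∀ t, HasFDerivAt (fun t => c (w t)) (c.comp (fderiv ℂ w t)) t := fun t =>
    HasFDerivAt.comp (g := c) (f := w) t c.hasFDerivAt (hw t).hasFDerivAt
  obtain ⟨Z, S, h⟩ := exists_isPencilSolution (w := fun t => c (w t))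
    (fun t => (hd t).differentiableAt)
    (fun t x y => by
      rw [(hd t).fderiv]
      change c (fderiv ℂ w t x) y = c (fderiv ℂ w t y) x
      rw [hc, hc, hclosed])
    (fun t x y => by
      rw [hc, hc, neg_mul_neg, neg_mul_neg, ← MulOpposite.op_mul, ← MulOpposite.op_mul, hcomm])
  refine ⟨fun n t => (Z n t).unop, fun t z => (S t z).unop, fun t => ?_, fun t z => ?_,
    fun z => ?_, fun t z => ?_, fun t =>
      (op.symm : 𝔸ᵐᵒᵖ →L[ℂ] 𝔸).differentiable.comp (h.differentiable t)⟩
  · rw [h.zero, MulOpposite.unop_one]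
  · exact (h.hasSum t z).mapL (op.symm : 𝔸ᵐᵒᵖ →L[ℂ] 𝔸)
  · rw [h.initial, MulOpposite.unop_one]
  · refine ⟨_, fun v => ?_, (op.symm : 𝔸ᵐᵒᵖ →L[ℂ] 𝔸).hasFDerivAt.comp t (h.hasFDerivAt t z)⟩
    change (z • (S t z * c (w t) v)).unop = _
    rw [hc, mul_neg, smul_neg, MulOpposite.unop_neg, MulOpposite.unop_smul, MulOpposite.unop_mul,
      MulOpposite.unop_op]

omit [CompleteSpace 𝔸] in
-- The product has zero differential and equals 1 at t = 0.
theorem IsPencilSolution.mul_inverse {w : E → E →L[ℂ] 𝔸} {Z M : ℕ → E → 𝔸} {S T : E → ℂ → 𝔸}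
    (h : IsPencilSolution w Z S) (h' : IsPencilInverse w M T) (t : E) (z : ℂ) :
    S t z * T t z = 1 := by
  choose D hD hT using h'.hasFDerivAt
  have hd : ∀ t, HasFDerivAt (fun t => S t z * T t z) (0 : E →L[ℂ] 𝔸) t := by
    intro t
    refine ((h.hasFDerivAt t z).mul' (hT t z)).congr_fderiv ?_
    ext v
    change S t z * D t z v + z • (S t z * w t v) * T t z = 0
    rw [hD, mul_neg, mul_smul_comm, smul_mul_assoc, mul_assoc, neg_add_cancel]
  have := is_const_of_fderiv_eq_zero (𝕜 := ℂ) (fun t => (hd t).differentiableAt)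
    (fun t => (hd t).fderiv) t 0
  rw [this, h.initial, h'.initial, mul_one]

end Pencil

end QuantumDModule

namespace QuantumDModule

/-! ### Existence of the Birkhoff factorization -/

section Existence

attribute [local instance] Matrix.linftyOpNormedRing Matrix.linftyOpNormedAlgebra

theorem hasFDerivAt_eval {σ E : Type*} [Fintype σ] [NormedAddCommGroup E] [NormedSpace ℂ E]
    (f : MvPolynomial σ ℂ) {g : E → σ → ℂ} {g' : σ → E →L[ℂ] ℂ} {t : E}
    (hg : ∀ s, HasFDerivAt (fun t => g t s) (g' s) t) :
    HasFDerivAt (fun t => MvPolynomial.eval (g t) f)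
      (∑ s, MvPolynomial.eval (g t) (MvPolynomial.pderiv s f) • g' s) t := by
  classical
  induction f using MvPolynomial.induction_on with
  | C c =>
    refine ((hasFDerivAt_const c t).congr_of_eventuallyEq (.of_forall fun x => by
      simp)).congr_fderiv ?_
    ext v
    simp
  | add f f' hf hf' =>
    simp only [map_add]
    refine (hf.add hf').congr_fderiv ?_
    ext v
    simp [add_mul, Finset.sum_add_distrib]
  | mul_X f s hf =>
    simp only [map_mul, MvPolynomial.eval_X]
    refine (hf.mul (hg s)).congr_fderiv ?_
    have h : ∀ b v,
        MvPolynomial.eval (g t) (MvPolynomial.pderiv b (f * MvPolynomial.X s)) * g' b v =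
        (if b = s then MvPolynomial.eval (g t) f * g' s v else 0) +
          g t s * (MvPolynomial.eval (g t) (MvPolynomial.pderiv b f) * g' b v) := by
      intro b v
      rw [Derivation.leibniz, MvPolynomial.pderiv_X, map_add, smul_eq_mul, smul_eq_mul, map_mul,
        map_mul, MvPolynomial.eval_X, add_mul, mul_assoc, mul_assoc]
      congr 1
      by_cases hb : b = s
      · subst hb; simp
      · simp [hb, Ne.symm hb]
    ext v
    simp [-Derivation.leibniz, h, Finset.sum_add_distrib, Finset.mul_sum]

set_option linter.unusedSectionVars false

theorem hasFDerivAt_mul_of_mulForm {E 𝔸 : Type*} [NormedAddCommGroup E] [NormedSpace ℂ E]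
    [NormedRing 𝔸] [NormedAlgebra ℂ 𝔸] {f g : E → 𝔸} {φ g' : E →L[ℂ] 𝔸} {t : E} {z : ℂ}
    (hf : HasFDerivAt f (z • mulForm (f t) φ) t) (hg : HasFDerivAt g g' t) :
    ∃ D : E →L[ℂ] 𝔸, (∀ v, D v = f t * g' v + z • (f t * φ v * g t)) ∧
      HasFDerivAt (fun t => f t * g t) D t := by
  refine ⟨_, fun v => ?_, hf.mul' hg⟩
  change f t * g' v + z • (f t * φ v) * g t = _
  rw [smul_mul_assoc]

variable {r : ℕ} {ι : Type*} [Fintype ι] [DecidableEq ι]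

/-- The point `q = exp t`. -/
noncomputable def expPoint (t : Fin r → ℂ) : Fin r → ℂ := fun a => Complex.exp (t a)

theorem hasFDerivAt_expPoint (t : Fin r → ℂ) (a : Fin r) :
    HasFDerivAt (fun t => expPoint t a)
      (Complex.exp (t a) • ContinuousLinearMap.proj (R := ℂ) (φ := fun _ : Fin r => ℂ) a) t :=
  (hasFDerivAt_apply a t).cexp

/-- Evaluation of a matrix over `ℂ[q,h]`. -/
noncomputable def evalMat (q : Fin r → ℂ) (z : ℂ) : Matrix ι ι (Coeff r) →+* Matrix ι ι ℂ :=
  (MvPolynomial.eval fun o : Option (Fin r) => o.elim z q).mapMatrix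

theorem evalMat_apply (q : Fin r → ℂ) (z : ℂ) (M : Matrix ι ι (Coeff r)) (j k : ι) :
    evalMat q z M j k = MvPolynomial.eval (fun o : Option (Fin r) => o.elim z q) (M j k) := rfl

section Form

variable {F : Type*} [NormedAddCommGroup F] [NormedSpace ℂ F]

/-- The `1`-form `∑ A_a dt_a`. -/
noncomputable def formOf (A : Fin r → F) : (Fin r → ℂ) →L[ℂ] F :=
  ∑ a, (ContinuousLinearMap.proj (R := ℂ) (φ := fun _ : Fin r => ℂ) a).smulRight (A a)

theorem formOf_apply (A : Fin r → F) (v : Fin r → ℂ) : formOf A v = ∑ a, v a • A a := by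
  simp [formOf]

theorem formOf_single (A : Fin r → F) (a : Fin r) : formOf A (Pi.single a 1) = A a := by
  rw [formOf_apply, Finset.sum_eq_single a]
  · rw [Pi.single_eq_same, one_smul]
  · intro b _ hb
    rw [Pi.single_eq_of_ne hb, zero_smul]
  · simp

theorem hasFDerivAt_formOf {f : Fin r → (Fin r → ℂ) → F} {g : Fin r → Fin r → F}
    {t : Fin r → ℂ} (h : ∀ a, HasFDerivAt (f a) (formOf (g a)) t) :
    ∃ D : (Fin r → ℂ) →L[ℂ] (Fin r → ℂ) →L[ℂ] F,
      (∀ x y, D x y = ∑ a, y a • ∑ b, x b • g a b) ∧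
      HasFDerivAt (fun t => formOf fun a => f a t) D t := by
  have h := HasFDerivAt.fun_sum (u := Finset.univ) fun (a : Fin r) _ =>
    (ContinuousLinearMap.smulRightL ℂ (Fin r → ℂ) F
      (ContinuousLinearMap.proj (R := ℂ) (φ := fun _ : Fin r => ℂ) a)).hasFDerivAt.comp t (h a)
  refine ⟨_, fun x y => ?_, h.congr_of_eventuallyEq (.of_forall fun t => rfl)⟩
  simp only [Finset.smul_sum]
  simp [formOf_apply, smul_smul, mul_comm]

end Form

/-- The matrix valued `1`-form `∑ A_a dt_a`. -/
noncomputable def matForm (A : Fin r → Matrix ι ι ℂ) : (Fin r → ℂ) →L[ℂ] Matrix ι ι ℂ :=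
  formOf A

theorem matForm_apply (A : Fin r → Matrix ι ι ℂ) (v : Fin r → ℂ) :
    matForm A v = ∑ a, v a • A a :=
  formOf_apply A v

theorem matForm_single (A : Fin r → Matrix ι ι ℂ) (a : Fin r) :
    matForm A (Pi.single a 1) = A a :=
  formOf_single A a

theorem hasFDerivAt_matrix {E : Type*} [NormedAddCommGroup E] [NormedSpace ℂ E]
    {f : E → Matrix ι ι ℂ} {f' : E →L[ℂ] Matrix ι ι ℂ} {t : E}
    (h : ∀ j k, ∃ D : E →L[ℂ] ℂ, (∀ v, D v = f' v j k) ∧ HasFDerivAt (fun t => f t j k) D t) :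
    HasFDerivAt f f' t := by
  choose D hD h using h
  have h1 : HasFDerivAt (E := E) (F := ι → ι → ℂ) f
      (ContinuousLinearMap.pi fun j => ContinuousLinearMap.pi fun k => D j k) t :=
    hasFDerivAt_pi.2 fun j => hasFDerivAt_pi.2 fun k => h j k
  have h2 : f' = (ContinuousLinearMap.pi fun j => ContinuousLinearMap.pi fun k => D j k :
      E →L[ℂ] (ι → ι → ℂ)) := by
    ext v j k
    exact (hD j k v).symm
  rw [h2]
  exact h1

theorem hasFDerivAt_entry {E : Type*} [NormedAddCommGroup E] [NormedSpace ℂ E]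
    {f : E → Matrix ι ι ℂ} {f' : E →L[ℂ] Matrix ι ι ℂ} {t : E} (h : HasFDerivAt f f' t) (j k : ι) :
    ∃ D : E →L[ℂ] ℂ, (∀ v, D v = f' v j k) ∧ HasFDerivAt (fun t => f t j k) D t := by
  have h1 : HasFDerivAt (E := E) (F := ι → ι → ℂ) f f' t := h
  exact ⟨_, fun v => rfl, hasFDerivAt_pi'.1 (hasFDerivAt_pi'.1 h1 j) k⟩

theorem hasFDerivAt_evalMat (z : ℂ) (M : Matrix ι ι (Coeff r)) (t : Fin r → ℂ) :
    HasFDerivAt (fun t => evalMat (expPoint t) z M)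
      (matForm fun a => evalMat (expPoint t) z (logDerivH a M)) t := by
  refine hasFDerivAt_matrix fun j k => ⟨_, fun v => ?_, hasFDerivAt_eval (M j k)
    (g := fun t o => Option.elim o z (expPoint t))
    (g' := fun o => Option.elim o 0 fun a => Complex.exp (t a) •
      ContinuousLinearMap.proj (R := ℂ) (φ := fun _ : Fin r => ℂ) a)
    (by
      rintro (_ | a)
      · exact hasFDerivAt_const z t
      · exact hasFDerivAt_expPoint t a)⟩
  rw [matForm_apply, Matrix.sum_apply]
  simp [Fintype.sum_option, evalMat_apply, logDerivH, expPoint]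
  exact Finset.sum_congr rfl fun _ _ => by ring

theorem evalMat_embedMat (q : Fin r → ℂ) (z : ℂ) (M : Matrix ι ι (QPoly r)) :
    evalMat q z (embedMat M) = evalAt q M := by
  ext j k
  rw [evalMat_apply, embedMat, Matrix.map_apply, evalAt, Matrix.map_apply, MvPolynomial.eval_rename]
  rfl

theorem hasFDerivAt_evalAt (M : Matrix ι ι (QPoly r)) (t : Fin r → ℂ) :
    HasFDerivAt (fun t => evalAt (expPoint t) M)
      (matForm fun a => evalAt (expPoint t) (logDeriv a M)) t := by
  refine hasFDerivAt_matrix fun j k => ⟨_, fun v => ?_, hasFDerivAt_eval (M j k)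
    (g := fun t => expPoint t) (hasFDerivAt_expPoint t)⟩
  rw [matForm_apply, Matrix.sum_apply]
  simp [evalAt, logDeriv, expPoint]
  exact Finset.sum_congr rfl fun _ _ => by ring

theorem evalMat_smul (q : Fin r → ℂ) (z : ℂ) (f : Coeff r) (M : Matrix ι ι (Coeff r)) :
    evalMat q z (f • M) = MvPolynomial.eval (fun o : Option (Fin r) => o.elim z q) f •
      evalMat q z M := by
  ext j k
  simp [evalMat_apply]

theorem hasSum_evalMat (q : Fin r → ℂ) (z : ℂ) (M : Matrix ι ι (Coeff r)) :
    HasSum (fun n => z ^ n • evalAt q (hCoeffMat n M)) (evalMat q z M) := by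
  obtain ⟨N, hN⟩ := exists_hCoeffMat_eq_zero M
  have h : evalMat q z M = ∑ n ∈ Finset.range N, z ^ n • evalAt q (hCoeffMat n M) := by
    ext j k
    rw [evalMat_apply, eval_eq_sum_hCoeff (M j k) (N := N)
      (fun n hn => congrFun (congrFun (hN n hn) j) k), Matrix.sum_apply]
    rfl
  rw [h]
  refine hasSum_sum_of_ne_finset_zero fun n hn => ?_
  rw [hN n (by simpa using hn)]
  ext j k
  simp [evalAt]

theorem evalMat_gaugeMat (q : Fin r → ℂ) (z : ℂ) (m : ℕ) (Q : ℕ → Matrix ι ι (QPoly r)) :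
    evalMat q z (gaugeMat m Q) =
      ∑ i ∈ Finset.range (m + 1), z ^ i • evalAt q (gaugeCoeff Q i) := by
  rw [gaugeMat, map_sum]
  refine Finset.sum_congr rfl fun i _ => ?_
  rw [evalMat_smul, map_pow, MvPolynomial.eval_X, evalMat_embedMat]
  rfl

theorem continuous_evalMat {X : Type*} [TopologicalSpace X] {f : X → Fin r → ℂ} {g : X → ℂ}
    (hf : Continuous f) (hg : Continuous g) (M : Matrix ι ι (Coeff r)) :
    Continuous fun x => evalMat (f x) (g x) M := by
  refine continuous_matrix fun j k => ?_
  refine (MvPolynomial.continuous_eval (M j k)).comp (continuous_pi ?_)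
  rintro (_ | a)
  · exact hg
  · exact (continuous_apply a).comp hf

theorem continuous_expPoint : Continuous (expPoint (r := r)) :=
  continuous_pi fun a => Complex.continuous_exp.comp (continuous_apply a)

theorem differentiable_evalMat_left (z : ℂ) (M : Matrix ι ι (Coeff r)) (j k : ι) :
    Differentiable ℂ fun q : Fin r → ℂ => evalMat q z M j k := fun t =>
  (hasFDerivAt_eval (M j k) (g := fun q o => Option.elim o z q)
    (g' := fun o => Option.elim o 0 fun a =>
      ContinuousLinearMap.proj (R := ℂ) (φ := fun _ : Fin r => ℂ) a)
    (by
      rintro (_ | a)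
      · exact hasFDerivAt_const z t
      · exact hasFDerivAt_apply a t)).differentiableAt

theorem differentiable_evalMat_right (q : Fin r → ℂ) (M : Matrix ι ι (Coeff r)) (j k : ι) :
    Differentiable ℂ fun z : ℂ => evalMat q z M j k := fun z =>
  (hasFDerivAt_eval (M j k) (g := fun z o => Option.elim o z q)
    (g' := fun o => Option.elim o (ContinuousLinearMap.id ℂ ℂ) fun _ => 0)
    (by
      rintro (_ | a)
      · exact hasFDerivAt_id z
      · exact hasFDerivAt_const (q a) z)).differentiableAt

theorem contDiff_circleExp {G : ℂ → ℂ} (hG : Differentiable ℂ G) :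
    ContDiff ℝ ∞ fun x : ℝ => G (Circle.exp x : ℂ) := by
  have h1 : ContDiff ℝ ∞ G := (hG.contDiff (n := ∞)).restrict_scalars ℝ
  refine h1.comp ?_
  simp only [Circle.coe_exp]
  exact ((Complex.ofRealCLM.contDiff).mul contDiff_const).cexp

theorem contDiff_circleExp_inv {G : ℂ → ℂ} (hG : Differentiable ℂ G) :
    ContDiff ℝ ∞ fun x : ℝ => G (Circle.exp x : ℂ)⁻¹ := by
  have := (contDiff_circleExp hG).comp (contDiff_neg (𝕜 := ℝ) (F := ℝ) (n := ∞))
  convert this using 2 with x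
  simp [Complex.exp_neg]

theorem IsSmoothLoop.mul {g g' : Circle → Matrix ι ι ℂ} (h : IsSmoothLoop g)
    (h' : IsSmoothLoop g') : IsSmoothLoop fun x => g x * g' x :=
  ⟨fun x => (h.1 x).mul (h'.1 x), fun j k => by
    simp only [Matrix.mul_apply]
    exact ContDiff.sum fun i _ => (h.2 j i).mul (h'.2 i k)⟩

variable {κ : Type*} {N : κ → MvPolynomial (Fin r) (Coeff r)}
  {P : Module.Basis ι (Coeff r) (DMod N)} {deg : ι → ℕ} {m : ℕ}

/-- The flat connection `∑ A_a(q) dt_a` as a `1`-form on `ℂ^r`. -/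
noncomputable def connForm (A : Fin r → Matrix ι ι (QPoly r)) (t : Fin r → ℂ) :
    (Fin r → ℂ) →L[ℂ] Matrix ι ι ℂ :=
  matForm fun a => evalAt (expPoint t) (A a)

theorem hasFDerivAt_connForm (A : Fin r → Matrix ι ι (QPoly r)) (t : Fin r → ℂ) :
    ∃ D : (Fin r → ℂ) →L[ℂ] (Fin r → ℂ) →L[ℂ] Matrix ι ι ℂ,
      (∀ x y, D x y = ∑ a, y a • ∑ b, x b • evalAt (expPoint t) (logDeriv b (A a))) ∧
      HasFDerivAt (connForm A) D t :=
  hasFDerivAt_formOf fun a => hasFDerivAt_evalAt (A a) t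

theorem IsGauge.exists_isPencilSolution {Q : ℕ → Matrix ι ι (QPoly r)}
    {A : Fin r → Matrix ι ι (QPoly r)} (h : IsGauge P deg m Q A) :
    (∃ Z S, IsPencilSolution (connForm A) Z S) ∧ ∃ M T, IsPencilInverse (connForm A) M T := by
  choose D hD hA using hasFDerivAt_connForm A
  have h1 : Differentiable ℂ (connForm A) := fun t => (hA t).differentiableAt
  have h2 : ∀ t x y, fderiv ℂ (connForm A) t x y = fderiv ℂ (connForm A) t y x := by
    intro t x y
    rw [(hA t).fderiv, hD, hD]
    simp only [Finset.smul_sum]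
    rw [Finset.sum_comm]
    refine Finset.sum_congr rfl fun a _ => Finset.sum_congr rfl fun b _ => ?_
    rw [smul_comm, h.closed]
  have h3 : ∀ t x y, connForm A t x * connForm A t y = connForm A t y * connForm A t x := by
    intro t x y
    simp only [connForm, matForm_apply, Finset.sum_mul, Finset.mul_sum, smul_mul_smul_comm]
    rw [Finset.sum_comm]
    refine Finset.sum_congr rfl fun a _ => Finset.sum_congr rfl fun b _ => ?_
    rw [← evalAt_mul, ← evalAt_mul, h.commute, mul_comm (x a)]
  exact ⟨QuantumDModule.exists_isPencilSolution h1 h2 h3,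
    QuantumDModule.exists_isPencilInverse h1 h2 h3⟩

theorem differentiable_entry {E : Type*} [NormedAddCommGroup E] [NormedSpace ℂ E]
    {f : E → Matrix ι ι ℂ} (hf : Differentiable ℂ f) (j k : ι) :
    Differentiable ℂ fun t => f t j k := fun t =>
  (hasFDerivAt_entry (hf t).hasFDerivAt j k).choose_spec.2.differentiableAt

theorem IsPencilSolution.isUnit {w : (Fin r → ℂ) → (Fin r → ℂ) →L[ℂ] Matrix ι ι ℂ}
    {Z M : ℕ → (Fin r → ℂ) → Matrix ι ι ℂ} {S T : (Fin r → ℂ) → ℂ → Matrix ι ι ℂ}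
    (h : IsPencilSolution w Z S) (h' : IsPencilInverse w M T) (t : Fin r → ℂ) (z : ℂ) :
    IsUnit (S t z) :=
  isUnit_iff_exists.2 ⟨T t z, h.mul_inverse h' t z,
    mul_eq_one_comm.1 (h.mul_inverse h' t z)⟩

/-- The parameter of the pencil is h⁻¹, so series in the parameter are series in nonpositive powers
of h. -/
theorem IsPencilSolution.isMinusLoop {w : (Fin r → ℂ) → (Fin r → ℂ) →L[ℂ] Matrix ι ι ℂ}
    {Z M : ℕ → (Fin r → ℂ) → Matrix ι ι ℂ} {S T : (Fin r → ℂ) → ℂ → Matrix ι ι ℂ}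
    (h : IsPencilSolution w Z S) (h' : IsPencilInverse w M T) (t : Fin r → ℂ) :
    IsMinusLoop fun x : Circle => S t (x : ℂ)⁻¹ := by
  refine ⟨⟨fun x => h.isUnit h' t _, fun j k => contDiff_circleExp_inv
    (G := fun z => S t z j k) (differentiable_entry (h.differentiable t) j k)⟩,
    ⟨fun n => Z n t, h.zero t, fun x => h.hasSum t _⟩, ⟨fun n => M n t, h'.zero t, fun x => ?_⟩⟩
  rw [Matrix.inv_eq_right_inv (h.mul_inverse h' t (x : ℂ)⁻¹)]
  exact h'.hasSum t _

theorem isPlusLoop_evalMat {M : Matrix ι ι (Coeff r)} (hM : IsUnit M) (q : Fin r → ℂ) :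
    IsPlusLoop (fun n => evalAt q (hCoeffMat n M)) fun x : Circle => evalMat q x M := by
  obtain ⟨C, hMC, hCM⟩ := isUnit_iff_exists.1 hM
  refine ⟨⟨fun x => hM.map _, fun j k => contDiff_circleExp
    (differentiable_evalMat_right q M j k)⟩, fun x => hasSum_evalMat q x M,
    fun n => evalAt q (hCoeffMat n C), fun x => ?_⟩
  rw [Matrix.inv_eq_right_inv (B := evalMat q x C) (by rw [← map_mul, hMC, map_one])]
  exact hasSum_evalMat q x C

theorem IsGauge.evalMat_zero {Q : ℕ → Matrix ι ι (QPoly r)}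
    {A : Fin r → Matrix ι ι (QPoly r)} (h : IsGauge P deg m Q A) (z : ℂ) :
    evalMat 0 z (gaugeMat m Q) = 1 := by
  rw [evalMat_gaugeMat, Finset.sum_eq_single 0]
  · rw [pow_zero, one_smul, gaugeCoeff, if_pos rfl, h.initial, if_pos rfl]
  · intro n _ hn
    rw [gaugeCoeff, if_neg hn, evalAt_mul, h.initial n, if_neg hn, mul_zero, smul_zero]
  · simp

theorem Omega_eq (P : Module.Basis ι (Coeff r) (DMod N)) (a : Fin r) (q : Fin r → ℂ) (x : Circle) :
    Omega P a q x = (x : ℂ)⁻¹ • evalMat q x (hOmega P a) := rfl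

/-- With L = SG one has dL = h⁻¹SAG + S dG, and the gauge equation h dG = G·hΩ − AG turns this into
SGΩ. -/
theorem IsGauge.hasFDerivAt_solution {Q : ℕ → Matrix ι ι (QPoly r)}
    {A : Fin r → Matrix ι ι (QPoly r)} (h : IsGauge P deg m Q A)
    {S : (Fin r → ℂ) → ℂ → Matrix ι ι ℂ} {Z : ℕ → (Fin r → ℂ) → Matrix ι ι ℂ}
    (hS : IsPencilSolution (connForm A) Z S) (x : Circle) (t : Fin r → ℂ) :
    ∃ D : (Fin r → ℂ) →L[ℂ] Matrix ι ι ℂ, (∀ a, D (Pi.single a 1) =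
      S t (x : ℂ)⁻¹ * evalMat (expPoint t) x (gaugeMat m Q) * Omega P a (expPoint t) x) ∧
    HasFDerivAt (fun t => S t (x : ℂ)⁻¹ * evalMat (expPoint t) x (gaugeMat m Q)) D t := by
  obtain ⟨D, hD, hL⟩ := hasFDerivAt_mul_of_mulForm (hS.hasFDerivAt t (x : ℂ)⁻¹)
    (hasFDerivAt_evalMat (x : ℂ) (gaugeMat m Q) t)
  refine ⟨D, fun a => (hD _).trans ?_, hL⟩
  have h2 := congrArg (evalMat (expPoint t) (x : ℂ)) (h.equation a)
  rw [evalMat_smul, map_sub, map_mul, map_mul, evalMat_embedMat, MvPolynomial.eval_X] at h2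
  change (x : ℂ) • _ = _ at h2
  have h3 : evalMat (expPoint t) (x : ℂ) (logDerivH a (gaugeMat m Q)) =
      (x : ℂ)⁻¹ • (evalMat (expPoint t) x (gaugeMat m Q) * evalMat (expPoint t) x (hOmega P a) -
        evalAt (expPoint t) (A a) * evalMat (expPoint t) x (gaugeMat m Q)) := by
    rw [← h2, inv_smul_smul₀ x.coe_ne_zero]
  refine (congrArg₂ (fun U V => S t (x : ℂ)⁻¹ * U + (x : ℂ)⁻¹ • (S t (x : ℂ)⁻¹ * V *
    evalMat (expPoint t) x (gaugeMat m Q))) ((matForm_single _ a).trans h3)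
    (matForm_single _ a)).trans ?_
  rw [Omega_eq, mul_smul_comm, mul_smul_comm,
    ← smul_add, mul_sub, mul_assoc, mul_assoc, sub_add_cancel]

theorem IsGauge.isSolution (hm : ∀ j, deg j ≤ m) {Q : ℕ → Matrix ι ι (QPoly r)}
    {A : Fin r → Matrix ι ι (QPoly r)} (h : IsGauge P deg m Q A)
    {S T : (Fin r → ℂ) → ℂ → Matrix ι ι ℂ} {Z M : ℕ → (Fin r → ℂ) → Matrix ι ι ℂ}
    (hS : IsPencilSolution (connForm A) Z S) (hT : IsPencilInverse (connForm A) M T) :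
    IsSolution P (fun t x => S t (x : ℂ)⁻¹ * evalMat (expPoint t) x (gaugeMat m Q)) := by
  have hderiv := h.hasFDerivAt_solution hS
  have hcoe : Continuous fun x : Circle => (x : ℂ) := continuous_subtype_val
  have hcont1 : Continuous fun p : (Fin r → ℂ) × Circle => S p.1 (p.2 : ℂ)⁻¹ :=
    hS.continuous.comp (continuous_fst.prodMk
      ((hcoe.comp continuous_snd).inv₀ fun p => p.2.coe_ne_zero))
  have hcont2 : Continuous fun p : (Fin r → ℂ) × Circle =>
      evalMat (expPoint p.1) (p.2 : ℂ) (gaugeMat m Q) :=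
    continuous_evalMat (continuous_expPoint.comp continuous_fst) (hcoe.comp continuous_snd) _
  constructor
  · exact fun t => (hS.isMinusLoop hT t).1.mul
      (isPlusLoop_evalMat (h.triangular.isUnit_gaugeMat hm) (expPoint t)).1
  · exact Continuous.matrix_mul hcont1 hcont2
  · intro x j k t
    obtain ⟨D, -, hD⟩ := hderiv x t
    exact (hasFDerivAt_entry hD j k).choose_spec.2.differentiableAt
  · intro t x a j k
    obtain ⟨D, hD1, hD⟩ := hderiv x t
    obtain ⟨D', hD2, hD'⟩ := hasFDerivAt_entry hD j k
    rw [hD'.fderiv, hD2, hD1]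
    rfl

theorem IsGauge.isNormalizedBirkhoff (hm : ∀ j, deg j ≤ m) {Q : ℕ → Matrix ι ι (QPoly r)}
    {A : Fin r → Matrix ι ι (QPoly r)} (h : IsGauge P deg m Q A)
    {S T : (Fin r → ℂ) → ℂ → Matrix ι ι ℂ} {Z M : ℕ → (Fin r → ℂ) → Matrix ι ι ℂ}
    (hS : IsPencilSolution (connForm A) Z S) (hT : IsPencilInverse (connForm A) M T) (ρ : ℝ) :
    IsNormalizedBirkhoff ρ
      (fun t x => S t (x : ℂ)⁻¹ * evalMat (expPoint t) x (gaugeMat m Q))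
      (fun t x => S t (x : ℂ)⁻¹) (fun q x => evalMat q x (gaugeMat m Q))
      fun n q => evalAt q (gaugeCoeff Q n) := by
  have hcoe : Continuous fun x : Circle => (x : ℂ) := continuous_subtype_val
  have hplus := fun q => isPlusLoop_evalMat (h.triangular.isUnit_gaugeMat hm) q
  simp only [hCoeffMat_gaugeMat hm h.triangular] at hplus
  have h4 : ContinuousOn (fun p : (Fin r → ℂ) × Circle => evalMat p.1 (p.2 : ℂ) (gaugeMat m Q))
      (Metric.ball 0 ρ ×ˢ Set.univ) :=
    (continuous_evalMat continuous_fst (hcoe.comp continuous_snd) (gaugeMat m Q)).continuousOn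
  have h5 := fun (x : Circle) (j k : ι) =>
    (differentiable_evalMat_left (x : ℂ) (gaugeMat m Q) j k).differentiableOn
      (s := Metric.ball 0 ρ)
  exact ⟨fun t _ => hS.isMinusLoop hT t, fun q _ => hplus q, fun t _ x => rfl, h4, h5,
    fun x => h.evalMat_zero _⟩

end Existence

end QuantumDModule

namespace QuantumDModule

/-! ### Fourier coefficients and rigidity of Birkhoff factorizations -/

section Fourier

variable {𝔸 : Type*} [NormedRing 𝔸] [NormedAlgebra ℂ 𝔸] [CompleteSpace 𝔸]

/-- The character `exp (i k θ)` of the circle. -/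
noncomputable def character (k : ℤ) (θ : ℝ) : ℂ := Complex.exp (k * θ * Complex.I)

theorem norm_character (k : ℤ) (θ : ℝ) : ‖character k θ‖ = 1 := by
  rw [character, show (k * θ * Complex.I : ℂ) = ((k * θ : ℝ) : ℂ) * Complex.I by push_cast; ring]
  exact Complex.norm_exp_ofReal_mul_I _

theorem continuous_character (k : ℤ) : Continuous (character k) := by
  unfold character
  fun_prop

theorem character_mul (k l : ℤ) (θ : ℝ) :
    character k θ * character l θ = character (k + l) θ := by
  rw [character, character, character, ← Complex.exp_add]
  congr 1
  push_cast
  ring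

theorem integral_character (k : ℤ) :
    ∫ θ in (0 : ℝ)..(2 * Real.pi), character k θ = if k = 0 then (2 * Real.pi : ℂ) else 0 := by
  split_ifs with h
  · subst h
    simp [character]
  · have hk : (k * Complex.I : ℂ) ≠ 0 := mul_ne_zero (Int.cast_ne_zero.2 h) Complex.I_ne_zero
    have h1 : ∀ θ : ℝ, character k θ = Complex.exp (k * Complex.I * θ) := fun θ => by
      rw [character]; ring_nf
    simp only [h1]
    rw [integral_exp_mul_complex hk]
    have h2 : Complex.exp (k * Complex.I * ((2 * Real.pi : ℝ) : ℂ)) = 1 := by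
      rw [Complex.exp_eq_one_iff]
      exact ⟨k, by push_cast; ring⟩
    rw [h2]
    simp

/-- The unnormalized Fourier coefficients of a function on the circle. -/
noncomputable def fcoeff (k : ℤ) (φ : ℝ → 𝔸) : 𝔸 :=
  ∫ θ in (0 : ℝ)..(2 * Real.pi), character (-k) θ • φ θ

omit [CompleteSpace 𝔸] in
theorem norm_fcoeff_le {k : ℤ} {φ : ℝ → 𝔸} {c : ℝ} (h : ∀ θ, ‖φ θ‖ ≤ c) :
    ‖fcoeff k φ‖ ≤ c * (2 * Real.pi) := by
  have := intervalIntegral.norm_integral_le_of_norm_le_const (a := 0) (b := 2 * Real.pi) (C := c)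
    (f := fun θ => character (-k) θ • φ θ)
    (fun θ _ => by rw [norm_smul, norm_character, one_mul]; exact h θ)
  rwa [sub_zero, abs_of_nonneg (by positivity)] at this

omit [CompleteSpace 𝔸] in
theorem fcoeff_add {k : ℤ} {φ ψ : ℝ → 𝔸} (hφ : Continuous φ) (hψ : Continuous ψ) :
    fcoeff k (fun θ => φ θ + ψ θ) = fcoeff k φ + fcoeff k ψ := by
  simp only [fcoeff, smul_add]
  exact intervalIntegral.integral_add
    (((continuous_character _).smul hφ).intervalIntegrable _ _)
    (((continuous_character _).smul hψ).intervalIntegrable _ _)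

theorem fcoeff_one (k : ℤ) :
    fcoeff k (fun _ => (1 : 𝔸)) = if k = 0 then (2 * Real.pi : ℂ) • 1 else 0 := by
  rw [fcoeff, intervalIntegral.integral_smul_const, integral_character]
  simp only [neg_eq_zero]
  split_ifs <;> simp

/-- `φ(θ) = ∑ exp (i e(n) θ) Aₙ`, with absolute convergence. -/
structure IsSeries (e : ℕ → ℤ) (A : ℕ → 𝔸) (φ : ℝ → 𝔸) : Prop where
  summable : Summable fun n => ‖A n‖
  hasSum : ∀ θ, HasSum (fun n => character (e n) θ • A n) (φ θ)

variable {e : ℕ → ℤ} {A : ℕ → 𝔸} {φ ψ : ℝ → 𝔸}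

theorem IsSeries.continuous (h : IsSeries e A φ) : Continuous φ := by
  have : φ = fun θ => ∑' n, character (e n) θ • A n := funext fun θ => (h.hasSum θ).tsum_eq.symm
  rw [this]
  exact continuous_tsum (fun n => (continuous_character _).smul continuous_const) h.summable
    fun n θ => by rw [norm_smul, norm_character, one_mul]

/-- Absolute convergence permits integration term by term, and each term hᵉAₙ only shifts the index.
-/
theorem IsSeries.hasSum_fcoeff_mul (h : IsSeries e A φ) (hψ : Continuous ψ) (k : ℤ) :
    HasSum (fun n => A n * fcoeff (k - e n) ψ) (fcoeff k fun θ => φ θ * ψ θ) := by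
  obtain ⟨c, hc⟩ := isCompact_uIcc (a := (0 : ℝ)) (b := 2 * Real.pi)
    |>.exists_bound_of_continuousOn hψ.continuousOn
  have := intervalIntegral.hasSum_integral_of_dominated_convergence
    (μ := MeasureTheory.volume) (a := 0) (b := 2 * Real.pi)
    (F := fun n θ => A n * (character (-(k - e n)) θ • ψ θ))
    (f := fun θ => character (-k) θ • (φ θ * ψ θ)) (fun n _ => ‖A n‖ * c)
    (fun n => (continuous_const.mul
      ((continuous_character _).smul hψ)).aestronglyMeasurable)
    (fun n => .of_forall fun θ hθ => by
      refine (norm_mul_le _ _).trans ?_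
      rw [norm_smul, norm_character, one_mul]
      gcongr
      exact hc θ (Set.uIoc_subset_uIcc hθ))
    (.of_forall fun θ _ => h.summable.mul_right c)
    intervalIntegrable_const
    (.of_forall fun θ _ => by
      refine (((h.hasSum θ).mul_right (ψ θ)).const_smul (character (-k) θ)).congr_fun fun n => ?_
      rw [neg_sub, sub_eq_neg_add, ← character_mul, mul_smul_comm, smul_mul_assoc, mul_smul])
  refine this.congr_fun fun n => ?_
  exact ((ContinuousLinearMap.mul ℂ 𝔸 (A n)).intervalIntegral_comp_comm
    (((continuous_character _).smul hψ).intervalIntegrable _ _)).symm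

theorem IsSeries.hasSum_mul_fcoeff (h : IsSeries e A φ) (hψ : Continuous ψ) (k : ℤ) :
    HasSum (fun n => fcoeff (k - e n) ψ * A n) (fcoeff k fun θ => ψ θ * φ θ) := by
  obtain ⟨c, hc⟩ := isCompact_uIcc (a := (0 : ℝ)) (b := 2 * Real.pi)
    |>.exists_bound_of_continuousOn hψ.continuousOn
  have := intervalIntegral.hasSum_integral_of_dominated_convergence
    (μ := MeasureTheory.volume) (a := 0) (b := 2 * Real.pi)
    (F := fun n θ => (character (-(k - e n)) θ • ψ θ) * A n)
    (f := fun θ => character (-k) θ • (ψ θ * φ θ)) (fun n _ => c * ‖A n‖)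
    (fun n => (((continuous_character _).smul hψ).mul continuous_const).aestronglyMeasurable)
    (fun n => .of_forall fun θ hθ => by
      refine (norm_mul_le _ _).trans ?_
      rw [norm_smul, norm_character, one_mul]
      gcongr
      exact hc θ (Set.uIoc_subset_uIcc hθ))
    (.of_forall fun θ _ => h.summable.mul_left c)
    intervalIntegrable_const
    (.of_forall fun θ _ => by
      refine (((h.hasSum θ).mul_left (ψ θ)).const_smul (character (-k) θ)).congr_fun fun n => ?_
      rw [neg_sub, sub_eq_neg_add, ← character_mul, mul_smul_comm, smul_mul_assoc, mul_smul])
  refine this.congr_fun fun n => ?_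
  exact (((ContinuousLinearMap.mul ℂ 𝔸).flip (A n)).intervalIntegral_comp_comm
    (((continuous_character _).smul hψ).intervalIntegrable _ _)).symm

/-- All Fourier coefficients with nonnegative index are those of the constant loop `1`. -/
def IsMinusFourier (φ : ℝ → 𝔸) : Prop :=
  ∀ k : ℤ, 0 ≤ k → fcoeff k φ = if k = 0 then (2 * Real.pi : ℂ) • 1 else 0

/-- `φ` is the sum of an absolutely convergent series `1 + h⁻¹ A₁ + h⁻² A₂ + ⋯`. -/
def IsMinusSeries (φ : ℝ → 𝔸) : Prop :=
  ∃ A : ℕ → 𝔸, A 0 = 1 ∧ IsSeries (fun n => -(n : ℤ)) A φ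

theorem isMinusFourier_one : IsMinusFourier fun _ => (1 : 𝔸) := fun k _ => fcoeff_one k

theorem IsMinusSeries.continuous (h : IsMinusSeries φ) : Continuous φ := by
  obtain ⟨A, -, h⟩ := h
  exact h.continuous

/-- For n ≥ 1 the term h⁻ⁿAₙ reads off the coefficient of index k + n > 0, which is zero; only A₀ =
1 contributes. -/
theorem IsMinusSeries.mul (h : IsMinusSeries φ) (hc : Continuous ψ) (hψ : IsMinusFourier ψ) :
    IsMinusFourier fun θ => φ θ * ψ θ := by
  obtain ⟨A, hA, h⟩ := h
  intro k hk
  refine (h.hasSum_fcoeff_mul hc k).unique ?_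
  convert hasSum_single 0 fun n hn => ?_ using 1
  · simp only [Nat.cast_zero, neg_zero, sub_zero, hA, one_mul]
    rw [hψ k hk]
  · rw [hψ _ (by omega), if_neg (by omega), mul_zero]

theorem IsMinusSeries.mul_left (h : IsMinusSeries φ) (hc : Continuous ψ) (hψ : IsMinusFourier ψ) :
    IsMinusFourier fun θ => ψ θ * φ θ := by
  obtain ⟨A, hA, h⟩ := h
  intro k hk
  refine (h.hasSum_mul_fcoeff hc k).unique ?_
  convert hasSum_single 0 fun n hn => ?_ using 1
  · simp only [Nat.cast_zero, neg_zero, sub_zero, hA, mul_one]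
    rw [hψ k hk]
  · rw [hψ _ (by omega), if_neg (by omega), zero_mul]

theorem IsMinusSeries.isMinusFourier (h : IsMinusSeries φ) : IsMinusFourier φ := by
  simpa using h.mul continuous_const isMinusFourier_one

/-- `φ = ∑ hⁿ Bₙ` with absolute convergence. -/
def IsPlusSeries (B : ℕ → 𝔸) (φ : ℝ → 𝔸) : Prop := IsSeries (fun n => (n : ℤ)) B φ

theorem IsPlusSeries.fcoeff_eq {B : ℕ → 𝔸} (h : IsPlusSeries B φ) (k : ℕ) :
    fcoeff k φ = (2 * Real.pi : ℂ) • B k := by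
  have h1 := h.hasSum_fcoeff_mul (ψ := fun _ => 1) continuous_const k
  simp only [mul_one, fcoeff_one] at h1
  refine h1.unique ?_
  convert hasSum_single k fun n hn => ?_ using 1
  · simp
  · rw [if_neg (by omega), mul_zero]

theorem IsPlusSeries.fcoeff_eq_zero {B : ℕ → 𝔸} (h : IsPlusSeries B φ) {k : ℤ} (hk : k < 0) :
    fcoeff k φ = 0 := by
  have h1 := h.hasSum_fcoeff_mul (ψ := fun _ => 1) continuous_const k
  simp only [mul_one, fcoeff_one] at h1
  refine h1.unique ?_
  convert hasSum_zero with n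
  rw [if_neg (by omega), mul_zero]

/-- If `φ` and `φ₀` are plus loops and `φ φ₀⁻¹` is a minus loop, then `φ = φ₀`. -/
theorem IsPlusSeries.eq_of_isMinusFourier {B B₀ B₀' : ℕ → 𝔸} {φ₀ φ₀' : ℝ → 𝔸}
    (h : IsPlusSeries B φ) (h₀ : IsPlusSeries B₀ φ₀) (h₀' : IsPlusSeries B₀' φ₀')
    (hinv : ∀ θ, φ₀' θ * φ₀ θ = 1) (hm : IsMinusFourier fun θ => φ θ * φ₀' θ) : B = B₀ := by
  -- A product of plus series has no negative coefficients, so the Fourier coefficients of φφ₀⁻¹ are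
  -- all those of 1. Multiplying by φ₀ compares φ with φ₀ coefficient by coefficient.
  have hneg : ∀ k : ℤ, k < 0 → fcoeff k (fun θ => φ θ * φ₀' θ) = 0 := by
    intro k hk
    refine (h.hasSum_fcoeff_mul h₀'.continuous k).unique ?_
    convert hasSum_zero with n
    rw [h₀'.fcoeff_eq_zero (by omega), mul_zero]
  funext k
  have h1 := h₀.hasSum_mul_fcoeff (ψ := fun θ => φ θ * φ₀' θ) (h.continuous.mul h₀'.continuous) k
  simp only [mul_assoc, hinv, mul_one] at h1
  rw [h.fcoeff_eq] at h1
  have h2 : HasSum (fun n : ℕ => fcoeff ((k : ℤ) - (n : ℤ)) (fun θ => φ θ * φ₀' θ) * B₀ n)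
      ((2 * Real.pi : ℂ) • B₀ k) := by
    convert hasSum_single k fun n hn => ?_ using 1
    · rw [sub_self, hm 0 le_rfl, if_pos rfl, smul_mul_assoc, one_mul]
    · rcases lt_or_ge ((k : ℤ) - n) 0 with h3 | h3
      · rw [hneg _ h3, zero_mul]
      · rw [hm _ h3, if_neg (by omega), zero_mul]
  exact smul_right_injective 𝔸 (r := (2 * Real.pi : ℂ))
    (by exact_mod_cast Real.two_pi_pos.ne') (h1.unique h2)

/-- Let `C n_s = m_s g_s`, where `m_s`, `n_s` are minus loops. If `n_s` and its inverse grow slowly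
for `s → -∞`, while `g_s` tends to `1` fast enough, then `g_0` is a minus loop. -/
theorem isMinusFourier_of_growth {C : ℝ → 𝔸} {m m' n n' g : ℝ → ℝ → 𝔸} {K c c' s₁ : ℝ}
    (hm : ∀ s ≤ 0, IsMinusSeries (m s)) (hm' : IsMinusSeries (m' 0))
    (hn : ∀ s ≤ 0, IsMinusSeries (n s)) (hn' : ∀ s ≤ 0, IsMinusSeries (n' s))
    (hmm : ∀ θ, m' 0 θ * m 0 θ = 1)
    (hnn : ∀ s θ, n s θ * n' s θ = 1) (hg : ∀ s ≤ 0, Continuous (g s))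
    (h : ∀ s ≤ 0, ∀ θ, C θ * n s θ = m s θ * g s θ) (hC : ∀ θ, ‖C θ‖ ≤ c')
    (hng : ∀ s ≤ s₁, ∀ θ, ‖n s θ‖ ≤ c * Real.exp (-s / 4))
    (hng' : ∀ s ≤ s₁, ∀ θ, ‖n' s θ‖ ≤ c * Real.exp (-s / 4))
    (hgK : ∀ s ≤ 0, ∀ θ, ‖g s θ - 1‖ ≤ K * Real.exp s) :
    IsMinusFourier (g 0) := by
  have hCeq : ∀ s ≤ 0, ∀ θ, C θ = m s θ * n' s θ + m s θ * (g s θ - 1) * n' s θ := by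
    intro s hs θ
    rw [mul_sub, mul_one, sub_mul, add_sub_cancel, ← h s hs, mul_assoc, hnn, mul_one]
  have hc' : 0 ≤ c' := (norm_nonneg _).trans (hC 0)
  have hK : 0 ≤ K := by simpa using (norm_nonneg _).trans (hgK 0 le_rfl 0)
  have hCcont : Continuous C := by
    have : C = fun θ => m 0 θ * n' 0 θ + m 0 θ * (g 0 θ - 1) * n' 0 θ :=
      funext fun θ => hCeq 0 le_rfl θ
    rw [this]
    have h1 := (hm 0 le_rfl).continuous
    have h2 := (hn' 0 le_rfl).continuous
    have h3 := hg 0 le_rfl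
    fun_prop
  -- Once ‖g − 1‖ ≤ 1/2, the norm of m is at most 2‖mg‖ = 2‖Cn‖, which is O(e^(−s/4)). The error is
  -- then of size e^(−s/4)·e^s·e^(−s/4) = e^(s/2).
  have hsmall : ∀ s, s ≤ 0 → s ≤ s₁ → K * Real.exp s ≤ 1 / 2 → ∀ θ,
      ‖m s θ * (g s θ - 1) * n' s θ‖ ≤ 2 * c' * c * K * c * Real.exp (s / 2) := by
    intro s hs hs1 hs2 θ
    have h1 : ‖m s θ‖ ≤ 2 * (c' * (c * Real.exp (-s / 4))) := by
      have h2 : ‖m s θ * (g s θ - 1)‖ ≤ ‖m s θ‖ * (1 / 2) :=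
        (norm_mul_le _ _).trans (by gcongr; exact (hgK s hs θ).trans hs2)
      have h3 : ‖m s θ * g s θ‖ ≤ c' * (c * Real.exp (-s / 4)) := by
        rw [← h s hs]
        exact (norm_mul_le _ _).trans (by gcongr; exacts [hC θ, hng s hs1 θ])
      have h4 : ‖m s θ‖ ≤ ‖m s θ * g s θ‖ + ‖m s θ * (g s θ - 1)‖ := by
        have : m s θ = m s θ * g s θ - m s θ * (g s θ - 1) := by rw [mul_sub, mul_one]; abel
        conv_lhs => rw [this]
        exact norm_sub_le _ _
      linarith
    have h5 : Real.exp (s / 2) = Real.exp (-s / 4) * Real.exp s * Real.exp (-s / 4) := by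
      rw [← Real.exp_add, ← Real.exp_add]; congr 1; ring
    calc ‖m s θ * (g s θ - 1) * n' s θ‖ ≤ ‖m s θ‖ * ‖g s θ - 1‖ * ‖n' s θ‖ :=
          (norm_mul_le _ _).trans (by gcongr; exact norm_mul_le _ _)
      _ ≤ 2 * (c' * (c * Real.exp (-s / 4))) * (K * Real.exp s) * (c * Real.exp (-s / 4)) := by
          have := hng' s hs1 θ
          have := hgK s hs θ
          have hc0 : 0 ≤ c := nonneg_of_mul_nonneg_left
            ((norm_nonneg _).trans (hng s hs1 θ)) (Real.exp_pos _)
          gcongr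
      _ = _ := by rw [h5]; ring
  -- The main term m_s n_s⁻¹ is a minus loop for every s and C does not depend on s, so the error
  -- can be sent to zero.
  have hCm : IsMinusFourier C := by
    intro k hk
    refine sub_eq_zero.1 (norm_le_zero_iff.1 ?_)
    have hlim : Filter.Tendsto (fun s : ℝ => 2 * c' * c * K * c * Real.exp (s / 2) * (2 * Real.pi))
        Filter.atBot (nhds (2 * c' * c * K * c * 0 * (2 * Real.pi))) :=
      ((Real.tendsto_exp_atBot.comp (Filter.tendsto_id.atBot_div_const (by norm_num))).const_mul
        _).mul_const _
    have hlim2 : Filter.Tendsto (fun s : ℝ => K * Real.exp s) Filter.atBot (nhds (K * 0)) :=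
      Real.tendsto_exp_atBot.const_mul K
    rw [mul_zero] at hlim2
    rw [mul_zero, zero_mul] at hlim
    refine ge_of_tendsto hlim ?_
    filter_upwards [Filter.eventually_le_atBot 0, Filter.eventually_le_atBot s₁,
      hlim2.eventually_le_const (show (0 : ℝ) < 1 / 2 by norm_num)] with s h1 h2 h3
    have h4 := (hm s h1).mul (hn' s h1).continuous (hn' s h1).isMinusFourier k hk
    have h5 : fcoeff k C = fcoeff k (fun θ => m s θ * n' s θ) +
        fcoeff k (fun θ => m s θ * (g s θ - 1) * n' s θ) := by
      rw [← fcoeff_add (φ := fun θ => m s θ * n' s θ)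
        (ψ := fun θ => m s θ * (g s θ - 1) * n' s θ) ((hm s h1).continuous.mul (hn' s h1).continuous)
        (((hm s h1).continuous.mul ((hg s h1).sub continuous_const)).mul (hn' s h1).continuous)]
      congr 1
      exact funext fun θ => hCeq s h1 θ
    rw [h5, h4, add_sub_cancel_left]
    exact norm_fcoeff_le (hsmall s h1 h2 h3)
  have hgeq : g 0 = fun θ => m' 0 θ * (C θ * n 0 θ) := by
    funext θ
    rw [h 0 le_rfl, ← mul_assoc, hmm, one_mul]
  rw [hgeq]
  exact hm'.mul (hCcont.mul (hn 0 le_rfl).continuous) ((hn 0 le_rfl).mul_left hCcont hCm)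

end Fourier

end QuantumDModule

namespace QuantumDModule

/-! ### Growth estimates -/

section Growth

/-- Grönwall's inequality with time reversed from s₁. -/
theorem norm_le_exp_of_norm_deriv_le {F : Type*} [NormedAddCommGroup F] [NormedSpace ℝ F]
    {y y' : ℝ → F} {K s₁ : ℝ} (hd : ∀ s, HasDerivAt y (y' s) s)
    (hb : ∀ s ≤ s₁, ‖y' s‖ ≤ K * ‖y s‖) {s : ℝ} (hs : s ≤ s₁) :
    ‖y s‖ ≤ ‖y s₁‖ * Real.exp (K * (s₁ - s)) := by
  have hd' : ∀ x, HasDerivAt (fun x => y (s₁ - x)) (-y' (s₁ - x)) x := fun x => by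
    simpa [Function.comp_def] using (hd (s₁ - x)).scomp x ((hasDerivAt_id x).const_sub s₁)
  have := norm_le_gronwallBound_of_norm_deriv_right_le (f := fun x => y (s₁ - x))
    (f' := fun x => -y' (s₁ - x)) (δ := ‖y s₁‖) (K := K) (ε := 0) (a := 0) (b := s₁ - s)
    (fun x _ => (hd' x).continuousAt.continuousWithinAt) (fun x _ => (hd' x).hasDerivWithinAt)
    (by simp) (fun x hx => by
      rw [norm_neg, add_zero]
      exact hb _ (by linarith [hx.1])) (s₁ - s) ⟨by linarith, le_rfl⟩
  rwa [gronwallBound_ε0, sub_sub_cancel, sub_zero] at this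

variable {E 𝔸 : Type*} [NormedAddCommGroup E] [NormedSpace ℂ E]
  [NormedRing 𝔸] [NormedAlgebra ℂ 𝔸]
  {w : E → E →L[ℂ] 𝔸} {Z M : ℕ → E → 𝔸} {S T : E → ℂ → 𝔸}

theorem hasDerivAt_line {F : Type*} [NormedAddCommGroup F] [NormedSpace ℂ F] {f : E → F}
    {D : E →L[ℂ] F} {t v : E} {s : ℝ} (h : HasFDerivAt f D (t + (s : ℂ) • v)) :
    HasDerivAt (fun s : ℝ => f (t + (s : ℂ) • v)) (D v) s := by
  have h1 : HasDerivAt (fun s : ℝ => t + (s : ℂ) • v) v s := by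
    simpa using ((Complex.ofRealCLM.hasDerivAt (x := s)).smul_const v).const_add t
  exact HasFDerivAt.comp_hasDerivAt (f := fun s : ℝ => t + (s : ℂ) • v) s
    (h.restrictScalars ℝ) h1

/-- The product S d' solves an equation whose coefficient is the conjugate d w d', so the growth
rate is governed by the conjugate rather than by w itself. -/
theorem IsPencilSolution.norm_le (h : IsPencilSolution w Z S) {t v : E} {d d' : 𝔸} {s₁ : ℝ}
    (hd : d' * d = 1) (hw : ∀ s : ℝ, s ≤ s₁ → ‖d * w (t + (s : ℂ) • v) v * d'‖ ≤ 1 / 4) {z : ℂ}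
    (hz : ‖z‖ = 1) {s : ℝ} (hs : s ≤ s₁) :
    ‖S (t + (s : ℂ) • v) z‖ ≤
      ‖S (t + (s₁ : ℂ) • v) z * d'‖ * Real.exp (1 / 4 * (s₁ - s)) * ‖d‖ := by
  have h1 : ∀ s : ℝ, HasDerivAt (fun s : ℝ => S (t + (s : ℂ) • v) z * d')
      (z • (S (t + (s : ℂ) • v) z * w (t + (s : ℂ) • v) v) * d') s := fun s =>
    (hasDerivAt_line (h.hasFDerivAt (t + (s : ℂ) • v) z)).mul_const d'
  have h2 := norm_le_exp_of_norm_deriv_le (K := 1 / 4) h1 (fun s hs => by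
    have : S (t + (s : ℂ) • v) z * w (t + (s : ℂ) • v) v * d' =
        S (t + (s : ℂ) • v) z * d' * (d * w (t + (s : ℂ) • v) v * d') := by
      simp only [← mul_assoc]
      rw [mul_assoc (S _ z) d' d, hd, mul_one]
    rw [smul_mul_assoc, norm_smul, hz, one_mul, this, mul_comm (1 / 4 : ℝ)]
    exact (norm_mul_le _ _).trans (by gcongr; exact hw s hs)) hs
  calc ‖S (t + (s : ℂ) • v) z‖ = ‖S (t + (s : ℂ) • v) z * d' * d‖ := by
        rw [mul_assoc, hd, mul_one]
    _ ≤ _ := (norm_mul_le _ _).trans (by gcongr)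

theorem IsPencilInverse.norm_le (h : IsPencilInverse w M T) {t v : E} {d d' : 𝔸} {s₁ : ℝ}
    (hd : d' * d = 1) (hw : ∀ s : ℝ, s ≤ s₁ → ‖d * w (t + (s : ℂ) • v) v * d'‖ ≤ 1 / 4) {z : ℂ}
    (hz : ‖z‖ = 1) {s : ℝ} (hs : s ≤ s₁) :
    ‖T (t + (s : ℂ) • v) z‖ ≤
      ‖d'‖ * (‖d * T (t + (s₁ : ℂ) • v) z‖ * Real.exp (1 / 4 * (s₁ - s))) := by
  have h1 : ∀ s : ℝ, HasDerivAt (fun s : ℝ => d * T (t + (s : ℂ) • v) z)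
      (d * -(z • (w (t + (s : ℂ) • v) v * T (t + (s : ℂ) • v) z))) s := fun s => by
    obtain ⟨D, hD, hT⟩ := h.hasFDerivAt (t + (s : ℂ) • v) z
    rw [← hD]
    exact (hasDerivAt_line hT).const_mul d
  have h2 := norm_le_exp_of_norm_deriv_le (K := 1 / 4) h1 (fun s hs => by
    have : d * (w (t + (s : ℂ) • v) v * T (t + (s : ℂ) • v) z) =
        d * w (t + (s : ℂ) • v) v * d' * (d * T (t + (s : ℂ) • v) z) := by
      rw [mul_assoc (d * w _ v), ← mul_assoc d' d, hd, one_mul, mul_assoc]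
    rw [mul_neg, norm_neg, mul_smul_comm, norm_smul, hz, one_mul, this]
    exact (norm_mul_le _ _).trans (by gcongr; exact hw s hs)) hs
  calc ‖T (t + (s : ℂ) • v) z‖ = ‖d' * (d * T (t + (s : ℂ) • v) z)‖ := by
        rw [← mul_assoc, hd, one_mul]
    _ ≤ _ := (norm_mul_le _ _).trans (by gcongr)

theorem exists_norm_le_of_conj_small (h : IsPencilSolution w Z S) (h' : IsPencilInverse w M T)
    {t v : E} {d d' : 𝔸} {s₁ : ℝ} (hd : d' * d = 1)
    (hw : ∀ s : ℝ, s ≤ s₁ → ‖d * w (t + (s : ℂ) • v) v * d'‖ ≤ 1 / 4) :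
    ∃ c : ℝ, ∀ s : ℝ, s ≤ s₁ → ∀ z : ℂ, ‖z‖ = 1 →
      ‖S (t + (s : ℂ) • v) z‖ ≤ c * Real.exp (-s / 4) ∧
      ‖T (t + (s : ℂ) • v) z‖ ≤ c * Real.exp (-s / 4) := by
  obtain ⟨c₁, h1⟩ := (isCompact_sphere (0 : ℂ) 1).exists_bound_of_continuousOn
    ((h.differentiable (t + (s₁ : ℂ) • v)).continuous.mul_const d').continuousOn
  obtain ⟨c₂, h2⟩ := (isCompact_sphere (0 : ℂ) 1).exists_bound_of_continuousOn
    ((h'.differentiable (t + (s₁ : ℂ) • v)).continuous.const_mul d).continuousOn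
  refine ⟨max (c₁ * Real.exp (s₁ / 4) * ‖d‖) (‖d'‖ * (c₂ * Real.exp (s₁ / 4))),
    fun s hs z hz => ?_⟩
  have he : Real.exp (1 / 4 * (s₁ - s)) = Real.exp (s₁ / 4) * Real.exp (-s / 4) := by
    rw [← Real.exp_add]; ring_nf
  have hz' : z ∈ Metric.sphere (0 : ℂ) 1 := by simpa using hz
  constructor
  · refine (h.norm_le hd hw hz hs).trans ?_
    rw [he]
    calc _ ≤ c₁ * (Real.exp (s₁ / 4) * Real.exp (-s / 4)) * ‖d‖ := by gcongr; exact h1 z hz'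
      _ = c₁ * Real.exp (s₁ / 4) * ‖d‖ * Real.exp (-s / 4) := by ring
      _ ≤ _ := by gcongr; exact le_max_left _ _
  · refine (h'.norm_le hd hw hz hs).trans ?_
    rw [he]
    calc _ ≤ ‖d'‖ * (c₂ * (Real.exp (s₁ / 4) * Real.exp (-s / 4))) := by gcongr; exact h2 z hz'
      _ = ‖d'‖ * (c₂ * Real.exp (s₁ / 4)) * Real.exp (-s / 4) := by ring
      _ ≤ _ := by gcongr; exact le_max_right _ _

/-- Two solutions of `y' = y W` differ by a constant factor on the left. -/
theorem eq_const_mul_of_hasDerivAt [CompleteSpace 𝔸] {a b W : ℝ → 𝔸}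
    (ha : ∀ s, HasDerivAt a (a s * W s) s) (hb : ∀ s, HasDerivAt b (b s * W s) s)
    (hu : ∀ s, IsUnit (b s)) (s : ℝ) : a s = a 0 * Ring.inverse (b 0) * b s := by
  have hinv : ∀ s, HasDerivAt (fun s => Ring.inverse (b s)) (-(W s * Ring.inverse (b s))) s := by
    intro s
    have h1 : DifferentiableAt ℝ (fun s => Ring.inverse (b s)) s :=
      (differentiableAt_inverse (𝕜 := ℝ) (hu s)).comp s (hb s).differentiableAt
    have h2 := (hb s).mul h1.hasDerivAt
    have h3 : HasDerivAt (b * fun s => Ring.inverse (b s)) 0 s := by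
      have : (b * fun s => Ring.inverse (b s)) = fun _ => 1 :=
        funext fun s => Ring.mul_inverse_cancel _ (hu s)
      rw [this]
      exact hasDerivAt_const s 1
    have h4 := h2.unique h3
    have h5 : deriv (fun s => Ring.inverse (b s)) s = -(W s * Ring.inverse (b s)) := by
      have h6 := congrArg (fun x => Ring.inverse (b s) * x) h4
      simp only [mul_add, ← mul_assoc, Ring.inverse_mul_cancel _ (hu s), one_mul, mul_zero] at h6
      exact eq_neg_of_add_eq_zero_right h6
    rw [← h5]
    exact h1.hasDerivAt
  have hz : ∀ s, HasDerivAt (fun s => a s * Ring.inverse (b s)) 0 s := by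
    intro s
    refine ((ha s).mul (hinv s)).congr_deriv ?_
    rw [mul_neg, mul_assoc, add_neg_cancel]
  have : a s * Ring.inverse (b s) = a 0 * Ring.inverse (b 0) := is_const_of_deriv_eq_zero (fun s => (hz s).differentiableAt) (fun s => (hz s).deriv) s 0
  rw [← this, mul_assoc, Ring.inverse_mul_cancel _ (hu s), mul_one]

/-- The Schwarz lemma: f maps the disc into the ball of radius 2c about f(0) = 1. -/
theorem norm_sub_one_le_of_bound {f : ℂ → 𝔸} {R c : ℝ} (hR : 1 ≤ R)
    (hf : DifferentiableOn ℂ f (Metric.ball 0 R)) (h0 : f 0 = 1)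
    (hc : ∀ x ∈ Metric.ball (0 : ℂ) R, ‖f x‖ ≤ c) {x : ℂ} (hx : x ∈ Metric.ball (0 : ℂ) R) :
    ‖f x - 1‖ ≤ 2 * c * ‖x‖ := by
  have hmap : Set.MapsTo f (Metric.ball 0 R) (Metric.closedBall (f 0) (2 * c)) := by
    intro y hy
    rw [mem_closedBall_iff_norm]
    have := norm_sub_le (f y) (f 0)
    have := hc y hy
    have := hc 0 (Metric.mem_ball_self (by linarith))
    linarith
  have h := Complex.dist_le_div_mul_dist_of_mapsTo_ball hf hmap hx
  rw [dist_eq_norm, dist_zero_right, h0] at h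
  refine h.trans ?_
  have hc0 : 0 ≤ c := (norm_nonneg _).trans (hc x hx)
  gcongr
  exact div_le_self (by positivity) hR

end Growth

end QuantumDModule

namespace QuantumDModule

/-! ### Uniqueness of the Birkhoff factorization -/

section Uniqueness

attribute [local instance] Matrix.linftyOpNormedRing Matrix.linftyOpNormedAlgebra

set_option linter.unusedSectionVars false

variable {r : ℕ} {ι : Type*} [Fintype ι] [DecidableEq ι]

/-- As M shifts the grading by exactly one, conjugation by the diagonal matrix with entries c^deg
multiplies M by c. -/
theorem exists_diagonal_conj {deg : ι → ℕ} {M : Matrix ι ι ℂ}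
    (hM : ∀ j k, M j k ≠ 0 → deg j = deg k + 1) {ε : ℝ} (hε : 0 < ε) :
    ∃ d d' : Matrix ι ι ℂ, d' * d = 1 ∧ ‖d * M * d'‖ < ε := by
  set c : ℝ := ε / (2 * (‖M‖ + 1)) with hc
  have hc0 : 0 < c := by positivity
  have hcz : (c : ℂ) ≠ 0 := by exact_mod_cast hc0.ne'
  refine ⟨Matrix.diagonal fun j => (c : ℂ) ^ deg j, Matrix.diagonal fun j => ((c : ℂ) ^ deg j)⁻¹,
    ?_, ?_⟩
  · rw [Matrix.diagonal_mul_diagonal, ← Matrix.diagonal_one]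
    congr 1
    funext j
    exact inv_mul_cancel₀ (pow_ne_zero _ hcz)
  · have h : (Matrix.diagonal fun j => (c : ℂ) ^ deg j) * M *
        (Matrix.diagonal fun j => ((c : ℂ) ^ deg j)⁻¹) = (c : ℂ) • M := by
      ext j k
      rw [Matrix.mul_diagonal, Matrix.diagonal_mul, Matrix.smul_apply, smul_eq_mul]
      by_cases hjk : M j k = 0
      · rw [hjk]; ring
      · rw [hM j k hjk, pow_succ]
        field_simp
    rw [h, norm_smul, Complex.norm_real, Real.norm_of_nonneg hc0.le, hc, div_mul_eq_mul_div,
      div_lt_iff₀ (by positivity)]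
    nlinarith [norm_nonneg M]

theorem expPoint_line (t : Fin r → ℂ) (s : ℝ) :
    expPoint (t + (s : ℂ) • (1 : Fin r → ℂ)) = ((Real.exp s : ℝ) : ℂ) • expPoint t := by
  funext a
  simp [expPoint, Complex.exp_add, mul_comm]

theorem connForm_apply (A : Fin r → Matrix ι ι (QPoly r)) (t v : Fin r → ℂ) :
    connForm A t v = ∑ a, v a • evalAt (expPoint t) (A a) :=
  matForm_apply _ v

theorem continuous_evalAt (M : Matrix ι ι (QPoly r)) :
    Continuous fun q : Fin r → ℂ => evalAt q M :=
  continuous_matrix fun j k => MvPolynomial.continuous_eval (M j k)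

theorem tendsto_connForm_line (A : Fin r → Matrix ι ι (QPoly r)) (t : Fin r → ℂ) :
    Filter.Tendsto (fun s : ℝ => connForm A (t + (s : ℂ) • (1 : Fin r → ℂ)) 1) Filter.atBot
      (nhds (∑ a, evalAt 0 (A a))) := by
  have h1 : Filter.Tendsto (fun s : ℝ => ((Real.exp s : ℝ) : ℂ) • expPoint t) Filter.atBot
      (nhds 0) := by
    have : Filter.Tendsto (fun s : ℝ => ((Real.exp s : ℝ) : ℂ)) Filter.atBot (nhds ((0 : ℝ) : ℂ)) :=
      (Complex.continuous_ofReal.tendsto 0).comp Real.tendsto_exp_atBot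
    simpa using this.smul_const (expPoint t)
  have h2 : Filter.Tendsto (fun q : Fin r → ℂ => ∑ a, evalAt q (A a)) (nhds 0)
      (nhds (∑ a, evalAt 0 (A a))) :=
    (continuous_finsetSum _ fun a _ => continuous_evalAt (A a)).tendsto 0
  refine (h2.comp h1).congr fun s => ?_
  refine Eq.trans ?_ (connForm_apply A _ 1).symm
  simp only [Function.comp, Pi.one_apply, one_smul, expPoint_line]

variable {κ : Type*} {N : κ → MvPolynomial (Fin r) (Coeff r)}
  {P : Module.Basis ι (Coeff r) (DMod N)} {deg : ι → ℕ} {m : ℕ}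
  {Q : ℕ → Matrix ι ι (QPoly r)} {A : Fin r → Matrix ι ι (QPoly r)}
  {S T : (Fin r → ℂ) → ℂ → Matrix ι ι ℂ} {Z M : ℕ → (Fin r → ℂ) → Matrix ι ι ℂ}

/-- Along the ray the connection tends to ∑ω_a at q = 0, whose nonzero entries raise the degree by
one and which can therefore be conjugated below 1/4. That rate is chosen so that two such factors
lose only e^(−s/2) against the gain e^s. -/
theorem IsGauge.exists_growth (h : IsGauge P deg m Q A) (hP : IsGraded P deg)
    (hS : IsPencilSolution (connForm A) Z S) (hT : IsPencilInverse (connForm A) M T)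
    (t : Fin r → ℂ) :
    ∃ c s₁ : ℝ, ∀ s : ℝ, s ≤ s₁ → ∀ z : ℂ, ‖z‖ = 1 →
      ‖S (t + (s : ℂ) • (1 : Fin r → ℂ)) z‖ ≤ c * Real.exp (-s / 4) ∧
      ‖T (t + (s : ℂ) • (1 : Fin r → ℂ)) z‖ ≤ c * Real.exp (-s / 4) := by
  obtain ⟨d, d', hd, hlt⟩ := exists_diagonal_conj (deg := deg)
    (M := ∑ a, evalAt 0 (A a)) (ε := 1 / 4) (by
      intro j k hjk
      rw [Matrix.sum_apply] at hjk
      obtain ⟨a, -, ha⟩ := Finset.exists_ne_zero_of_sum_ne_zero hjk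
      rw [h.eval_zero, evalAt_zero_apply] at ha
      have := (hP.omega_homogeneous a).deg_eq ha
      omega) (by norm_num)
  have hlim : Filter.Tendsto
      (fun s : ℝ => ‖d * connForm A (t + (s : ℂ) • (1 : Fin r → ℂ)) 1 * d'‖) Filter.atBot
      (nhds ‖d * (∑ a, evalAt 0 (A a)) * d'‖) :=
    (((tendsto_connForm_line A t).const_mul d).mul_const d').norm
  obtain ⟨s₁, hs₁⟩ := Filter.eventually_atBot.1 (hlim.eventually_le_const hlt)
  obtain ⟨c, hc⟩ := exists_norm_le_of_conj_small hS hT (t := t) (v := 1) hd hs₁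
  exact ⟨c, s₁, hc⟩

theorem IsSolution.hasDerivAt_line {L : (Fin r → ℂ) → Circle → Matrix ι ι ℂ}
    (h : IsSolution P L) (t : Fin r → ℂ) (x : Circle) (s : ℝ) :
    HasDerivAt (fun s : ℝ => L (t + (s : ℂ) • (1 : Fin r → ℂ)) x)
      (L (t + (s : ℂ) • (1 : Fin r → ℂ)) x *
        ∑ a, Omega P a (expPoint (t + (s : ℂ) • (1 : Fin r → ℂ))) x) s := by
  have h1 : ∀ t, HasFDerivAt (fun t => L t x)
      (matForm fun a => L t x * Omega P a (expPoint t) x) t := by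
    intro t
    refine hasFDerivAt_matrix fun j k => ⟨_, fun v => ?_, (h.holomorphic x j k t).hasFDerivAt⟩
    rw [matForm_apply, Matrix.sum_apply]
    conv_lhs => rw [← Finset.univ_sum_single v]
    rw [map_sum]
    refine Finset.sum_congr rfl fun a _ => ?_
    rw [Matrix.smul_apply, show Pi.single a (v a) = v a • (Pi.single a 1 : Fin r → ℂ) by
      rw [← Pi.single_smul, smul_eq_mul, mul_one], map_smul, h.equation]
    rfl
  refine (QuantumDModule.hasDerivAt_line (h1 (t + (s : ℂ) • (1 : Fin r → ℂ)))).congr_deriv ?_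
  refine (matForm_apply _ 1).trans ?_
  simp only [Pi.one_apply, one_smul, Finset.mul_sum]

theorem character_eq_zpow (k : ℤ) (θ : ℝ) : character k θ = (Circle.exp θ : ℂ) ^ k := by
  rw [Circle.coe_exp, ← Complex.exp_int_mul, character, mul_assoc]

theorem isSeries_of_hasSum {e : ℕ → ℤ} {B : ℕ → Matrix ι ι ℂ} {g : Circle → Matrix ι ι ℂ}
    (h : ∀ x : Circle, HasSum (fun n => (x : ℂ) ^ e n • B n) (g x)) :
    IsSeries e B fun θ => g (Circle.exp θ) := by
  constructor
  · have h1 := (h 1).summable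
    simp only [Circle.coe_one, one_zpow, one_smul] at h1
    have h2 : FiniteDimensional ℝ (Matrix ι ι ℂ) := inferInstance
    exact (@summable_norm_iff ℕ (Matrix ι ι ℂ) _ _ h2 B).2 h1
  · intro θ
    refine HasSum.congr_fun (f := fun n => (Circle.exp θ : ℂ) ^ e n • B n) (h (Circle.exp θ))
      fun n => ?_
    rw [character_eq_zpow]

theorem isMinusSeries_of_hasSum {B : ℕ → Matrix ι ι ℂ} {g : Circle → Matrix ι ι ℂ} (h0 : B 0 = 1)
    (h : ∀ x : Circle, HasSum (fun n => (x : ℂ)⁻¹ ^ n • B n) (g x)) :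
    IsMinusSeries fun θ => g (Circle.exp θ) := by
  refine ⟨B, h0, isSeries_of_hasSum fun x => ?_⟩
  refine (h x).congr_fun fun n => ?_
  rw [zpow_neg, zpow_natCast, inv_pow]

theorem isPlusSeries_of_hasSum {B : ℕ → Matrix ι ι ℂ} {g : Circle → Matrix ι ι ℂ}
    (h : ∀ x : Circle, HasSum (fun n => (x : ℂ) ^ n • B n) (g x)) :
    IsPlusSeries B fun θ => g (Circle.exp θ) := by
  refine isSeries_of_hasSum fun x => ?_
  refine (h x).congr_fun fun n => ?_
  rw [zpow_natCast]

theorem continuous_ringInverse {X : Type*} [TopologicalSpace X] {f : X → Matrix ι ι ℂ}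
    (hf : Continuous f) (hu : ∀ x, IsUnit (f x)) : Continuous fun x => Ring.inverse (f x) :=
  continuous_iff_continuousAt.2 fun x => by
    obtain ⟨u, hu⟩ := hu x
    have h := NormedRing.inverse_continuousAt u
    rw [hu] at h
    exact ContinuousAt.comp (f := f) h hf.continuousAt

/-- A holomorphic family normalized at `q = 0` is close to `1` near `0`, uniformly on the circle. -/
theorem exists_norm_sub_one_le {F : (Fin r → ℂ) → Circle → Matrix ι ι ℂ} {ρ : ℝ}
    (hcont : ContinuousOn (fun p : (Fin r → ℂ) × Circle => F p.1 p.2)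
      (Metric.ball 0 ρ ×ˢ Set.univ))
    (hhol : ∀ x j k, DifferentiableOn ℂ (fun q => F q x j k) (Metric.ball (0 : Fin r → ℂ) ρ))
    (h0 : ∀ x, F 0 x = 1) {q : Fin r → ℂ} (hq : q ∈ Metric.ball (0 : Fin r → ℂ) ρ) :
    ∃ K : ℝ, ∀ s : ℝ, s ≤ 0 → ∀ x, ‖F (((Real.exp s : ℝ) : ℂ) • q) x - 1‖ ≤ K * Real.exp s := by
  rw [mem_ball_zero_iff] at hq
  -- The complex disc of radius R through the ray stays in the polydisc; R > 1 puts every e^s with s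
  -- ≤ 0, including s = 0, in its interior.
  obtain ⟨R, hRρ, hR⟩ : ∃ R : ℝ, R * ‖q‖ < ρ ∧ 1 < R := by
    have h1 : Filter.Tendsto (fun R : ℝ => R * ‖q‖) (nhdsWithin 1 (Set.Ioi 1)) (nhds (1 * ‖q‖)) :=
      ((continuous_id.mul continuous_const).tendsto 1).mono_left nhdsWithin_le_nhds
    rw [one_mul] at h1
    exact ((h1.eventually_lt_const hq).and self_mem_nhdsWithin).exists
  have hmem : ∀ y : ℂ, ‖y‖ ≤ R → y • q ∈ Metric.ball (0 : Fin r → ℂ) ρ := by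
    intro y hy
    rw [mem_ball_zero_iff, norm_smul]
    exact (mul_le_mul_of_nonneg_right hy (norm_nonneg q)).trans_lt hRρ
  have hc : ContinuousOn (fun p : ℂ × Circle => F (p.1 • q) p.2)
      (Metric.closedBall 0 R ×ˢ Set.univ) := by
    refine ContinuousOn.comp (g := fun p : (Fin r → ℂ) × Circle => F p.1 p.2)
      (f := fun p : ℂ × Circle => (p.1 • q, p.2)) hcont (by fun_prop) ?_
    rintro ⟨y, x⟩ ⟨hy, -⟩
    exact ⟨hmem y (by simpa using hy), trivial⟩
  obtain ⟨c, hc⟩ := ((isCompact_closedBall (0 : ℂ) R).prod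
    (isCompact_univ (X := Circle))).exists_bound_of_continuousOn hc
  refine ⟨2 * c, fun s hs x => ?_⟩
  have hd : DifferentiableOn ℂ (fun y : ℂ => F (y • q) x) (Metric.ball 0 R) := by
    have : ∀ j k, DifferentiableOn ℂ (fun y : ℂ => F (y • q) x j k) (Metric.ball 0 R) := by
      intro j k
      refine (hhol x j k).comp (by fun_prop) fun y hy => hmem y ?_
      rw [mem_ball_zero_iff] at hy
      exact hy.le
    exact differentiableOn_pi.2 fun j => differentiableOn_pi.2 fun k => this j k
  have hes : ‖((Real.exp s : ℝ) : ℂ)‖ = Real.exp s := by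
    rw [Complex.norm_real, Real.norm_of_nonneg (Real.exp_pos s).le]
  have := norm_sub_one_le_of_bound hR.le hd (by rw [zero_smul, h0])
    (fun y hy => hc (y, x) ⟨Metric.ball_subset_closedBall hy, trivial⟩)
    (x := ((Real.exp s : ℝ) : ℂ)) (by
      rw [mem_ball_zero_iff, hes]
      exact (Real.exp_le_one_iff.2 hs).trans_lt hR)
  rwa [hes] at this

end Uniqueness

end QuantumDModule

namespace QuantumDModule

/-! ### Identification of the plus factor with the gauge transformation. -/

section PlusUnique

attribute [local instance] Matrix.linftyOpNormedRing Matrix.linftyOpNormedAlgebra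

set_option linter.unusedSectionVars false

variable {r : ℕ} {ι : Type*} [Fintype ι] [DecidableEq ι]
  {κ : Type*} {N : κ → MvPolynomial (Fin r) (Coeff r)}
  {P : Module.Basis ι (Coeff r) (DMod N)} {deg : ι → ℕ} {m : ℕ}
  {Q : ℕ → Matrix ι ι (QPoly r)} {A : Fin r → Matrix ι ι (QPoly r)}

/-- Along a line both families solve the same ordinary differential equation for each h; the
constant of proportionality is continuous in h, hence bounded on the circle. -/
theorem exists_const_mul_eq {L L₀ : (Fin r → ℂ) → Circle → Matrix ι ι ℂ}
    (h : IsSolution P L) (h₀ : IsSolution P L₀) (t : Fin r → ℂ) :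
    ∃ (C : Circle → Matrix ι ι ℂ) (c : ℝ), (∀ x, ‖C x‖ ≤ c) ∧
      ∀ (s : ℝ) (x : Circle), L (t + (s : ℂ) • (1 : Fin r → ℂ)) x =
        C x * L₀ (t + (s : ℂ) • (1 : Fin r → ℂ)) x := by
  have hcont : ∀ {F : (Fin r → ℂ) → Circle → Matrix ι ι ℂ}, IsSolution P F → ∀ t,
      Continuous (F t) := fun hF t => hF.continuous.comp (continuous_const.prodMk continuous_id)
  set t₀ := t + ((0 : ℝ) : ℂ) • (1 : Fin r → ℂ)
  have hC : Continuous fun x => L t₀ x * Ring.inverse (L₀ t₀ x) :=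
    (hcont h t₀).mul (continuous_ringInverse (hcont h₀ t₀) (h₀.loop t₀).1)
  obtain ⟨c, hc⟩ := (isCompact_univ (X := Circle)).exists_bound_of_continuousOn hC.continuousOn
  exact ⟨_, c, fun x => hc x trivial, fun s x => eq_const_mul_of_hasDerivAt
    (h.hasDerivAt_line t x) (h₀.hasDerivAt_line t x) (fun s => (h₀.loop _).1 x) s⟩

/-- Nonzero coordinates allow q = exp t, and the ray t + s(1,…,1) brings e^s q to 0 inside the
polydisc. The growth criterion applies with g = L₊G⁻¹, m = L₋ and n = S; so L₊G⁻¹ is a minus loop at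
q, and a quotient of plus loops which is a minus loop is trivial. -/
theorem IsGauge.coeff_eq_of_ne_zero (h : IsGauge P deg m Q A) (hP : IsGraded P deg)
    (hm : ∀ j, deg j ≤ m) {ρ : ℝ} {L Lminus Lplus : (Fin r → ℂ) → Circle → Matrix ι ι ℂ}
    {B : ℕ → (Fin r → ℂ) → Matrix ι ι ℂ} (hL : IsSolution P L)
    (hB : IsNormalizedBirkhoff ρ L Lminus Lplus B) {q : Fin r → ℂ}
    (hq : q ∈ Metric.ball (0 : Fin r → ℂ) ρ) (hq0 : ∀ a, q a ≠ 0) :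
    (fun n => B n q) = fun n => evalAt q (gaugeCoeff Q n) := by
  obtain ⟨⟨Z, S, hS⟩, M, T, hT⟩ := h.exists_isPencilSolution
  have hunit := h.triangular.isUnit_gaugeMat hm
  obtain ⟨G', hGG', hG'G⟩ := isUnit_iff_exists.1 hunit
  obtain ⟨G, hG⟩ : ∃ G, G = gaugeMat m Q := ⟨_, rfl⟩
  have hL₀ := h.isSolution hm hS hT
  have hev0 := fun z => h.evalMat_zero (m := m) z
  rw [← hG] at hunit hGG' hG'G hL₀
  simp only [← hG] at hev0
  have hplus₀ := isPlusLoop_evalMat hunit q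
  rw [show (fun n => evalAt q (hCoeffMat n G)) = fun n => evalAt q (gaugeCoeff Q n) from
    funext fun n => by rw [hG, hCoeffMat_gaugeMat hm h.triangular]] at hplus₀
  have hev : ∀ q z, evalMat q z G' * evalMat q z G = 1 := fun q z => by
    rw [← map_mul, hG'G, map_one]
  have hev' : ∀ q z, evalMat q z G * evalMat q z G' = 1 := fun q z => by
    rw [← map_mul, hGG', map_one]
  set t : Fin r → ℂ := fun a => Complex.log (q a) with ht
  have hexp : expPoint t = q := funext fun a => Complex.exp_log (hq0 a)
  obtain ⟨C, c', hC, hLC⟩ := exists_const_mul_eq hL hL₀ t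
  obtain ⟨c, s₁, hgrow⟩ := h.exists_growth hP hS hT t
  set τ : ℝ → Fin r → ℂ := fun s => t + (s : ℂ) • (1 : Fin r → ℂ) with hτ
  have hτe : ∀ s, expPoint (τ s) = ((Real.exp s : ℝ) : ℂ) • q := fun s => by
    rw [hτ]; dsimp only; rw [expPoint_line, hexp]
  have hmem : ∀ s ≤ 0, expPoint (τ s) ∈ Metric.ball (0 : Fin r → ℂ) ρ := by
    intro s hs
    rw [hτe, mem_ball_zero_iff, norm_smul, Complex.norm_real,
      Real.norm_of_nonneg (Real.exp_pos s).le]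
    rw [mem_ball_zero_iff] at hq
    exact (mul_le_of_le_one_left (norm_nonneg q) (Real.exp_le_one_iff.2 hs)).trans_lt hq
  have hτ0 : expPoint (τ 0) = q := by rw [hτe, Real.exp_zero, Complex.ofReal_one, one_smul]
  have hcoe : Continuous fun x : Circle => (x : ℂ) := continuous_subtype_val
  have hnorm : ∀ θ, ‖((Circle.exp θ : Circle) : ℂ)⁻¹‖ = 1 := fun θ => by
    rw [norm_inv, Circle.norm_coe, inv_one]
  -- the quotient of the two plus factors
  obtain ⟨K, hK⟩ := exists_norm_sub_one_le (F := fun q x => Lplus q x * evalMat q x G')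
    (ContinuousOn.mul (M := Matrix ι ι ℂ) hB.plus_continuous
      (continuous_evalMat continuous_fst (hcoe.comp continuous_snd) G').continuousOn)
    (fun x j k => by
      simp only [Matrix.mul_apply]
      exact DifferentiableOn.fun_sum fun i _ => (hB.plus_holomorphic x j i).mul
        (differentiable_evalMat_left _ _ i k).differentiableOn)
    (fun x => by
      have h1 := hev 0 (x : ℂ)
      rw [hev0, mul_one] at h1
      rw [hB.normalized, one_mul, h1]) hq
  have hminus := isMinusFourier_of_growth (C := fun θ => C (Circle.exp θ))
    (m := fun s θ => Lminus (τ s) (Circle.exp θ))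
    (m' := fun s θ => (Lminus (τ s) (Circle.exp θ))⁻¹)
    (n := fun s θ => S (τ s) (Circle.exp θ : ℂ)⁻¹)
    (n' := fun s θ => T (τ s) (Circle.exp θ : ℂ)⁻¹)
    (g := fun s θ => Lplus (expPoint (τ s)) (Circle.exp θ) *
      evalMat (expPoint (τ s)) (Circle.exp θ) G') (K := K) (c := c) (c' := c') (s₁ := s₁)
    (fun s hs => by
      obtain ⟨A, hA, hsum⟩ := (hB.minus_loop (τ s) (hmem s hs)).2.1
      exact isMinusSeries_of_hasSum hA hsum)
    (by
      obtain ⟨A, hA, hsum⟩ := (hB.minus_loop (τ 0) (hmem 0 le_rfl)).2.2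
      exact isMinusSeries_of_hasSum (g := fun x => (Lminus (τ 0) x)⁻¹) hA hsum)
    (fun s hs => isMinusSeries_of_hasSum (g := fun x => S (τ s) (x : ℂ)⁻¹) (hS.zero _)
      fun x => hS.hasSum _ _)
    (fun s hs => isMinusSeries_of_hasSum (g := fun x => T (τ s) (x : ℂ)⁻¹) (hT.zero _)
      fun x => hT.hasSum _ _)
    (fun θ => Matrix.nonsing_inv_mul _ ((Matrix.isUnit_iff_isUnit_det _).1
      ((hB.minus_loop (τ 0) (hmem 0 le_rfl)).1.1 _)))
    (fun s θ => hS.mul_inverse hT _ _)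
    (fun s hs => (isPlusSeries_of_hasSum (hB.plus_loop _ (hmem s hs)).2.1).continuous.mul
      (isPlusSeries_of_hasSum fun x => hasSum_evalMat _ _ G').continuous)
    (fun s hs θ => by
      have h1 := hB.factorization (τ s) (hmem s hs) (Circle.exp θ)
      rw [hLC] at h1
      have h2 := congrArg (fun X => X * evalMat (expPoint (τ s)) (Circle.exp θ) G') h1
      rw [mul_assoc, mul_assoc (S _ _), hev', mul_one, mul_assoc] at h2
      exact h2)
    (fun θ => hC _) (fun s hs θ => (hgrow s hs _ (hnorm θ)).1)
    (fun s hs θ => (hgrow s hs _ (hnorm θ)).2)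
    (fun s hs θ => by
      rw [hτe]
      exact hK s hs _)
  simp only [hτ0] at hminus
  exact IsPlusSeries.eq_of_isMinusFourier
    (isPlusSeries_of_hasSum (hB.plus_loop q hq).2.1) (isPlusSeries_of_hasSum hplus₀.2.1)
    (isPlusSeries_of_hasSum (g := fun x => evalMat q x G') fun x => hasSum_evalMat _ _ G')
    (fun θ => hev _ _) hminus

theorem eq_of_hasSum_circle {B B' : ℕ → Matrix ι ι ℂ} {g : Circle → Matrix ι ι ℂ}
    (h : ∀ x : Circle, HasSum (fun n => (x : ℂ) ^ n • B n) (g x))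
    (h' : ∀ x : Circle, HasSum (fun n => (x : ℂ) ^ n • B' n) (g x)) : B = B' := by
  funext n
  have h1 := (isPlusSeries_of_hasSum h).fcoeff_eq n
  rw [(isPlusSeries_of_hasSum h').fcoeff_eq n] at h1
  exact (smul_right_injective (Matrix ι ι ℂ) (r := (2 * Real.pi : ℂ))
    (by exact_mod_cast Real.two_pi_pos.ne') h1).symm

/-- The plus factor of a normalized Birkhoff factorization is the gauge transformation. -/
theorem IsGauge.plus_eq (h : IsGauge P deg m Q A) (hP : IsGraded P deg)
    (hm : ∀ j, deg j ≤ m) {ρ : ℝ} {L Lminus Lplus : (Fin r → ℂ) → Circle → Matrix ι ι ℂ}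
    {B : ℕ → (Fin r → ℂ) → Matrix ι ι ℂ} (hL : IsSolution P L)
    (hB : IsNormalizedBirkhoff ρ L Lminus Lplus B) {q : Fin r → ℂ}
    (hq : q ∈ Metric.ball (0 : Fin r → ℂ) ρ) :
    (∀ n, B n q = evalAt q (gaugeCoeff Q n)) ∧ ∀ x : Circle, Lplus q x =
      evalMat q x (gaugeMat m Q) := by
  have hsum : ∀ q (x : Circle), HasSum (fun n => (x : ℂ) ^ n • evalAt q (gaugeCoeff Q n))
      (evalMat q x (gaugeMat m Q)) := fun q x => by
    simpa only [hCoeffMat_gaugeMat hm h.triangular] using hasSum_evalMat q x (gaugeMat m Q)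
  have hne : ∀ q ∈ Metric.ball (0 : Fin r → ℂ) ρ, (∀ a, q a ≠ 0) → ∀ x : Circle, Lplus q x =
      evalMat q x (gaugeMat m Q) := by
    intro q hq hq0 x
    have h1 := (hB.plus_loop q hq).2.1 x
    rw [h.coeff_eq_of_ne_zero hP hm hL hB hq hq0] at h1
    exact h1.unique (hsum q x)
  have hall : ∀ x : Circle, Lplus q x = evalMat q x (gaugeMat m Q) := by
    intro x
    -- Replacing the zero coordinates by ε ≠ 0 reaches points where the equality is known; both
    -- sides are continuous as ε → 0.
    set γ : ℝ → Fin r → ℂ := fun ε a => if q a = 0 then (ε : ℂ) else q a with hγ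
    have hγc : Continuous γ := continuous_pi fun a => by
      by_cases ha : q a = 0
      · simpa [hγ, ha] using Complex.continuous_ofReal
      · simpa [hγ, ha] using continuous_const
    have hγ0 : γ 0 = q := by
      funext a
      by_cases ha : q a = 0 <;> simp [hγ, ha]
    have hlim : Filter.Tendsto γ (nhdsWithin 0 {0}ᶜ) (nhds q) := by
      rw [← hγ0]
      exact (hγc.tendsto 0).mono_left nhdsWithin_le_nhds
    have hcont : ContinuousAt (fun q => Lplus q x) q := by
      have h1 : ContinuousAt (fun p : (Fin r → ℂ) × Circle => Lplus p.1 p.2) (q, x) :=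
        hB.plus_continuous.continuousAt
          ((Metric.isOpen_ball.prod isOpen_univ).mem_nhds ⟨hq, trivial⟩)
      exact ContinuousAt.comp (f := fun q => (q, x)) h1 (by fun_prop)
    have hcont' : Continuous fun q : Fin r → ℂ => evalMat q (x : ℂ) (gaugeMat m Q) :=
      continuous_evalMat continuous_id continuous_const _
    refine tendsto_nhds_unique_of_eventuallyEq (hcont.tendsto.comp hlim)
      ((hcont'.tendsto q).comp hlim) ?_
    filter_upwards [hlim.eventually (Metric.isOpen_ball.mem_nhds hq), self_mem_nhdsWithin]
      with ε h1 h2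
    refine hne _ h1 (fun a => ?_) x
    by_cases ha : q a = 0
    · simpa [hγ, ha] using h2
    · simp [hγ, ha]
  refine ⟨fun n => congrFun (eq_of_hasSum_circle (B := fun n => B n q)
    (B' := fun n => evalAt q (gaugeCoeff Q n)) (hB.plus_loop q hq).2.1 fun x => ?_) n, hall⟩
  rw [hall]
  exact hsum q x

end PlusUnique

end QuantumDModule

namespace QuantumDModule

/-! ### Solution by quadrature -/

section Quadrature

set_option linter.unusedSectionVars false

variable {r : ℕ} {κ ι : Type*} [Fintype ι] [DecidableEq ι]
  {N : κ → MvPolynomial (Fin r) (Coeff r)}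
  {P : Module.Basis ι (Coeff r) (DMod N)} {deg : ι → ℕ} {m : ℕ}
  {Q Q' : ℕ → Matrix ι ι (QPoly r)} {A : Fin r → Matrix ι ι (QPoly r)}

theorem logDeriv_diagPart (a : Fin r) (l : ℤ) (M : Matrix ι ι (QPoly r)) :
    logDeriv a (diagPart deg l M) = diagPart deg l (logDeriv a M) := by
  ext1 j k
  rw [logDeriv_apply, diagPart, diagPart, Matrix.of_apply, Matrix.of_apply, logDeriv_apply]
  split_ifs <;> simp

theorem evalAt_diagPart (q : Fin r → ℂ) (l : ℤ) (M : Matrix ι ι (QPoly r)) :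
    evalAt q (diagPart deg l M) = diagPart deg l (evalAt q M) := by
  ext1 j k
  rw [evalAt, diagPart, diagPart, evalAt, Matrix.map_apply, Matrix.of_apply, Matrix.of_apply,
    Matrix.map_apply]
  split_ifs <;> simp

theorem eq_of_logDeriv_eq {M M' : Matrix ι ι (QPoly r)} (h : ∀ a, logDeriv a M = logDeriv a M')
    (h0 : evalAt 0 M = evalAt 0 M') : M = M' := by
  ext1 j k
  refine eq_of_X_mul_pderiv_eq (fun a => ?_) ?_
  · rw [← logDeriv_apply, h, logDeriv_apply]
  · rw [← evalAt_zero_apply, h0, evalAt_zero_apply]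

theorem Precedes.trans {p p' p'' : ℕ × ℕ} (h : Precedes p p') (h' : Precedes p' p'') :
    Precedes p p'' := by
  unfold Precedes at *
  omega

theorem IsGauge.evalAt_zero_diagPart (h : IsGauge P deg m Q A) {l : ℕ} (hl : 2 ≤ l) (i : ℕ) :
    evalAt 0 (diagPart deg l (Q i)) = 0 := by
  rw [evalAt_diagPart, h.initial]
  ext j k
  rw [diagPart, Matrix.of_apply, Matrix.zero_apply]
  split_ifs with h1 h2
  · rw [Matrix.one_apply_ne]
    rintro rfl
    omega
  · rfl
  · rfl

/-- Induction on the rank: at each stage both families have the same right-hand side by triangular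
dependence and the same value at q = 0, so the primitives coincide. -/
theorem IsGauge.diagPart_eq (h : IsGauge P deg m Q A) (hP : IsGraded P deg)
    (hm : ∀ j, deg j ≤ m) (hQ' : IsTriangularFamily deg Q') {p : ℕ × ℕ}
    (hprev : ∀ p', IsIndex m p' → Precedes p' p →
      evalAt 0 (diagPart deg p'.2 (Q' p'.1)) = 0 ∧
      ∀ a, logDeriv a (diagPart deg p'.2 (Q' p'.1)) = diagPart deg p'.2 (systemRhs P Q' p'.1 a)) :
    ∀ p', IsIndex m p' → Precedes p' p →
      diagPart deg p'.2 (Q' p'.1) = diagPart deg p'.2 (Q p'.1) := by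
  intro p'
  induction hn : indexRank m p' using Nat.strong_induction_on generalizing p' with
  | _ n ih =>
    intro hi hp
    refine eq_of_logDeriv_eq (fun a => ?_) ?_
    · rw [(hprev p' hi hp).2, hP.diagPart_systemRhs_eq hm hQ' h.triangular
        (fun p'' hi' hp' => ih _ (hn ▸ indexRank_lt hi' hi hp') p'' rfl hi' (hp'.trans hp)),
        ← h.system, logDeriv_diagPart]
    · have := hi.1
      rw [(hprev p' hi hp).1, h.evalAt_zero_diagPart (by omega)]

theorem hasDerivAt_eval_smul (f : QPoly r) (q : Fin r → ℂ) (x : ℝ) :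
    HasDerivAt (fun x : ℝ => MvPolynomial.eval (fun b => (x : ℂ) * q b) f)
      (∑ a, MvPolynomial.eval (fun b => (x : ℂ) * q b) (MvPolynomial.pderiv a f) * q a) x := by
  have h := hasFDerivAt_eval f (g := fun (z : ℂ) b => z * q b)
    (g' := fun b => (1 : ℂ →L[ℂ] ℂ).smulRight (q b)) (t := (x : ℂ))
    fun b => ((1 : ℂ →L[ℂ] ℂ).smulRight (q b)).hasFDerivAt
  refine (h.hasDerivAt.comp_ofReal).congr_deriv ?_
  simp

theorem eval_eq_integral {f : QPoly r} (h0 : MvPolynomial.constantCoeff f = 0)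
    (q : Fin r → ℂ) :
    MvPolynomial.eval q f = ∫ x : ℝ in (0 : ℝ)..1, ∑ a, (x : ℂ)⁻¹ *
      MvPolynomial.eval (fun b => (x : ℂ) * q b)
        (MvPolynomial.X a * MvPolynomial.pderiv a f) := by
  have hcont : ∀ g : QPoly r, Continuous fun x : ℝ =>
      MvPolynomial.eval (fun b => (x : ℂ) * q b) g := fun g =>
    (MvPolynomial.continuous_eval g).comp (by fun_prop)
  have h1 := intervalIntegral.integral_eq_sub_of_hasDerivAt (a := 0) (b := 1)
    (fun x _ => hasDerivAt_eval_smul f q x) (Continuous.intervalIntegrable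
      (continuous_finsetSum _ fun a _ => (hcont _).mul continuous_const) _ _)
  have h2 : MvPolynomial.eval (fun b => ((0 : ℝ) : ℂ) * q b) f = 0 := by
    simp only [Complex.ofReal_zero, zero_mul]
    rw [← MvPolynomial.eval_zero] at h0
    exact h0
  rw [h2] at h1
  simp only [Complex.ofReal_one, one_mul, sub_zero] at h1
  rw [← h1]
  -- The interval of integration is (0, 1], so the factor x⁻¹ cancels the x in xq_a without regard
  -- to x = 0.
  refine intervalIntegral.integral_congr_ae (.of_forall fun x hx => ?_)
  rw [Set.uIoc_of_le zero_le_one] at hx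
  have hx0 : (x : ℂ) ≠ 0 := by exact_mod_cast hx.1.ne'
  refine Finset.sum_congr rfl fun a _ => ?_
  rw [map_mul, MvPolynomial.eval_X]
  field_simp

/-- For any family with the smaller unknowns already determined, the right-hand side equals the one
for `Q`, that is, the logarithmic differential of Q_i^{[j]}. Closedness, uniqueness and the integral
formula are then properties of an exact form. -/
theorem IsGauge.solvedByQuadrature (h : IsGauge P deg m Q A) (hP : IsGraded P deg)
    (hm : ∀ j, deg j ≤ m) : SolvedByQuadrature P deg m Q := by
  refine ⟨h.system, by simpa using h.initial 0, fun i hi => ?_,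
    fun p _ Q' Q'' hQ' hQ'' hprev a => hP.diagPart_systemRhs_eq hm hQ' hQ'' hprev a,
    fun p hi Q' hQ' hprev => ?_⟩
  · rw [h.initial, if_neg (by omega)]
  have hrhs : ∀ a, diagPart deg p.2 (systemRhs P Q' p.1 a) =
      logDeriv a (diagPart deg p.2 (Q p.1)) := fun a => by
    rw [hP.diagPart_systemRhs_eq hm hQ' h.triangular (h.diagPart_eq hP hm hQ' hprev), ← h.system,
      logDeriv_diagPart]
  have h0 : evalAt 0 (diagPart deg p.2 (Q p.1)) = 0 :=
    h.evalAt_zero_diagPart (by have := hi.1; omega) _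
  simp only [hrhs]
  refine ⟨fun a b => logDeriv_comm _ _ _, fun Y => ⟨fun ⟨h1, h2⟩ => ?_, ?_⟩, fun q j k => ?_⟩
  · exact eq_of_logDeriv_eq h2 (h1.trans h0.symm)
  · rintro rfl
    exact ⟨h0, fun a => rfl⟩
  · have h1 := congrFun (congrFun h0 j) k
    rw [evalAt_zero_apply] at h1
    exact eval_eq_integral h1 q

theorem evalMat_gaugeMat_eq (hm : ∀ j, deg j ≤ m) (hQ : IsTriangularFamily deg Q)
    (q : Fin r → ℂ) (z : ℂ) :
    evalMat q z (gaugeMat m Q) = evalAt q (Q 0) *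
      (1 + ∑ i ∈ Finset.Icc 1 (m - 2), z ^ i • evalAt q (Q i)) := by
  have h1 : ∑ i ∈ insert 0 (Finset.Icc 1 (m - 2)), z ^ i • evalAt q (gaugeCoeff Q i) =
      evalMat q z (gaugeMat m Q) := by
    rw [evalMat_gaugeMat]
    -- The indices i ≥ 1 beyond m − 2 contribute nothing, since i + 2 exceeds m. If m ≤ 2 the
    -- truncated difference is 0 and only Q₀ remains.
    refine Finset.sum_subset (fun i hi => ?_) fun i hi hi' => ?_
    · rw [Finset.mem_insert, Finset.mem_Icc] at hi
      rw [Finset.mem_range]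
      omega
    · rw [Finset.mem_insert, Finset.mem_Icc] at hi'
      rw [gaugeCoeff, if_neg (by omega), (hQ.2 i (by omega)).eq_zero hm (by omega), mul_zero]
      ext j k
      simp [evalAt]
  rw [← h1, Finset.sum_insert (by simp), pow_zero, one_smul, mul_add, mul_one, Finset.mul_sum]
  congr 1
  refine Finset.sum_congr rfl fun i hi => ?_
  rw [Finset.mem_Icc] at hi
  rw [gaugeCoeff, if_neg (by omega), evalAt_mul, mul_smul_comm]

end Quadrature

end QuantumDModule
-- Proof of the proposition.
open QuantumDModule in
theorem proposition2p2 {r : ℕ} {κ ι : Type*} [Fintype ι] [DecidableEq ι]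
    (R : κ → MvPolynomial (Fin r) (QPoly r)) (N : κ → MvPolynomial (Fin r) (Coeff r))
    (hN : IsQuantization R N)
    (e : ι → Fin r →₀ ℕ) (P : Module.Basis ι (Coeff r) (DMod N))
    (hP : ∀ j, P j = DMod.mk N (monomialOp (e j)))
    (deg : ι → ℕ) (hdeg : ∀ j, deg j = (e j).degree)
    (m : ℕ) (hm : m = Finset.univ.sup deg) :
    ∃ Q : ℕ → Matrix ι ι (QPoly r),
      (∀ ρ : ℝ, 0 < ρ → ∃ L Lminus Lplus B,
        IsSolution P L ∧ IsNormalizedBirkhoff ρ L Lminus Lplus B) ∧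
      (∀ ρ : ℝ, 0 < ρ → ∀ L Lminus Lplus B,
        IsSolution P L → IsNormalizedBirkhoff ρ L Lminus Lplus B →
        ∀ q ∈ Metric.ball (0 : Fin r → ℂ) ρ,
          B 0 q = evalAt q (Q 0) ∧
          (∀ i, 1 ≤ i → B i q = evalAt q (Q 0) * evalAt q (Q i)) ∧
          ∀ h : Circle, Lplus q h =
            evalAt q (Q 0) *
              (1 + ∑ i ∈ Finset.Icc 1 (m - 2), (h : ℂ) ^ i • evalAt q (Q i))) ∧
      (∃ X : Matrix ι ι (QPoly r), IsTriangular deg 2 X ∧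
        ∀ q, evalAt q (Q 0) = NormedSpace.exp (evalAt q X)) ∧
      (∀ i : ℕ, 1 ≤ i → IsTriangular deg ((i : ℤ) + 2) (Q i)) ∧
      (∀ i j k, MvPolynomial.IsWeightedHomogeneous (fun _ : Fin r => (4 : ℤ)) (Q i j k)
        (2 * ((deg k : ℤ) - deg j - i))) ∧
      (∀ i, 1 ≤ i → m < i + 2 → Q i = 0) ∧
      SolvedByQuadrature P deg m Q := by
  have hm' : ∀ j, deg j ≤ m := fun j => hm ▸ Finset.le_sup (Finset.mem_univ j)
  have hgr : IsGraded P deg := ⟨fun a j k => by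
    rw [hdeg, hdeg]
    exact hOmega_isWeightedHomogeneous hN.homogeneous hP a j k,
    constantCoeff_theta hN hP⟩
  obtain ⟨Q, A, h⟩ := hgr.exists_isGauge hm'
  refine ⟨Q, fun ρ _ => ?_, fun ρ _ L Lminus Lplus B hL hB q hq => ?_,
    exists_isTriangular_exp_eq h.triangular.1, h.triangular.2, h.homogeneous,
    fun i hi hmi => (h.triangular.2 i hi).eq_zero hm' (by omega), h.solvedByQuadrature hgr hm'⟩
  · obtain ⟨⟨Z, S, hS⟩, M, T, hT⟩ := h.exists_isPencilSolution
    exact ⟨_, _, _, _, h.isSolution hm' hS hT, h.isNormalizedBirkhoff hm' hS hT ρ⟩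
  · obtain ⟨h1, h2⟩ := h.plus_eq hgr hm' hL hB hq
    refine ⟨?_, fun i hi => ?_, fun x => ?_⟩
    · rw [h1, gaugeCoeff, if_pos rfl]
    · rw [h1, gaugeCoeff, if_neg (by omega), evalAt_mul]
    · rw [h2, evalMat_gaugeMat_eq hm' h.triangular]
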